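/- Let $G=(V,E)$ be an infinite, connected, locally finite, vertex-transitive graph with a fixed vertex $o$. For $p\in[0,1]$ let $\mathrm P_p$ be Bernoulli bond percolation on $G$ (each edge is open with probability $p$, independently of all others), and let $p_c=\inf\{p\in[0,1]:\mathrm P_p(o\leftrightarrow\infty)>0\}$, where $o\leftrightarrow\infty$ means that the open cluster of $o$ is infinite. For a set $A$ of vertices let $\partial A$ be the set of edges with exactly one endpoint in $A$, and for real $t$ let $$\Phi(t)=\min\{|\partial A| : A\subset V,\ t\le |A|<\infty\}.$$ For a finite non-empty set $S\subset V$ and $n\in\mathbb N=\{0,1,2,\dots\}$, let $\mathrm B_n(S)$ be the set of vertices at graph distance at most $n$ from $S$, and let $\mathcal C_S^n$ be the set of all $v\in \mathrm B_n(S)$ that are connected to $S$ by a path of open edges with all endpoints in $\mathrm B_n(S)$. **Theorem.** For every $p\in(p_c,1]$ there is a constant $c>0$ such that for every finite non-empty set $S\subset V$, $$\mathrm P_p\big(\forall n\in\mathbb N:\ |\mathcal C_S^n|\ge v_n\big)\ \ge\ 1-\sum_{n\ge |S|}e^{-c\,\Phi(n)},$$ where, for each $n\in\mathbb N$, $v_n=v_n(S)$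 is the (unique) real number determined by $$\int_{|S|}^{v_n}\frac{1}{c\,\Phi(t)}\,dt=n .$$ -/

import Mathlib

open MeasureTheory ProbabilityTheory

namespace Perc

variable {V : Type*}

/-- A (vertex-)transitive graph. -/
def Transitive (G : SimpleGraph V) : Prop :=
  ∀ u v : V, ∃ φ : G ≃g G, φ u = v

/-- The edge boundary `∂A`: the edges with exactly one endpoint in `A`. -/
def edgeBoundary (G : SimpleGraph V) (A : Set V) : Set (Sym2 V) :=
  {e | ∃ u v : V, G.Adj u v ∧ u ∈ A ∧ v ∉ A ∧ e = s(u, v)}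

/-- The isoperimetric function `Φ(x) = min {|∂A| : A ⊆ V finite, |A| ≥ x}`. The argument is a real
number, since `Φ` is both evaluated at integers and integrated over real intervals. -/
noncomputable def isoperimetric (G : SimpleGraph V) (x : ℝ) : ℕ :=
  sInf {k | ∃ A : Finset V, x ≤ (A.card : ℝ) ∧ k = (edgeBoundary G (A : Set V)).ncard}

/-- `B_n(S)`: the vertices at graph distance at most `n` from `S`. -/
def ball (G : SimpleGraph V) (S : Set V) (n : ℕ) : Set V :=
  {v | ∃ s ∈ S, G.edist s v ≤ (n : ℕ∞)}

/-- A percolation configuration: every edge is either open (`true`) or closed (`false`). -/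
abbrev Config (G : SimpleGraph V) : Type _ := G.edgeSet → Bool

/-- The percolation measure `P_p`: each edge is open with probability `p`, independently. -/
noncomputable def measure (G : SimpleGraph V) (p : unitInterval) : Measure (Config G) :=
  Measure.infinitePi fun _ : G.edgeSet => bernoulliMeasure true false p

/-- The graph on `V` whose edges are the open edges of `ω` with both endpoints in `A`. -/
def openGraph {G : SimpleGraph V} (ω : Config G) (A : Set V) : SimpleGraph V where
  Adj u v := u ∈ A ∧ v ∈ A ∧ ∃ h : G.Adj u v, ω ⟨s(u, v), h⟩ = true
  symm := ⟨by
    rintro u v ⟨hu, hv, h, ho⟩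
    refine ⟨hv, hu, h.symm, ?_⟩
    rw [← ho]
    exact congrArg ω (Subtype.ext Sym2.eq_swap)⟩
  loopless := ⟨by
    rintro u ⟨_, _, h, _⟩
    exact h.ne rfl⟩

/-- The vertices of `A` connected to `S` by open paths inside `A`. -/
def cluster {G : SimpleGraph V} (ω : Config G) (A S : Set V) : Set V :=
  {v | v ∈ A ∧ ∃ s ∈ S, (openGraph ω A).Reachable v s}

/-- The critical point `p_c = inf {p ∈ [0,1] : P_p(o ↔ ∞) > 0}`, where `o ↔ ∞` means that the
open cluster of `o` is infinite. -/
noncomputable def criticalPoint (G : SimpleGraph V) (o : V) : ℝ :=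
  sInf {p : ℝ | ∃ hp : p ∈ unitInterval,
    0 < measure G ⟨p, hp⟩ {ω | (cluster ω Set.univ {o}).Infinite}}

end Perc

/-! Choose `π < p` at which percolation occurs and keep `p - π` for sprinkling. The growth of the
cluster is driven by how hard it is to separate a finite set `A` from the complement of a large
finite set `Λ` by closed edges.

Separation (`exists_ex_Sep_le_exp`). If every finite superset of `A` has at least `K` boundary
edges, then separation has probability at most `exp (-c K)`. Large balls are rarely cut off
(`exists_radius`). By Harris' inequality and the positive probability of closing a few edges, the
cluster of a ball inside `W \ I` usually has many edges to `I` or many edges to the complement of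
`W`. The set of points of the first kind has at least `K` boundary edges, so the two kinds are
adjacent at order `K` well-spread places. Opening a whole ball at such a place lowers the chance of
separation by a constant factor (`ex_Sep_le_of_budget`).

Growth. Let `κ` be minus the logarithm of the separation probability of `A` (`sepCost`), at slightly
reduced density. Thinning shows that, outside an event of probability `exp (-κ/2)`, every `A'`
between `A` and `Λ` has order `κ` open boundary edges (`ex_Thin_le`). An exploration started at `A`
then gains order `κ` vertices per step for as long as `κ` is comparable to the cost of its current
set. When that cost has become much larger, the argument is restarted from the current set. The
coins on its boundary have partly been seen by then, so every edge carries two independent coins and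
a restart uses fresh second coins on the boundary. The recorded cost at least quadruples at each
later restart, so the failure probabilities sum to a constant times that of the first one
(`ex_exists_BadRestart_le`). Cost is subadditive in the available edges and does not increase as the
set grows with a fixed set of available edges, so between restarts it stays below six times the
recorded value.

Each step thus adds at least `b Φ(|A|)` vertices (`card_explore_succ_ge`), which is compared with
the flow `v' = c Φ(v)`. The constant in front of the failure probability is absorbed by the sum over
`n`, because `Φ` grows at most linearly. -/

namespace PercGrowth

/-! ### Expectations over independent finite random sets. -/

section Expectation

variable {ι κ α : Type*} [DecidableEq ι] [DecidableEq κ]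

/-- Expectation of `f T`, where `T ⊆ F` contains each `i ∈ F` independently with
probability `ρ i`. -/
noncomputable def ex (ρ : ι → ℝ) (F : Finset ι) (f : Finset ι → ℝ) : ℝ :=
  ∑ T ∈ F.powerset, (∏ i ∈ T, ρ i) * (∏ i ∈ F \ T, (1 - ρ i)) * f T

/-- Indicator of a proposition. -/
noncomputable def ind (P : Prop) : ℝ := by
  classical exact if P then 1 else 0

theorem ind_true {P : Prop} (h : P) : ind P = 1 := if_pos h
theorem ind_false {P : Prop} (h : ¬ P) : ind P = 0 := if_neg h

theorem ind_nonneg (P : Prop) : 0 ≤ ind P := by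
  by_cases h : P
  · rw [ind_true h]; norm_num
  · rw [ind_false h]

theorem ind_le_one (P : Prop) : ind P ≤ 1 := by
  by_cases h : P
  · rw [ind_true h]
  · rw [ind_false h]; norm_num

theorem ind_mono {P Q : Prop} (h : P → Q) : ind P ≤ ind Q := by
  by_cases hP : P
  · rw [ind_true hP, ind_true (h hP)]
  · rw [ind_false hP]; exact ind_nonneg _

theorem ind_and (P Q : Prop) : ind (P ∧ Q) = ind P * ind Q := by
  by_cases hP : P
  · by_cases hQ : Q
    · rw [ind_true hP, ind_true hQ, ind_true ⟨hP, hQ⟩, one_mul]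
    · rw [ind_false hQ, ind_false fun h => hQ h.2, mul_zero]
  · rw [ind_false hP, ind_false fun h => hP h.1, zero_mul]

theorem ind_not (P : Prop) : ind (¬ P) = 1 - ind P := by
  by_cases hP : P
  · rw [ind_true hP, ind_false (not_not.2 hP), sub_self]
  · rw [ind_false hP, ind_true hP, sub_zero]

theorem ind_or_le (P Q : Prop) : ind (P ∨ Q) ≤ ind P + ind Q := by
  by_cases hP : P
  · rw [ind_true hP, ind_true (Or.inl hP)]; linarith [ind_nonneg Q]
  · by_cases hQ : Q
    · rw [ind_true hQ, ind_true (Or.inr hQ)]; linarith [ind_nonneg P]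
    · rw [ind_false (not_or.2 ⟨hP, hQ⟩)]; linarith [ind_nonneg P, ind_nonneg Q]

theorem ind_congr {P Q : Prop} (h : P ↔ Q) : ind P = ind Q := by rw [propext h]

theorem ex_empty (ρ : ι → ℝ) (f : Finset ι → ℝ) : ex ρ ∅ f = f ∅ := by simp [ex]

theorem ex_congr {ρ : ι → ℝ} {F : Finset ι} {f g : Finset ι → ℝ} (h : ∀ T, T ⊆ F → f T = g T) :
    ex ρ F f = ex ρ F g :=
  Finset.sum_congr rfl fun T hT => by rw [h T (Finset.mem_powerset.1 hT)]

theorem ex_insert (ρ : ι → ℝ) {F : Finset ι} {i : ι} (hi : i ∉ F) (f : Finset ι → ℝ) :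
    ex ρ (insert i F) f = ρ i * ex ρ F (fun T => f (insert i T)) + (1 - ρ i) * ex ρ F f := by
  unfold ex
  rw [Finset.sum_powerset_insert hi, add_comm, Finset.mul_sum, Finset.mul_sum]
  congr 1
  · refine Finset.sum_congr rfl fun T hT => ?_
    have hT' := Finset.mem_powerset.1 hT
    have hiT : i ∉ T := fun h => hi (hT' h)
    rw [Finset.prod_insert hiT]
    have : insert i F \ insert i T = F \ T := by
      ext j; simp only [Finset.mem_sdiff, Finset.mem_insert]; grind
    rw [this]; ring
  · refine Finset.sum_congr rfl fun T hT => ?_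
    have hT' := Finset.mem_powerset.1 hT
    have hiT : i ∉ T := fun h => hi (hT' h)
    have : insert i F \ T = insert i (F \ T) := by
      ext j; simp only [Finset.mem_sdiff, Finset.mem_insert]; grind
    rw [this, Finset.prod_insert (fun h => hi (Finset.mem_sdiff.1 h).1)]; ring

theorem ex_add (ρ : ι → ℝ) (F : Finset ι) (f g : Finset ι → ℝ) :
    ex ρ F (fun T => f T + g T) = ex ρ F f + ex ρ F g := by
  simp only [ex, mul_add, Finset.sum_add_distrib]

theorem ex_sub (ρ : ι → ℝ) (F : Finset ι) (f g : Finset ι → ℝ) :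
    ex ρ F (fun T => f T - g T) = ex ρ F f - ex ρ F g := by
  simp only [ex, mul_sub, Finset.sum_sub_distrib]

theorem ex_const_mul (ρ : ι → ℝ) (F : Finset ι) (c : ℝ) (f : Finset ι → ℝ) :
    ex ρ F (fun T => c * f T) = c * ex ρ F f := by
  simp only [ex, Finset.mul_sum]
  exact Finset.sum_congr rfl fun T _ => by ring

theorem ex_mul_const (ρ : ι → ℝ) (F : Finset ι) (c : ℝ) (f : Finset ι → ℝ) :
    ex ρ F (fun T => f T * c) = ex ρ F f * c := by
  simp only [mul_comm _ c, ex_const_mul]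

theorem ex_sum (ρ : ι → ℝ) (F : Finset ι) (s : Finset α) (f : α → Finset ι → ℝ) :
    ex ρ F (fun T => ∑ a ∈ s, f a T) = ∑ a ∈ s, ex ρ F (f a) := by
  simp only [ex, Finset.mul_sum]
  exact Finset.sum_comm

theorem ex_const (ρ : ι → ℝ) (F : Finset ι) (c : ℝ) : ex ρ F (fun _ => c) = c := by
  induction F using Finset.induction_on with
  | empty => rw [ex_empty]
  | insert i F hi ih => rw [ex_insert _ hi, ih]; ring

theorem ex_weight_nonneg {ρ : ι → ℝ} (h0 : ∀ i, 0 ≤ ρ i) (h1 : ∀ i, ρ i ≤ 1) (F T : Finset ι) :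
    0 ≤ (∏ i ∈ T, ρ i) * ∏ i ∈ F \ T, (1 - ρ i) :=
  mul_nonneg (Finset.prod_nonneg fun i _ => h0 i)
    (Finset.prod_nonneg fun i _ => sub_nonneg.2 (h1 i))

theorem ex_mono {ρ : ι → ℝ} (h0 : ∀ i, 0 ≤ ρ i) (h1 : ∀ i, ρ i ≤ 1) {F : Finset ι}
    {f g : Finset ι → ℝ} (h : ∀ T, T ⊆ F → f T ≤ g T) : ex ρ F f ≤ ex ρ F g :=
  Finset.sum_le_sum fun T hT =>
    mul_le_mul_of_nonneg_left (h T (Finset.mem_powerset.1 hT)) (ex_weight_nonneg h0 h1 F T)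

theorem ex_nonneg {ρ : ι → ℝ} (h0 : ∀ i, 0 ≤ ρ i) (h1 : ∀ i, ρ i ≤ 1) {F : Finset ι}
    {f : Finset ι → ℝ} (h : ∀ T, T ⊆ F → 0 ≤ f T) : 0 ≤ ex ρ F f := by
  have := ex_mono h0 h1 h
  rwa [ex_const] at this

theorem ex_le_const {ρ : ι → ℝ} (h0 : ∀ i, 0 ≤ ρ i) (h1 : ∀ i, ρ i ≤ 1) {F : Finset ι}
    {f : Finset ι → ℝ} {c : ℝ} (h : ∀ T, T ⊆ F → f T ≤ c) : ex ρ F f ≤ c := by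
  have := ex_mono h0 h1 h
  rwa [ex_const] at this

theorem ex_ind_le_one {ρ : ι → ℝ} (h0 : ∀ i, 0 ≤ ρ i) (h1 : ∀ i, ρ i ≤ 1) (F : Finset ι)
    (P : Finset ι → Prop) : ex ρ F (fun T => ind (P T)) ≤ 1 :=
  ex_le_const h0 h1 fun _ _ => ind_le_one _

theorem ex_ind_nonneg {ρ : ι → ℝ} (h0 : ∀ i, 0 ≤ ρ i) (h1 : ∀ i, ρ i ≤ 1) (F : Finset ι)
    (P : Finset ι → Prop) : 0 ≤ ex ρ F (fun T => ind (P T)) :=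
  ex_nonneg h0 h1 fun _ _ => ind_nonneg _

theorem ex_congr_density {ρ ρ' : ι → ℝ} {F : Finset ι} (h : ∀ i ∈ F, ρ i = ρ' i)
    (f : Finset ι → ℝ) : ex ρ F f = ex ρ' F f := by
  refine Finset.sum_congr rfl fun T hT => ?_
  have hT' := Finset.mem_powerset.1 hT
  have e1 : ∏ i ∈ T, ρ i = ∏ i ∈ T, ρ' i := Finset.prod_congr rfl fun i hi => h i (hT' hi)
  have e2 : ∏ i ∈ F \ T, (1 - ρ i) = ∏ i ∈ F \ T, (1 - ρ' i) :=
    Finset.prod_congr rfl fun i hi => by rw [h i (Finset.mem_sdiff.1 hi).1]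
  rw [e1, e2]

theorem ex_union (ρ : ι → ℝ) {F F' : Finset ι} (h : Disjoint F F') (f : Finset ι → ℝ) :
    ex ρ (F ∪ F') f = ex ρ F fun T => ex ρ F' fun T' => f (T ∪ T') := by
  induction F using Finset.induction_on generalizing f with
  | empty => simp [ex_empty]
  | insert i F hi ih =>
    have hd := Finset.disjoint_insert_left.1 h
    have hi' : i ∉ F ∪ F' := by simp [hi, hd.1]
    rw [Finset.insert_union, ex_insert _ hi', ex_insert _ hi, ih hd.2, ih hd.2]
    simp only [Finset.insert_union]

/-- Only the coordinates on which `f` depends matter. -/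
theorem ex_restrict (ρ : ι → ℝ) {F F' : Finset ι} (hF : F ⊆ F') {f : Finset ι → ℝ}
    (h : ∀ T ⊆ F', f (T ∩ F) = f T) : ex ρ F' f = ex ρ F f := by
  have : F' = F ∪ (F' \ F) := (Finset.union_sdiff_of_subset hF).symm
  rw [this, ex_union _ Finset.disjoint_sdiff]
  refine ex_congr fun T hT => ?_
  rw [ex_congr (g := fun _ => f T), ex_const]
  intro T' hT'
  have h1 := h (T ∪ T') (Finset.union_subset (hT.trans hF) (hT'.trans Finset.sdiff_subset))
  rw [← h1]
  congr 1
  ext j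
  have := @hT j
  have := @hT' j
  simp only [Finset.mem_inter, Finset.mem_union, Finset.mem_sdiff] at *
  grind

theorem ex_indep (ρ : ι → ℝ) (F P : Finset ι) {f g : Finset ι → ℝ}
    (hf : ∀ T T', T ∩ P = T' ∩ P → f T = f T') (hg : ∀ T T', T \ P = T' \ P → g T = g T') :
    ex ρ F (fun T => f T * g T) = ex ρ F f * ex ρ F g := by
  have hF : F = (F ∩ P) ∪ (F \ P) := by ext j; simp only [Finset.mem_inter, Finset.mem_union, Finset.mem_sdiff]; tauto
  have hd : Disjoint (F ∩ P) (F \ P) := by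
    rw [Finset.disjoint_left]; intro j; simp only [Finset.mem_inter, Finset.mem_sdiff]; tauto
  have key : ∀ T ⊆ F ∩ P, ∀ T' ⊆ F \ P, f (T ∪ T') = f T ∧ g (T ∪ T') = g T' := by
    intro T hT T' hT'
    constructor
    · apply hf; ext j
      have := @hT j
      have := @hT' j
      simp only [Finset.mem_inter, Finset.mem_union, Finset.mem_sdiff] at *
      grind
    · apply hg; ext j
      have := @hT j
      have := @hT' j
      simp only [Finset.mem_inter, Finset.mem_union, Finset.mem_sdiff] at *
      grind
  have e1 : ex ρ F f = ex ρ (F ∩ P) f := by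
    conv_lhs => rw [hF, ex_union _ hd]
    refine ex_congr fun T hT => ?_
    rw [ex_congr fun T' hT' => (key T hT T' hT').1, ex_const]
  have e2 : ex ρ F g = ex ρ (F \ P) g := by
    conv_lhs => rw [hF, ex_union _ hd]
    rw [ex_congr (g := fun _ => ex ρ (F \ P) g), ex_const]
    exact fun T hT => ex_congr fun T' hT' => (key T hT T' hT').2
  rw [e1, e2, ← ex_mul_const]
  conv_lhs => rw [hF, ex_union _ hd]
  refine ex_congr fun T hT => ?_
  rw [← ex_const_mul]
  refine ex_congr fun T' hT' => ?_
  rw [(key T hT T' hT').1, (key T hT T' hT').2]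

/-- Harris' inequality. -/
theorem ex_mul_ex_le {ρ : ι → ℝ} (h0 : ∀ i, 0 ≤ ρ i) (h1 : ∀ i, ρ i ≤ 1) (F : Finset ι)
    {f g : Finset ι → ℝ} (hf : Antitone f) (hg : Antitone g) :
    ex ρ F f * ex ρ F g ≤ ex ρ F fun T => f T * g T := by
  induction F using Finset.induction_on generalizing f g with
  | empty => simp [ex_empty]
  | insert i F hi ih =>
    have hins : Monotone fun T : Finset ι => insert i T := fun T T' h => Finset.insert_subset_insert i h
    have a1 := ih (hf.comp_monotone hins) (hg.comp_monotone hins)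
    have a2 := ih hf hg
    rw [ex_insert _ hi, ex_insert _ hi, ex_insert _ hi]
    have b1 : ex ρ F (fun T => f (insert i T)) ≤ ex ρ F f :=
      ex_mono h0 h1 fun T _ => hf (Finset.subset_insert i T)
    have b2 : ex ρ F (fun T => g (insert i T)) ≤ ex ρ F g :=
      ex_mono h0 h1 fun T _ => hg (Finset.subset_insert i T)
    simp only [Function.comp_def] at a1
    have c1 := mul_le_mul_of_nonneg_left a1 (h0 i)
    have c2 := mul_le_mul_of_nonneg_left a2 (sub_nonneg.2 (h1 i))
    -- The covariance produced by the coordinate `i`: both conditional expectations drop when `i` is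
    -- added, so the product of the drops is nonnegative.
    have c3 : 0 ≤ ρ i * (1 - ρ i) * ((ex ρ F f - ex ρ F fun T => f (insert i T)) *
        (ex ρ F g - ex ρ F fun T => g (insert i T))) :=
      mul_nonneg (mul_nonneg (h0 i) (sub_nonneg.2 (h1 i)))
        (mul_nonneg (sub_nonneg.2 b1) (sub_nonneg.2 b2))
    nlinarith

/-- Superposition of independent sets. -/
theorem ex_superpose (a b : ι → ℝ) (F : Finset ι) (f : Finset ι → ℝ) :
    ex (fun i => 1 - (1 - a i) * (1 - b i)) F f = ex a F fun T => ex b F fun T' => f (T ∪ T') := by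
  induction F using Finset.induction_on generalizing f with
  | empty => simp [ex_empty]
  | insert i F hi ih =>
    simp only [ex_insert _ hi]
    simp only [Finset.insert_union, Finset.union_insert, Finset.insert_idem, ex_add, ex_const_mul]
    rw [ih, ih]
    ring

/-- Thinning by an independent set. -/
theorem ex_thin (a b : ι → ℝ) (F : Finset ι) (f : Finset ι → ℝ) :
    ex (fun i => a i * b i) F f = ex a F fun T => ex b F fun T' => f (T ∩ T') := by
  induction F using Finset.induction_on generalizing f with
  | empty => simp [ex_empty]
  | insert i F hi ih =>
    rw [ex_insert _ hi, ex_insert _ hi, ih, ih]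
    have e1 : (ex a F fun T => ex b (insert i F) fun T' => f (insert i T ∩ T')) =
        b i * (ex a F fun T => ex b F fun T' => f (insert i (T ∩ T'))) +
        (1 - b i) * ex a F fun T => ex b F fun T' => f (T ∩ T') := by
      rw [← ex_const_mul, ← ex_const_mul, ← ex_add]
      refine ex_congr fun T hT => ?_
      rw [ex_insert _ hi]
      congr 2
      · refine ex_congr fun T' hT' => ?_
        congr 1; ext j; simp only [Finset.mem_inter, Finset.mem_insert]; tauto
      · refine ex_congr fun T' hT' => ?_
        congr 1; ext j; have := @hT' j; simp only [Finset.mem_inter, Finset.mem_insert]; grind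
    have e2 : (ex a F fun T => ex b (insert i F) fun T' => f (T ∩ T')) =
        ex a F fun T => ex b F fun T' => f (T ∩ T') := by
      refine ex_congr fun T hT => ?_
      rw [ex_insert _ hi]
      have : (ex b F fun T' => f (T ∩ insert i T')) = ex b F fun T' => f (T ∩ T') := by
        refine ex_congr fun T' hT' => ?_
        congr 1; ext j; have := @hT j; simp only [Finset.mem_inter, Finset.mem_insert]; grind
      rw [this]; ring
    rw [e1, e2]; ring

/-- Discarding coordinates amounts to giving them density zero; explored or irrelevant edges are
removed from a layer in this way. -/
theorem ex_sdiff (ρ : ι → ℝ) (F R : Finset ι) (f : Finset ι → ℝ) :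
    ex ρ F (fun T => f (T \ R)) = ex (fun i => if i ∈ R then 0 else ρ i) F f := by
  induction F using Finset.induction_on generalizing f with
  | empty => simp [ex_empty]
  | insert i F hi ih =>
    rw [ex_insert _ hi, ex_insert _ hi, ← ih f]
    by_cases hR : i ∈ R
    · simp only [Finset.insert_sdiff_of_mem _ hR, hR, if_true]
      ring
    · rw [← ih fun T => f (insert i T)]
      simp only [Finset.insert_sdiff_of_notMem _ hR, hR, if_false]

theorem ex_antitone_density {ρ ρ' : ι → ℝ} (h0 : ∀ i, 0 ≤ ρ i) (h1 : ∀ i, ρ' i ≤ 1) {F : Finset ι}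
    (hle : ∀ i ∈ F, ρ i ≤ ρ' i) {f : Finset ι → ℝ} (hf : Antitone f) : ex ρ' F f ≤ ex ρ F f := by
  induction F using Finset.induction_on generalizing f with
  | empty => simp [ex_empty]
  | insert i F hi ih =>
    have hins : Monotone fun T : Finset ι => insert i T := fun T T' h => Finset.insert_subset_insert i h
    have hle' : ∀ j ∈ F, ρ j ≤ ρ' j := fun j hj => hle j (Finset.mem_insert_of_mem hj)
    have a1 := ih hle' (hf.comp_monotone hins)
    have a2 := ih hle' hf
    have hi0 := hle i (Finset.mem_insert_self i F)
    simp only [Function.comp_def] at a1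
    rw [ex_insert _ hi, ex_insert _ hi]
    have b1 : ex ρ F (fun T => f (insert i T)) ≤ ex ρ F f := by
      refine Finset.sum_le_sum fun T hT => ?_
      have hT' := Finset.mem_powerset.1 hT
      refine mul_le_mul_of_nonneg_left (hf (Finset.subset_insert i T)) ?_
      refine mul_nonneg (Finset.prod_nonneg fun i _ => h0 i) (Finset.prod_nonneg fun j hj => ?_)
      have hj' := (Finset.mem_sdiff.1 hj).1
      exact sub_nonneg.2 ((hle' j hj').trans (h1 j))
    have c1 := mul_le_mul_of_nonneg_left a1 ((h0 i).trans hi0)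
    have c2 := mul_le_mul_of_nonneg_left a2 (sub_nonneg.2 (h1 i))
    nlinarith [mul_nonneg (sub_nonneg.2 hi0) (sub_nonneg.2 b1)]

theorem ex_map (ρ : κ → ℝ) (φ : ι ↪ κ) (F : Finset ι) (f : Finset κ → ℝ) :
    ex ρ (F.map φ) f = ex (fun i => ρ (φ i)) F fun T => f (T.map φ) := by
  induction F using Finset.induction_on generalizing f with
  | empty => simp [ex_empty]
  | insert i F hi ih =>
    rw [Finset.map_insert, ex_insert _ (by simpa using hi), ex_insert _ hi, ih, ih]
    simp only [Finset.map_insert]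

theorem ex_disjoint (ρ : ι → ℝ) {F X : Finset ι} (hX : X ⊆ F) :
    ex ρ F (fun T => ind (Disjoint T X)) = ∏ i ∈ X, (1 - ρ i) := by
  rw [ex_restrict ρ hX]
  · unfold ex
    rw [Finset.sum_eq_single ∅]
    · simp [ind_true]
    · intro T hT hne
      dsimp only
      rw [ind_false, mul_zero]
      intro h
      exact hne (disjoint_self.1 (h.mono_right (Finset.mem_powerset.1 hT)))
    · simp
  · intro T _
    refine ind_congr ?_
    simp only [Finset.disjoint_left, Finset.mem_inter]
    tauto

theorem ex_superset (ρ : ι → ℝ) {F X : Finset ι} (hX : X ⊆ F) :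
    ex ρ F (fun T => ind (X ⊆ T)) = ∏ i ∈ X, ρ i := by
  rw [ex_restrict ρ hX]
  · unfold ex
    rw [Finset.sum_eq_single X]
    · simp [ind_true]
    · intro T hT hne
      dsimp only
      rw [ind_false, mul_zero]
      intro h
      exact hne ((Finset.mem_powerset.1 hT).antisymm h)
    · simp
  · intro T _
    refine ind_congr ?_
    simp only [Finset.subset_iff, Finset.mem_inter]
    exact ⟨fun h x hx => (h hx).1, fun h x hx => ⟨h hx, hx⟩⟩

/-- Resampling outside the explored region: if the value `s` of `X` is determined by the
coordinates in `R s`, and `g s` only depends on the coordinates outside `R s`, then `T` may be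
replaced by an independent copy in the second argument of `g`. -/
theorem ex_resample [DecidableEq α] (ρ : ι → ℝ) (F : Finset ι) (X : Finset ι → α) (R : α → Finset ι)
    (g : α → Finset ι → ℝ)
    (hX : ∀ T T', T ∩ R (X T) = T' ∩ R (X T) → X T' = X T)
    (hg : ∀ s T T', T \ R s = T' \ R s → g s T = g s T') :
    ex ρ F (fun T => g (X T) T) = ex ρ F fun T => ex ρ F fun T' => g (X T) T' := by
  set 𝒮 := F.powerset.image X
  have expand : ∀ φ : α → ℝ, ∀ T ⊆ F, φ (X T) = ∑ s ∈ 𝒮, ind (X T = s) * φ s := by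
    intro φ T hT
    rw [Finset.sum_eq_single (X T)]
    · rw [ind_true rfl, one_mul]
    · intro s _ hs
      rw [ind_false (Ne.symm hs), zero_mul]
    · intro h
      exact absurd (Finset.mem_image_of_mem X (Finset.mem_powerset.2 hT)) h
  rw [ex_congr fun T hT => expand (fun s => g s T) T hT,
    ex_congr fun T hT => expand (fun s => ex ρ F (g s)) T hT, ex_sum, ex_sum]
  refine Finset.sum_congr rfl fun s _ => ?_
  rw [ex_mul_const, ex_indep ρ F (R s)]
  · intro T T' h
    refine ind_congr ⟨fun hs => ?_, fun hs => ?_⟩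
    · rw [← hs] at h ⊢; exact hX T T' h
    · rw [← hs] at h ⊢; exact hX T' T h.symm
  · exact hg s

end Expectation

/-! ### Boundaries, balls, separation and clusters in a locally finite graph. -/

section Graph

variable {V : Type*} [DecidableEq V] (G : SimpleGraph V) [G.LocallyFinite]

/-- Edges with at least one endpoint in `A`. -/
def star (A : Finset V) : Finset (Sym2 V) :=
  A.biUnion fun v => (G.neighborFinset v).image fun w => s(v, w)

open Classical in
/-- Edges with exactly one endpoint in `A`. -/
noncomputable def bd (A : Finset V) : Finset (Sym2 V) := (star G A).filter fun e => ∃ y ∈ e, y ∉ A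

open Classical in
/-- Edges with both endpoints in `A`. -/
noncomputable def inn (A : Finset V) : Finset (Sym2 V) := (star G A).filter fun e => ∀ y ∈ e, y ∈ A

variable {G}

theorem mem_star {A : Finset V} {x y : V} :
    s(x, y) ∈ star G A ↔ G.Adj x y ∧ (x ∈ A ∨ y ∈ A) := by
  simp only [star, Finset.mem_biUnion, Finset.mem_image, SimpleGraph.mem_neighborFinset, Sym2.eq_iff]
  constructor
  · rintro ⟨v, hv, w, hw, ⟨rfl, rfl⟩ | ⟨rfl, rfl⟩⟩
    · exact ⟨hw, Or.inl hv⟩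
    · exact ⟨hw.symm, Or.inr hv⟩
  · rintro ⟨h, hx | hy⟩
    · exact ⟨x, hx, y, h, Or.inl ⟨rfl, rfl⟩⟩
    · exact ⟨y, hy, x, h.symm, Or.inr ⟨rfl, rfl⟩⟩

theorem mem_bd {A : Finset V} {x y : V} :
    s(x, y) ∈ bd G A ↔ G.Adj x y ∧ (x ∈ A ∧ y ∉ A ∨ y ∈ A ∧ x ∉ A) := by
  simp only [bd, Finset.mem_filter, mem_star, Sym2.mem_iff, exists_eq_or_imp, exists_eq_left]
  tauto

theorem mem_inn {A : Finset V} {x y : V} :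
    s(x, y) ∈ inn G A ↔ G.Adj x y ∧ x ∈ A ∧ y ∈ A := by
  simp only [inn, Finset.mem_filter, mem_star, Sym2.mem_iff, forall_eq_or_imp, forall_eq]
  tauto

theorem adj_of_mem_star {A : Finset V} {e : Sym2 V} (h : e ∈ star G A) : e ∈ G.edgeSet := by
  induction e with | _ x y => exact (mem_star.1 h).1

theorem coe_bd (A : Finset V) : (bd G A : Set (Sym2 V)) = Perc.edgeBoundary G (A : Set V) := by
  ext e
  induction e with | _ x y => ?_
  simp only [Finset.mem_coe, mem_bd, Perc.edgeBoundary, Set.mem_ofPred_eq, Sym2.eq_iff]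
  constructor
  · rintro ⟨h, ⟨h1, h2⟩ | ⟨h1, h2⟩⟩
    · exact ⟨x, y, h, h1, h2, Or.inl ⟨rfl, rfl⟩⟩
    · exact ⟨y, x, h.symm, h1, h2, Or.inr ⟨rfl, rfl⟩⟩
  · rintro ⟨u, v, h, h1, h2, ⟨rfl, rfl⟩ | ⟨rfl, rfl⟩⟩
    · exact ⟨h, Or.inl ⟨h1, h2⟩⟩
    · exact ⟨h.symm, Or.inr ⟨h1, h2⟩⟩

theorem ncard_edgeBoundary (A : Finset V) :
    (Perc.edgeBoundary G (A : Set V)).ncard = (bd G A).card := by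
  rw [← coe_bd, Set.ncard_coe_finset]

theorem bd_subset_star (A : Finset V) : bd G A ⊆ star G A := by
  classical exact Finset.filter_subset _ _

theorem inn_subset_star (A : Finset V) : inn G A ⊆ star G A := by
  classical exact Finset.filter_subset _ _

theorem star_mono {A B : Finset V} (h : A ⊆ B) : star G A ⊆ star G B :=
  Finset.biUnion_subset_biUnion_of_subset_left _ h

theorem card_star_le {d : ℕ} (hd : ∀ v, G.degree v ≤ d) (A : Finset V) :
    (star G A).card ≤ d * A.card := by
  rw [mul_comm]
  exact Finset.card_biUnion_le_card_mul _ _ _ fun v _ => Finset.card_image_le.trans (hd v)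

theorem card_inn_le {d : ℕ} (hd : ∀ v, G.degree v ≤ d) (A : Finset V) :
    (inn G A).card ≤ d * A.card :=
  (Finset.card_le_card (inn_subset_star A)).trans (card_star_le hd A)

variable (G) in
/-- The vertices within distance `n` of `A`. -/
def bal (A : Finset V) : ℕ → Finset V
  | 0 => A
  | n + 1 => bal A n ∪ (bal A n).biUnion fun v => G.neighborFinset v

theorem mem_bal_succ {A : Finset V} {n : ℕ} {v : V} :
    v ∈ bal G A (n + 1) ↔ v ∈ bal G A n ∨ ∃ u ∈ bal G A n, G.Adj u v := by
  simp [bal]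

theorem mem_bal {A : Finset V} {n : ℕ} {v : V} :
    v ∈ bal G A n ↔ ∃ s ∈ A, ∃ w : G.Walk s v, w.length ≤ n := by
  induction n generalizing v with
  | zero =>
    constructor
    · exact fun h => ⟨v, h, .nil, le_rfl⟩
    · rintro ⟨s, hs, w, hw⟩
      cases SimpleGraph.Walk.eq_of_length_eq_zero (Nat.le_zero.1 hw)
      exact hs
  | succ n ih =>
    rw [mem_bal_succ]
    constructor
    · rintro (h | ⟨u, hu, huv⟩)
      · obtain ⟨s, hs, w, hw⟩ := ih.1 h
        exact ⟨s, hs, w, hw.trans n.le_succ⟩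
      · obtain ⟨s, hs, w, hw⟩ := ih.1 hu
        refine ⟨s, hs, w.concat huv, ?_⟩
        rw [SimpleGraph.Walk.length_concat]; omega
    · rintro ⟨s, hs, w, hw⟩
      rcases Nat.lt_or_ge n w.length with h | h
      · have hnn : ¬ w.Nil := by
          rw [← SimpleGraph.Walk.length_eq_zero_iff]; omega
        right
        refine ⟨w.penultimate, ih.2 ⟨s, hs, w.dropLast, ?_⟩, w.adj_penultimate hnn⟩
        have := w.length_dropLast_add_one hnn
        omega
      · exact Or.inl (ih.2 ⟨s, hs, w, h⟩)

theorem subset_bal (A : Finset V) (n : ℕ) : A ⊆ bal G A n :=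
  fun v hv => mem_bal.2 ⟨v, hv, .nil, Nat.zero_le _⟩

theorem bal_mono_radius (A : Finset V) {m n : ℕ} (h : m ≤ n) : bal G A m ⊆ bal G A n := by
  intro v hv
  obtain ⟨s, hs, w, hw⟩ := mem_bal.1 hv
  exact mem_bal.2 ⟨s, hs, w, hw.trans h⟩

theorem bal_mono {A B : Finset V} (h : A ⊆ B) (n : ℕ) : bal G A n ⊆ bal G B n := by
  intro v hv
  obtain ⟨s, hs, w, hw⟩ := mem_bal.1 hv
  exact mem_bal.2 ⟨s, h hs, w, hw⟩

theorem mem_bal_comm {u v : V} {n : ℕ} : u ∈ bal G {v} n ↔ v ∈ bal G {u} n := by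
  simp only [mem_bal, Finset.mem_singleton, exists_eq_left]
  exact ⟨fun ⟨w, hw⟩ => ⟨w.reverse, by simpa using hw⟩, fun ⟨w, hw⟩ => ⟨w.reverse, by simpa using hw⟩⟩

theorem bal_adj_subset {u v : V} (h : G.Adj u v) (n : ℕ) : bal G {v} n ⊆ bal G {u} (n + 1) := by
  intro x hx
  simp only [mem_bal, Finset.mem_singleton, exists_eq_left] at hx ⊢
  obtain ⟨w, hw⟩ := hx
  exact ⟨.cons h w, by simpa using hw⟩

theorem card_bal_le {d : ℕ} (hd : ∀ v, G.degree v ≤ d) (A : Finset V) (n : ℕ) :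
    (bal G A n).card ≤ A.card * (d + 1) ^ n := by
  induction n with
  | zero => simp [bal]
  | succ n ih =>
    have h1 : ((bal G A n).biUnion fun v => G.neighborFinset v).card ≤ (bal G A n).card * d :=
      Finset.card_biUnion_le_card_mul _ _ _ fun v _ => hd v
    calc (bal G A (n + 1)).card ≤ (bal G A n).card + (bal G A n).card * d :=
          (Finset.card_union_le _ _).trans (by omega)
      _ = (bal G A n).card * (d + 1) := by ring
      _ ≤ A.card * (d + 1) ^ n * (d + 1) := Nat.mul_le_mul_right _ ih
      _ = _ := by ring

/-- A set that no edge of a ball crosses contains the ball or is disjoint from it. -/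
theorem bal_subset_or_disjoint {u : V} {n : ℕ} {A : Finset V}
    (h : Disjoint (inn G (bal G {u} n)) (bd G A)) : bal G {u} n ⊆ A ∨ Disjoint (bal G {u} n) A := by
  have key : ∀ v ∈ bal G {u} n, (v ∈ A ↔ u ∈ A) := by
    intro v hv
    have : ∀ j, j ≤ n → ∀ v ∈ bal G {u} j, (v ∈ A ↔ u ∈ A) := by
      intro j
      induction j with
      | zero => intro _ v hv; rw [Finset.mem_singleton.1 hv]
      | succ j ih =>
        intro hj v hv
        rcases mem_bal_succ.1 hv with h' | ⟨x, hx, hxv⟩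
        · exact ih (by omega) v h'
        · rw [← ih (by omega) x hx]
          have hi : s(x, v) ∈ inn G (bal G {u} n) :=
            mem_inn.2 ⟨hxv, bal_mono_radius _ (by omega) hx, bal_mono_radius _ hj hv⟩
          have := Finset.disjoint_left.1 h hi
          rw [mem_bd] at this
          tauto
    exact this n le_rfl v hv
  by_cases hu : u ∈ A
  · exact Or.inl fun v hv => (key v hv).2 hu
  · exact Or.inr (Finset.disjoint_left.2 fun v hv hA => hu ((key v hv).1 hA))

variable (G) in
/-- The event that `I` is separated from the complement of `W` by closed edges. -/
def Sep (I W : Finset V) (T : Finset (Sym2 V)) : Prop :=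
  ∃ A, I ⊆ A ∧ A ⊆ W ∧ Disjoint T (bd G A)

theorem Sep.mono {I W : Finset V} {T T' : Finset (Sym2 V)} (h : T ⊆ T') (hs : Sep G I W T') :
    Sep G I W T := by
  obtain ⟨A, h1, h2, h3⟩ := hs
  exact ⟨A, h1, h2, h3.mono_left h⟩

theorem antitone_ind_Sep (I W : Finset V) : Antitone fun T => ind (Sep G I W T) :=
  fun _ _ h => ind_mono fun hs => hs.mono h

theorem Sep_inter {I W : Finset V} {T F : Finset (Sym2 V)} (hF : star G W ⊆ F) :
    Sep G I W (T ∩ F) ↔ Sep G I W T := by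
  refine ⟨?_, fun h => h.mono Finset.inter_subset_left⟩
  rintro ⟨A, h1, h2, h3⟩
  refine ⟨A, h1, h2, ?_⟩
  rw [Finset.disjoint_left] at h3 ⊢
  intro e he hA
  exact h3 (Finset.mem_inter.2 ⟨he, hF (star_mono h2 (bd_subset_star A hA))⟩) hA

open Classical in
variable (G) in
/-- The cluster of `B ∩ U` inside `U`. -/
noncomputable def clus (U B : Finset V) (T : Finset (Sym2 V)) : Finset V :=
  U.filter fun v => ∀ X ⊆ U, B ∩ U ⊆ X → Disjoint T (bd G X ∩ inn G U) → v ∈ X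

theorem clus_subset (U B : Finset V) (T : Finset (Sym2 V)) : clus G U B T ⊆ U :=
  Finset.filter_subset _ _

theorem subset_clus (U B : Finset V) (T : Finset (Sym2 V)) : B ∩ U ⊆ clus G U B T := by
  classical
  intro v hv
  exact Finset.mem_filter.2 ⟨(Finset.mem_inter.1 hv).2, fun X _ hX _ => hX hv⟩

theorem clus_minimal {U B X : Finset V} {T : Finset (Sym2 V)} (h1 : X ⊆ U) (h2 : B ∩ U ⊆ X)
    (h3 : Disjoint T (bd G X ∩ inn G U)) : clus G U B T ⊆ X := by
  classical
  exact fun v hv => (Finset.mem_filter.1 hv).2 X h1 h2 h3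

theorem clus_closed (U B : Finset V) (T : Finset (Sym2 V)) :
    Disjoint T (bd G (clus G U B T) ∩ inn G U) := by
  classical
  rw [Finset.disjoint_left]
  have key : ∀ x y, s(x, y) ∈ T → s(x, y) ∈ inn G U → x ∈ clus G U B T → y ∈ clus G U B T := by
    intro x y hT hU hx
    have hU' := mem_inn.1 hU
    refine Finset.mem_filter.2 ⟨hU'.2.2, fun X h1 h2 h3 => ?_⟩
    by_contra hy
    have hxX := clus_minimal h1 h2 h3 hx
    exact Finset.disjoint_left.1 h3 hT (Finset.mem_inter.2 ⟨mem_bd.2 ⟨hU'.1, Or.inl ⟨hxX, hy⟩⟩, hU⟩)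
  intro e he hb
  induction e with | _ x y => ?_
  obtain ⟨hb, hi⟩ := Finset.mem_inter.1 hb
  rcases (mem_bd.1 hb).2 with ⟨h1, h2⟩ | ⟨h1, h2⟩
  · exact h2 (key x y he hi h1)
  · exact h2 (key y x (Sym2.eq_swap ▸ he) (Sym2.eq_swap ▸ hi) h1)

theorem clus_mono {U B B' : Finset V} {T T' : Finset (Sym2 V)} (hB : B ⊆ B') (hT : T ⊆ T') :
    clus G U B T ⊆ clus G U B' T' :=
  clus_minimal (clus_subset _ _ _)
    ((Finset.inter_subset_inter_right hB).trans (subset_clus _ _ _))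
    ((clus_closed U B' T').mono_left hT)

/-- The boundary of a subset of the cluster lies in the star of the cluster, where the two
configurations agree. Each cluster is therefore closed for the other configuration, and minimality
gives both inclusions. -/
theorem clus_determined {U B : Finset V} {T T' : Finset (Sym2 V)}
    (h : T ∩ star G (clus G U B T) = T' ∩ star G (clus G U B T)) :
    clus G U B T' = clus G U B T := by
  have h1 : clus G U B T' ⊆ clus G U B T := by
    refine clus_minimal (clus_subset _ _ _) (subset_clus _ _ _) ?_
    rw [Finset.disjoint_left]
    intro e he hb
    have hs := bd_subset_star _ (Finset.mem_inter.1 hb).1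
    have : e ∈ T := (Finset.mem_inter.1 (h ▸ Finset.mem_inter.2 ⟨he, hs⟩)).1
    exact Finset.disjoint_left.1 (clus_closed U B T) this hb
  refine h1.antisymm (clus_minimal (clus_subset _ _ _) (subset_clus _ _ _) ?_)
  rw [Finset.disjoint_left]
  intro e he hb
  have hs := star_mono h1 (bd_subset_star _ (Finset.mem_inter.1 hb).1)
  have : e ∈ T' := (Finset.mem_inter.1 (h.symm ▸ Finset.mem_inter.2 ⟨he, hs⟩)).1
  exact Finset.disjoint_left.1 (clus_closed U B T') this hb

/-- A set with closed boundary cannot cut a cluster. Together with `clus_disjoint_of_disjoint` this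
puts the cluster of `B` on the same side of a separator as `B`. -/
theorem clus_subset_of_subset {U B A : Finset V} {T : Finset (Sym2 V)}
    (hA : Disjoint T (bd G A)) (hB : B ⊆ A) : clus G U B T ⊆ A := by
  refine (clus_minimal (X := A ∩ U) Finset.inter_subset_right
    (Finset.inter_subset_inter_right hB) ?_).trans Finset.inter_subset_left
  rw [Finset.disjoint_left] at hA ⊢
  intro e he hb
  refine hA he ?_
  induction e with | _ x y => ?_
  simp only [Finset.mem_inter, mem_bd, mem_inn] at hb ⊢
  tauto

theorem clus_disjoint_of_disjoint {U B A : Finset V} {T : Finset (Sym2 V)}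
    (hA : Disjoint T (bd G A)) (hB : Disjoint B A) : Disjoint (clus G U B T) A := by
  have : clus G U B T ⊆ U \ A := by
    refine clus_minimal Finset.sdiff_subset ?_ ?_
    · intro v hv
      have := Finset.mem_inter.1 hv
      exact Finset.mem_sdiff.2 ⟨this.2, Finset.disjoint_left.1 hB this.1⟩
    rw [Finset.disjoint_left] at hA ⊢
    intro e he hb
    refine hA he ?_
    induction e with | _ x y => ?_
    simp only [Finset.mem_inter, mem_bd, mem_inn, Finset.mem_sdiff] at hb ⊢
    tauto
  exact Finset.disjoint_left.2 fun v hv => (Finset.mem_sdiff.1 (this hv)).2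

/-- Edges in both boundaries join `I` directly to the complement of `W`. This identity and
`card_bd_inter_sdiff` count the new ones when `Z` passes to the inner or to the outer side, so that
powers of `1 - q` multiply. -/
theorem card_bd_union_inter {I Z W : Finset V} (hIZ : Disjoint I Z) (hI : I ⊆ W) (hZ : Z ⊆ W) :
    (bd G (I ∪ Z) ∩ bd G W).card = (bd G I ∩ bd G W).card + (bd G Z ∩ bd G W).card := by
  rw [← Finset.card_union_of_disjoint]
  · congr 1
    ext e; induction e with | _ x y => ?_
    have := @hI x; have := @hI y; have := @hZ x; have := @hZ y
    simp only [Finset.mem_inter, mem_bd, Finset.mem_union]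
    grind
  · rw [Finset.disjoint_left] at hIZ ⊢
    intro e; induction e with | _ x y => ?_
    have := @hI x; have := @hI y; have := @hZ x; have := @hZ y
    have := @hIZ x; have := @hIZ y
    simp only [Finset.mem_inter, mem_bd]
    grind

theorem card_bd_inter_sdiff {I Z W : Finset V} (hIZ : Disjoint I Z) (hI : I ⊆ W) (hZ : Z ⊆ W) :
    (bd G I ∩ bd G (W \ Z)).card = (bd G I ∩ bd G W).card + (bd G I ∩ bd G Z).card := by
  rw [← Finset.card_union_of_disjoint]
  · congr 1
    ext e; induction e with | _ x y => ?_
    have := @hI x; have := @hI y; have := @hZ x; have := @hZ y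
    have hIZ' := Finset.disjoint_left.1 hIZ
    have := @hIZ' x; have := @hIZ' y
    simp only [Finset.mem_inter, Finset.mem_union, mem_bd, Finset.mem_sdiff]
    grind
  · rw [Finset.disjoint_left] at hIZ ⊢
    intro e; induction e with | _ x y => ?_
    have := @hI x; have := @hI y; have := @hZ x; have := @hZ y
    have := @hIZ x; have := @hIZ y
    simp only [Finset.mem_inter, mem_bd]
    grind

/-- For `Z ⊆ Z'` disjoint from `I`, more edges of `∂I` lead to `Z'` than to `Z`. -/
theorem bd_inter_mono_of_disjoint {I Z Z' : Finset V} (h : Z ⊆ Z') (hI : Disjoint I Z') :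
    bd G I ∩ bd G Z ⊆ bd G I ∩ bd G Z' := by
  rw [Finset.disjoint_left] at hI
  intro e; induction e with | _ x y => ?_
  have := @h x; have := @h y; have := @hI x; have := @hI y
  simp only [Finset.mem_inter, mem_bd]
  grind

theorem bd_inter_mono_of_subset {W Z Z' : Finset V} (h : Z ⊆ Z') (hW : Z' ⊆ W) :
    bd G Z ∩ bd G W ⊆ bd G Z' ∩ bd G W := by
  intro e; induction e with | _ x y => ?_
  have := @h x; have := @h y; have := @hW x; have := @hW y
  simp only [Finset.mem_inter, mem_bd]
  grind

end Graph

/-! ### From the percolation measure to finite expectations. -/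

section Measure

variable {V : Type*} {G : SimpleGraph V}

open Classical in
/-- The open edges of `ω` in `F`. -/
noncomputable def openF (ω : Perc.Config G) (F : Finset (Sym2 V)) : Finset (Sym2 V) :=
  F.filter fun e => ∃ h : e ∈ G.edgeSet, ω ⟨e, h⟩ = true

theorem mem_openF {ω : Perc.Config G} {F : Finset (Sym2 V)} {e : Sym2 V} :
    e ∈ openF ω F ↔ e ∈ F ∧ ∃ h : e ∈ G.edgeSet, ω ⟨e, h⟩ = true := by
  classical exact Finset.mem_filter

theorem openF_subset (ω : Perc.Config G) (F : Finset (Sym2 V)) : openF ω F ⊆ F :=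
  fun _ he => (mem_openF.1 he).1

instance (p : unitInterval) : IsProbabilityMeasure (Perc.measure G p) := by
  unfold Perc.measure; infer_instance

/-- Prescribing the open edges within `F` fixes finitely many coordinates, so the event is a
cylinder and the product formula applies. -/
theorem openF_eq_preimage [DecidableEq V] [DecidablePred (· ∈ G.edgeSet)] {F T : Finset (Sym2 V)} (hF : ∀ e ∈ F, e ∈ G.edgeSet) (hT : T ⊆ F) :
    {ω : Perc.Config G | openF ω F = T} =
      Set.pi (F.subtype (· ∈ G.edgeSet) : Finset G.edgeSet)
        fun e : G.edgeSet => {decide ((e : Sym2 V) ∈ T)} := by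
  ext ω
  simp only [Set.mem_ofPred_eq, Set.mem_pi, Finset.mem_coe, Finset.mem_subtype,
    Set.mem_singleton_iff, Finset.ext_iff, mem_openF]
  constructor
  · rintro h ⟨e, he⟩ heF
    have := h e
    by_cases hT' : e ∈ T
    · obtain ⟨_, _, h'⟩ := this.2 hT'
      simp [hT', h']
    · simp only [hT', iff_false, not_and, not_exists, Bool.not_eq_true] at this
      simp [hT', this heF he]
  · intro h e
    constructor
    · rintro ⟨heF, he, ho⟩
      have := h ⟨e, he⟩ heF
      rw [ho] at this
      simpa using this.symm
    · intro heT
      have he := hF e (hT heT)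
      refine ⟨hT heT, he, ?_⟩
      rw [h ⟨e, he⟩ (hT heT)]
      simpa using heT

theorem measurableSet_openF_eq {F T : Finset (Sym2 V)} (hF : ∀ e ∈ F, e ∈ G.edgeSet) (hT : T ⊆ F) :
    MeasurableSet {ω : Perc.Config G | openF ω F = T} := by
  classical
  rw [openF_eq_preimage hF hT]
  exact MeasurableSet.pi (Finset.countable_toSet _) fun _ _ => MeasurableSet.of_discrete

theorem measureReal_openF_eq [DecidableEq V] (p : unitInterval) {F T : Finset (Sym2 V)}
    (hF : ∀ e ∈ F, e ∈ G.edgeSet) (hT : T ⊆ F) :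
    (Perc.measure G p).real {ω | openF ω F = T} =
      (∏ _e ∈ T, (p : ℝ)) * ∏ _e ∈ F \ T, (1 - (p : ℝ)) := by
  classical
  rw [openF_eq_preimage hF hT, measureReal_def, Perc.measure,
    Measure.infinitePi_pi _ fun _ _ => MeasurableSet.of_discrete, ENNReal.toReal_prod]
  have : ∀ e : G.edgeSet, (bernoulliMeasure true false p {decide ((e : Sym2 V) ∈ T)}).toReal =
      (fun e : Sym2 V => if e ∈ T then (p : ℝ) else 1 - p) e := by
    intro e
    rw [← measureReal_def]
    by_cases h : (e : Sym2 V) ∈ T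
    · rw [bernoulliMeasure_real_apply_of_mem_of_notMem p MeasurableSet.of_discrete (by simp [h])
        (by simp [h])]
      simp [h]
    · rw [bernoulliMeasure_real_apply_of_notMem_of_mem p MeasurableSet.of_discrete (by simp [h])
        (by simp [h])]
      simp [h]
  refine (Finset.prod_congr rfl fun e _ => this e).trans ?_
  rw [Finset.prod_subtype_of_mem (fun e : Sym2 V => if e ∈ T then (p : ℝ) else 1 - p) hF,
    Finset.prod_ite]
  congr 2
  · rw [Finset.filter_mem_eq_inter, Finset.inter_eq_right.2 hT]
  · rw [Finset.sdiff_eq_filter]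

theorem event_eq_biUnion (P : Finset (Sym2 V) → Prop) (F : Finset (Sym2 V)) [DecidablePred P] :
    {ω : Perc.Config G | P (openF ω F)} =
      ⋃ T ∈ F.powerset.filter P, {ω | openF ω F = T} := by
  ext ω
  simp only [Set.mem_ofPred_eq, Set.mem_iUnion, Finset.mem_filter, Finset.mem_powerset, exists_prop]
  exact ⟨fun h => ⟨_, ⟨openF_subset _ _, h⟩, rfl⟩, fun ⟨T, h, e⟩ => e ▸ h.2⟩

theorem measurableSet_event (P : Finset (Sym2 V) → Prop) {F : Finset (Sym2 V)}
    (hF : ∀ e ∈ F, e ∈ G.edgeSet) : MeasurableSet {ω : Perc.Config G | P (openF ω F)} := by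
  classical
  rw [event_eq_biUnion]
  exact Finset.measurableSet_biUnion _ fun T hT => measurableSet_openF_eq hF
    (Finset.mem_powerset.1 (Finset.mem_filter.1 hT).1)

/-- Probabilities of events depending on finitely many edges are finite expectations. -/
theorem measureReal_event [DecidableEq V] (p : unitInterval) (P : Finset (Sym2 V) → Prop) {F : Finset (Sym2 V)}
    (hF : ∀ e ∈ F, e ∈ G.edgeSet) :
    (Perc.measure G p).real {ω | P (openF ω F)} = ex (fun _ => (p : ℝ)) F fun T => ind (P T) := by
  classical
  rw [event_eq_biUnion, measureReal_biUnion_finset]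
  · rw [Finset.sum_filter]
    refine Finset.sum_congr rfl fun T hT => ?_
    dsimp only
    by_cases h : P T
    · rw [if_pos h, ind_true h, mul_one, measureReal_openF_eq p hF (Finset.mem_powerset.1 hT)]
    · rw [if_neg h, ind_false h, mul_zero]
  · intro T _ T' _ hne
    rw [Function.onFun, Set.disjoint_left]
    intro ω h h'
    exact hne (h.symm.trans h')
  · exact fun T hT => measurableSet_openF_eq hF
      (Finset.mem_powerset.1 (Finset.mem_filter.1 hT).1)

/-- The defining set of the critical point contains `1`. -/
theorem measure_one_pos [Infinite V] (hconn : G.Connected) (o : V) :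
    0 < Perc.measure G 1 {ω | (Perc.cluster ω Set.univ {o}).Infinite} := by
  have hall : ∀ ω : Perc.Config G, (∀ e, ω e = true) → Perc.cluster ω Set.univ {o} = Set.univ := by
    intro ω hω
    refine Set.eq_univ_of_forall fun v => ⟨trivial, o, rfl, ?_⟩
    obtain ⟨w⟩ := hconn.preconnected v o
    induction w with
    | nil => exact SimpleGraph.Reachable.refl _
    | cons hab w ih =>
      refine SimpleGraph.Reachable.trans (SimpleGraph.Adj.reachable ?_) ih
      exact ⟨trivial, trivial, hab, hω _⟩
  have h1 : Perc.measure G 1 = Measure.dirac fun _ => true := by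
    rw [← Measure.infinitePi_dirac, Perc.measure]
    simp only [bernoulliMeasure_one]
  rw [h1, Measure.dirac_apply_of_mem]
  · exact one_pos
  · rw [Set.mem_ofPred_eq, hall _ fun _ => rfl]
    exact Set.infinite_univ

end Measure

/-! ### Large balls are unlikely to be separated from infinity. -/

section LargeBalls

open Filter Topology

variable {V : Type*} [DecidableEq V] {G : SimpleGraph V} [G.LocallyFinite]

theorem cluster_subset_of_closed {ω : Perc.Config G} {A : Finset V} {F : Finset (Sym2 V)} {s : V}
    (hs : s ∈ A) (hF : star G A ⊆ F) (h : Disjoint (openF ω F) (bd G A)) :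
    Perc.cluster ω Set.univ {s} ⊆ A := by
  rintro v ⟨-, s', rfl, ⟨w⟩⟩
  induction w with
  | nil => exact hs
  | @cons a b c hab w ih =>
    have hb : b ∈ A := ih hs
    by_contra ha
    obtain ⟨-, -, hG, ho⟩ := hab
    have hbd : s(a, b) ∈ bd G A := mem_bd.2 ⟨hG, Or.inr ⟨hb, ha⟩⟩
    exact Finset.disjoint_left.1 h
      (mem_openF.2 ⟨hF (bd_subset_star A hbd), (G.mem_edgeSet).2 hG, ho⟩) hbd

theorem ex_Sep_eq (ρ : Sym2 V → ℝ) {I W : Finset V} {F : Finset (Sym2 V)} (hF : star G W ⊆ F) :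
    ex ρ F (fun T => ind (Sep G I W T)) = ex ρ (star G W) fun T => ind (Sep G I W T) :=
  ex_restrict ρ hF fun _ _ => ind_congr (Sep_inter subset_rfl)

theorem ex_Sep_mono {ρ : Sym2 V → ℝ} (h0 : ∀ i, 0 ≤ ρ i) (h1 : ∀ i, ρ i ≤ 1) {I I' W W' : Finset V}
    (hI : I' ⊆ I) (hW : W ⊆ W') :
    ex ρ (star G W) (fun T => ind (Sep G I W T)) ≤ ex ρ (star G W') fun T => ind (Sep G I' W' T) := by
  rw [← ex_Sep_eq ρ (star_mono hW)]
  refine ex_mono h0 h1 fun T _ => ind_mono ?_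
  rintro ⟨A, a, b, c⟩
  exact ⟨A, hI.trans a, b.trans hW, c⟩

theorem map_bal (φ : G ≃g G) (A : Finset V) (n : ℕ) :
    (bal G A n).map φ.toEmbedding.toEmbedding = bal G (A.map φ.toEmbedding.toEmbedding) n := by
  induction n with
  | zero => rfl
  | succ n ih =>
    ext v
    rw [mem_bal_succ, ← ih]
    constructor
    · intro h
      obtain ⟨u, hu, rfl⟩ := Finset.mem_map.1 h
      rcases mem_bal_succ.1 hu with hu | ⟨x, hx, hxu⟩
      · exact Or.inl (Finset.mem_map_of_mem _ hu)
      · exact Or.inr ⟨φ x, Finset.mem_map_of_mem _ hx, φ.map_adj_iff.2 hxu⟩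
    · rintro (h | ⟨x, hx, hxv⟩)
      · obtain ⟨u, hu, rfl⟩ := Finset.mem_map.1 h
        exact Finset.mem_map_of_mem _ (mem_bal_succ.2 (Or.inl hu))
      · obtain ⟨u, hu, rfl⟩ := Finset.mem_map.1 hx
        obtain ⟨y, rfl⟩ := φ.surjective v
        exact Finset.mem_map_of_mem _ (mem_bal_succ.2 (Or.inr ⟨u, hu, φ.map_adj_iff.1 hxv⟩))

theorem ex_Sep_map_le {π : ℝ} (h0 : 0 ≤ π) (h1 : π ≤ 1) (φ : G ≃g G) (I W : Finset V) :
    ex (fun _ => π) (star G (W.map φ.toEmbedding.toEmbedding)) (fun T =>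
        ind (Sep G (I.map φ.toEmbedding.toEmbedding) (W.map φ.toEmbedding.toEmbedding) T)) ≤
      ex (fun _ => π) (star G W) fun T => ind (Sep G I W T) := by
  have hs : star G (W.map φ.toEmbedding.toEmbedding) =
      (star G W).map φ.toEmbedding.toEmbedding.sym2Map := by
    ext e
    induction e with | _ a b => ?_
    obtain ⟨x, rfl⟩ := φ.surjective a
    obtain ⟨y, rfl⟩ := φ.surjective b
    have e1 : s(φ x, φ y) = φ.toEmbedding.toEmbedding.sym2Map s(x, y) := rfl
    have e2 : ∀ z, φ z ∈ W.map φ.toEmbedding.toEmbedding ↔ z ∈ W := fun z =>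
      Finset.mem_map' φ.toEmbedding.toEmbedding
    rw [mem_star, e2, e2, e1, Finset.mem_map', mem_star, φ.map_adj_iff]
  rw [hs, ex_map]
  refine ex_mono (fun _ => h0) (fun _ => h1) fun T _ => ind_mono ?_
  rintro ⟨A, hI, hW, hA⟩
  refine ⟨A.map φ.symm.toEmbedding.toEmbedding, ?_, ?_, ?_⟩
  · intro x hx
    have := hI (Finset.mem_map_of_mem _ hx)
    exact Finset.mem_map.2 ⟨_, this, φ.symm_apply_apply x⟩
  · intro x hx
    obtain ⟨y, hy, rfl⟩ := Finset.mem_map.1 hx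
    obtain ⟨z, hz, rfl⟩ := Finset.mem_map.1 (hW hy)
    have : φ.symm (φ z) = z := φ.symm_apply_apply z
    exact this.symm ▸ hz
  · rw [Finset.disjoint_left] at hA ⊢
    intro e heT he
    refine hA (Finset.mem_map_of_mem _ heT) ?_
    induction e with | _ x y => ?_
    have e2 : ∀ z, z ∈ A.map φ.symm.toEmbedding.toEmbedding ↔ φ z ∈ A := by
      intro z
      constructor
      · intro h
        obtain ⟨y, hy, rfl⟩ := Finset.mem_map.1 h
        have : φ (φ.symm y) = y := φ.apply_symm_apply y
        exact this.symm ▸ hy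
      · exact fun h => Finset.mem_map.2 ⟨_, h, φ.symm_apply_apply z⟩
    have e1 : φ.toEmbedding.toEmbedding.sym2Map s(x, y) = s(φ x, φ y) := rfl
    rw [mem_bd, e2, e2] at he
    rw [e1, mem_bd, φ.map_adj_iff]
    exact he

theorem exists_subset_bal (hconn : G.Connected) (w : V) (U : Finset V) : ∃ n, U ⊆ bal G {w} n := by
  induction U using Finset.induction_on with
  | empty => exact ⟨0, Finset.empty_subset _⟩
  | insert v U _ ih =>
    obtain ⟨n, hn⟩ := ih
    obtain ⟨p⟩ := hconn.preconnected w v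
    refine ⟨max n p.length, Finset.insert_subset ?_ (hn.trans (bal_mono_radius _ (le_max_left _ _)))⟩
    exact mem_bal.2 ⟨w, Finset.mem_singleton_self w, p, le_max_right _ _⟩

/-- Above the critical point, large balls are unlikely to be separated from infinity,
uniformly over the confining set. -/
theorem exists_radius [Infinite V] (hconn : G.Connected) (htrans : Perc.Transitive G) (o : V)
    {p : ℝ} (hp : Perc.criticalPoint G o < p) :
    ∃ π : ℝ, 0 ≤ π ∧ π ≤ 1 ∧ π < p ∧ ∀ ε > 0, ∃ m, ∀ w U,
      ex (fun _ => π) (star G U) (fun T => ind (Sep G (bal G {w} m) U T)) ≤ ε := by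
  have hne : {p : ℝ | ∃ hp : p ∈ unitInterval,
      0 < Perc.measure G ⟨p, hp⟩ {ω | (Perc.cluster ω Set.univ {o}).Infinite}}.Nonempty :=
    ⟨1, ⟨zero_le_one, le_rfl⟩, measure_one_pos hconn o⟩
  obtain ⟨π, ⟨hπ, hpos⟩, hπp⟩ := exists_lt_of_csInf_lt hne hp
  have h0 : (0 : ℝ) ≤ π := hπ.1
  have h1 : π ≤ 1 := hπ.2
  refine ⟨π, h0, h1, hπp, fun ε hε => ?_⟩
  set ρ : Sym2 V → ℝ := fun _ => π
  have r0 : ∀ i, 0 ≤ ρ i := fun _ => h0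
  have r1 : ∀ i, ρ i ≤ 1 := fun _ => h1
  set e : ℕ → ℕ → ℝ := fun m n =>
    ex ρ (star G (bal G {o} n)) fun T => ind (Sep G (bal G {o} m) (bal G {o} n) T) with he
  set μ := Perc.measure G ⟨π, hπ⟩
  set θ : ℝ := μ.real {ω | (Perc.cluster ω Set.univ {o}).Infinite}
  have hθ : 0 < θ := ENNReal.toReal_pos hpos.ne' (measure_ne_top _ _)
  have en : ∀ m n, 0 ≤ e m n := fun m n => ex_ind_nonneg r0 r1 _ _
  have mono_n : ∀ m, Monotone (e m) := fun m n n' h =>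
    ex_Sep_mono r0 r1 subset_rfl (bal_mono_radius _ h)
  have anti_m : ∀ n, Antitone fun m => e m n := fun n m m' h =>
    ex_Sep_mono r0 r1 (bal_mono_radius _ h) subset_rfl
  have bound : ∀ m n, e m n ≤ 1 - θ := by
    intro m n
    refine (anti_m n (Nat.zero_le m)).trans ?_
    have hF : ∀ e ∈ star G (bal G {o} n), e ∈ G.edgeSet := fun e he => adj_of_mem_star he
    have hev := measureReal_event ⟨π, hπ⟩ (fun T => ¬ Sep G (bal G {o} 0) (bal G {o} n) T) hF
    simp only [ind_not] at hev
    rw [ex_sub, ex_const] at hev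
    have : θ ≤ μ.real {ω | ¬ Sep G (bal G {o} 0) (bal G {o} n) (openF ω (star G (bal G {o} n)))} := by
      refine measureReal_mono ?_
      rintro ω hω ⟨A, hA, hW, hd⟩
      exact hω ((Finset.finite_toSet A).subset
        (cluster_subset_of_closed (hA (Finset.mem_singleton_self o)) (star_mono hW) hd))
    rw [hev] at this
    change θ ≤ 1 - e 0 n at this
    linarith
  -- Since `n < m'`, a set containing the ball of radius `m'` has no boundary edge touching the ball
  -- of radius `n`, so the two separation events are independent. If the outer one occurs and the
  -- inner one fails, the ball of radius `m` is separated within radius `n'` but not within radius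
  -- `n`.
  have key : ∀ m n m' n', m ≤ m' → n < m' → n ≤ n' →
      e m' n' ≤ e m' n' * e m n + (e m n' - e m n) := by
    intro m n m' n' hmm h2 h4
    have hs : star G (bal G {o} n) ⊆ star G (bal G {o} n') := star_mono (bal_mono_radius _ h4)
    have e1 : e m n = ex ρ (star G (bal G {o} n')) fun T => ind (Sep G (bal G {o} m) (bal G {o} n) T) :=
      (ex_Sep_eq ρ hs).symm
    have hind := ex_indep ρ (star G (bal G {o} n')) (star G (bal G {o} n))
      (f := fun T => ind (Sep G (bal G {o} m) (bal G {o} n) T))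
      (g := fun T => ind (Sep G (bal G {o} m') (bal G {o} n') T)) ?_ ?_
    · have : e m' n' ≤ ex ρ (star G (bal G {o} n')) (fun T =>
          ind (Sep G (bal G {o} m) (bal G {o} n) T) * ind (Sep G (bal G {o} m') (bal G {o} n') T) +
          (ind (Sep G (bal G {o} m) (bal G {o} n') T) - ind (Sep G (bal G {o} m) (bal G {o} n) T))) := by
        refine ex_mono r0 r1 fun T _ => ?_
        have hA : ind (Sep G (bal G {o} m) (bal G {o} n) T) ≤ ind (Sep G (bal G {o} m) (bal G {o} n') T) :=
          ind_mono fun ⟨A, a, b, c⟩ => ⟨A, a, b.trans (bal_mono_radius _ h4), c⟩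
        have hB : ind (Sep G (bal G {o} m') (bal G {o} n') T) ≤ ind (Sep G (bal G {o} m) (bal G {o} n') T) :=
          ind_mono fun ⟨A, a, b, c⟩ => ⟨A, (bal_mono_radius _ hmm).trans a, b, c⟩
        by_cases hS : Sep G (bal G {o} m) (bal G {o} n) T
        · rw [ind_true hS] at hA ⊢; linarith
        · rw [ind_false hS] at hA ⊢; linarith
      rw [ex_add, ex_sub, hind, ← e1] at this
      change e m' n' ≤ e m n * e m' n' + (e m n' - e m n) at this
      linarith
    · intro T T' h
      refine ind_congr ?_
      rw [← Sep_inter subset_rfl, h, Sep_inter subset_rfl]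
    · intro T T' h
      have : ∀ T T', T \ star G (bal G {o} n) = T' \ star G (bal G {o} n) →
          Sep G (bal G {o} m') (bal G {o} n') T → Sep G (bal G {o} m') (bal G {o} n') T' := by
        rintro T T' h ⟨A, a, b, c⟩
        refine ⟨A, a, b, ?_⟩
        rw [Finset.disjoint_left] at c ⊢
        intro x hx hb
        have hns : x ∉ star G (bal G {o} n) := by
          intro hs
          induction x with | _ u v => ?_
          obtain ⟨huv, hs⟩ := mem_star.1 hs
          have hsub := (bal_mono_radius {o} (Nat.succ_le_of_lt h2)).trans a
          have hu : u ∈ A ∧ v ∈ A := by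
            rcases hs with hs | hs
            · exact ⟨hsub (mem_bal_succ.2 (Or.inl hs)), hsub (mem_bal_succ.2 (Or.inr ⟨u, hs, huv⟩))⟩
            · exact ⟨hsub (mem_bal_succ.2 (Or.inr ⟨v, hs, huv.symm⟩)), hsub (mem_bal_succ.2 (Or.inl hs))⟩
          have := mem_bd.1 hb
          tauto
        exact c (Finset.mem_sdiff.1 (h.symm ▸ Finset.mem_sdiff.2 ⟨hx, hns⟩)).1 hb
      exact ind_congr ⟨this T T' h, this T' T h.symm⟩
  have bdd : ∀ m, BddAbove (Set.range (e m)) := fun m => ⟨1 - θ, by rintro _ ⟨n, rfl⟩; exact bound m n⟩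
  set s : ℕ → ℝ := fun m => ⨆ n, e m n
  have hs : ∀ m, Tendsto (e m) atTop (𝓝 (s m)) := fun m => tendsto_atTop_ciSup (mono_n m) (bdd m)
  have es : ∀ m n, e m n ≤ s m := fun m n => le_ciSup (bdd m) n
  have s_anti : Antitone s := fun m m' h => ciSup_le fun n => (anti_m n h).trans (es m n)
  have s_nonneg : ∀ m, 0 ≤ s m := fun m => (en m 0).trans (es m 0)
  have s_le : ∀ m, s m ≤ 1 - θ := fun m => ciSup_le (bound m)
  set a : ℝ := ⨅ m, s m
  have ha : Tendsto s atTop (𝓝 a) :=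
    tendsto_atTop_ciInf s_anti ⟨0, by rintro _ ⟨m, rfl⟩; exact s_nonneg m⟩
  have a_nonneg : 0 ≤ a := le_ciInf s_nonneg
  have a_le : a ≤ 1 - θ := le_of_tendsto' ha s_le
  have step1 : ∀ m n m', m ≤ m' → n < m' → s m' ≤ s m' * e m n + (s m - e m n) := by
    intro m n m' h1 h2
    refine le_of_tendsto_of_tendsto (hs m') (((hs m').mul_const _).add ((hs m).sub_const _)) ?_
    filter_upwards [eventually_ge_atTop n] with n' hn'
    exact key m n m' n' h1 h2 hn'
  have step2 : ∀ m n, a ≤ a * e m n + (s m - e m n) := by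
    intro m n
    refine le_of_tendsto_of_tendsto ha ((ha.mul_const _).add_const _) ?_
    filter_upwards [eventually_gt_atTop n, eventually_ge_atTop m] with m' h1 h2
    exact step1 m n m' h2 h1
  have step3 : ∀ m, a ≤ a * s m + (s m - s m) := fun m =>
    ge_of_tendsto' (((hs m).const_mul a).add ((hs m).const_sub (s m))) (step2 m)
  -- Limits in the order `n'`, `m'`, `n`, `m` turn `key` into `a ≤ a * a`. With `0 ≤ a ≤ 1 - θ < 1`
  -- this forces `a = 0`.
  have step4 : a ≤ a * a := by
    refine ge_of_tendsto' (ha.const_mul a) fun m => ?_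
    have := step3 m
    linarith
  have a_zero : a < ε := by nlinarith
  obtain ⟨m, hm⟩ := (ha.eventually_lt_const a_zero).exists
  refine ⟨m, fun w U => ?_⟩
  obtain ⟨n, hn⟩ := exists_subset_bal hconn w U
  obtain ⟨φ, rfl⟩ := htrans o w
  have hmap : ∀ k, (bal G {o} k).map φ.toEmbedding.toEmbedding = bal G {φ o} k := fun k =>
    (map_bal φ {o} k).trans (by rw [Finset.map_singleton]; rfl)
  refine (ex_Sep_mono r0 r1 subset_rfl hn).trans ?_
  rw [← hmap m, ← hmap n]
  exact (ex_Sep_map_le h0 h1 φ _ _).trans ((es m n).trans hm.le)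

end LargeBalls

/-! ### Exponential bound for separation, by sprinkling open balls. -/

section Separation

variable {V : Type*} [DecidableEq V] {G : SimpleGraph V} [G.LocallyFinite]

variable (G) in
/-- Density `π` on the edges inside `U`. -/
noncomputable def inside (π : ℝ) (U : Finset V) (e : Sym2 V) : ℝ := if e ∈ inn G U then π else 0

/-- Superposition of density `q` and of density `δ` off `N`. -/
noncomputable def sprinkle (δ q : ℝ) (N : Finset (Sym2 V)) (e : Sym2 V) : ℝ :=
  1 - (1 - if e ∈ N then 0 else δ) * (1 - q)

variable (G) in
/-- Superposition of `inside` and `sprinkle`. -/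
noncomputable def dens (π δ q : ℝ) (U : Finset V) (N : Finset (Sym2 V)) (e : Sym2 V) : ℝ :=
  1 - (1 - inside G π U e) * (1 - sprinkle δ q N e)

theorem superpose_mem {a b : ℝ} (ha : 0 ≤ a ∧ a ≤ 1) (hb : 0 ≤ b ∧ b ≤ 1) :
    0 ≤ 1 - (1 - a) * (1 - b) ∧ 1 - (1 - a) * (1 - b) ≤ 1 := by
  constructor
  · nlinarith [mul_nonneg ha.1 (sub_nonneg.2 hb.2)]
  · nlinarith [mul_nonneg (sub_nonneg.2 ha.2) (sub_nonneg.2 hb.2)]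

theorem inside_mem {π : ℝ} (hπ : 0 ≤ π ∧ π ≤ 1) (U : Finset V) (e : Sym2 V) :
    0 ≤ inside G π U e ∧ inside G π U e ≤ 1 := by
  unfold inside; split_ifs
  · exact hπ
  · norm_num

theorem sprinkle_mem {δ q : ℝ} (hδ : 0 ≤ δ ∧ δ ≤ 1) (hq : 0 ≤ q ∧ q ≤ 1) (N : Finset (Sym2 V))
    (e : Sym2 V) : 0 ≤ sprinkle δ q N e ∧ sprinkle δ q N e ≤ 1 := by
  unfold sprinkle
  refine superpose_mem ?_ hq
  split_ifs
  · norm_num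
  · exact hδ

theorem dens_mem {π δ q : ℝ} (hπ : 0 ≤ π ∧ π ≤ 1) (hδ : 0 ≤ δ ∧ δ ≤ 1) (hq : 0 ≤ q ∧ q ≤ 1)
    (U : Finset V) (N : Finset (Sym2 V)) (e : Sym2 V) :
    0 ≤ dens G π δ q U N e ∧ dens G π δ q U N e ≤ 1 :=
  superpose_mem (inside_mem hπ U e) (sprinkle_mem hδ hq N e)

theorem le_dens {π δ q : ℝ} (hπ : 0 ≤ π ∧ π ≤ 1) (hδ : 0 ≤ δ ∧ δ ≤ 1) (hq : 0 ≤ q ∧ q ≤ 1)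
    (U : Finset V) (N : Finset (Sym2 V)) (e : Sym2 V) : q ≤ dens G π δ q U N e := by
  have h1 : q ≤ sprinkle δ q N e := by
    unfold sprinkle
    split_ifs
    · linarith
    · nlinarith [mul_nonneg hδ.1 (sub_nonneg.2 hq.2)]
  have h2 := inside_mem (G := G) hπ U e
  have h3 := sprinkle_mem hδ hq N e
  unfold dens
  nlinarith [mul_nonneg h2.1 (sub_nonneg.2 h3.2)]

theorem clus_inter (U B : Finset V) (T : Finset (Sym2 V)) :
    clus G U B (T ∩ inn G U) = clus G U B T := by
  refine (clus_mono subset_rfl Finset.inter_subset_left).antisymm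
    (clus_minimal (clus_subset _ _ _) (subset_clus _ _ _) ?_)
  have := clus_closed (G := G) U B (T ∩ inn G U)
  rw [Finset.disjoint_left] at this ⊢
  intro e he hb
  exact this (Finset.mem_inter.2 ⟨he, (Finset.mem_inter.1 hb).2⟩) hb

variable (G) in
/-- `B` does not meet `I`, and few edges join its cluster to `I`. -/
def FarIn (k : ℕ) (I W B : Finset V) (T : Finset (Sym2 V)) : Prop :=
  Disjoint B I ∧ (bd G I ∩ bd G (clus G (W \ I) B T)).card < k

variable (G) in
/-- `B` does not meet the complement of `W`, and few edges join its cluster to that complement. -/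
def FarOut (k : ℕ) (I W B : Finset V) (T : Finset (Sym2 V)) : Prop :=
  B ⊆ W ∧ (bd G (clus G (W \ I) B T) ∩ bd G W).card < k

theorem antitone_FarIn (k : ℕ) (I W B : Finset V) : Antitone fun T => ind (FarIn G k I W B T) := by
  intro T T' h
  refine ind_mono fun ⟨h1, h2⟩ => ⟨h1, lt_of_le_of_lt (Finset.card_le_card ?_) h2⟩
  refine bd_inter_mono_of_disjoint (clus_mono subset_rfl h) ?_
  exact Finset.disjoint_left.2 fun v hI hv =>
    (Finset.mem_sdiff.1 (clus_subset _ _ _ hv)).2 hI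

theorem antitone_FarOut (k : ℕ) (I W B : Finset V) :
    Antitone fun T => ind (FarOut G k I W B T) := by
  intro T T' h
  refine ind_mono fun ⟨h1, h2⟩ => ⟨h1, lt_of_le_of_lt (Finset.card_le_card ?_) h2⟩
  exact bd_inter_mono_of_subset (clus_mono subset_rfl h)
    ((clus_subset _ _ _).trans Finset.sdiff_subset)

/-- Closing the few exits of a cluster that is far from both ends separates it. -/
theorem closing_exits {π : ℝ} (hπ : 0 ≤ π ∧ π ≤ 1) (k : ℕ) {I W B : Finset V} {F : Finset (Sym2 V)}
    (hF : inn G (W \ I) ⊆ F) :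
    ex (inside G π (W \ I)) F (fun T => ind (FarIn G k I W B T) * ind (FarOut G k I W B T)) *
      (1 - π) ^ (2 * k) ≤ ex (fun _ => π) (star G (W \ I)) fun T => ind (Sep G B (W \ I) T) := by
  set U := W \ I with hU
  have hc : ∀ T, clus G U B (T ∩ inn G U) = clus G U B T := clus_inter U B
  rw [ex_restrict (inside G π U) hF (fun T _ => by simp only [FarIn, FarOut, ← hU, hc])]
  rw [ex_congr_density (ρ' := fun _ => π) (fun e he => by rw [inside, if_pos he])]
  -- The cluster reads only edges inside `U`, while its exits from `U` lie on the boundary of `U`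
  -- and are independent of it.
  have hst : star G U = inn G U ∪ bd G U := by
    ext e; induction e with | _ x y => ?_
    simp only [Finset.mem_union, mem_star, mem_inn, mem_bd]; tauto
  have hdis : Disjoint (inn G U) (bd G U) := by
    rw [Finset.disjoint_left]
    intro e; induction e with | _ x y => ?_
    simp only [mem_inn, mem_bd]; tauto
  rw [hst, ex_union _ hdis, ← ex_mul_const]
  refine ex_mono (fun _ => hπ.1) (fun _ => hπ.2) fun T hT => ?_
  rw [← ind_and]
  by_cases hfar : FarIn G k I W B T ∧ FarOut G k I W B T
  · rw [ind_true hfar, one_mul]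
    obtain ⟨⟨h1, h2⟩, h3, h4⟩ := hfar
    set Z := clus G U B T with hZ
    have hZU : Z ⊆ U := clus_subset _ _ _
    have hBZ : B ⊆ Z := by
      intro v hv
      refine subset_clus U B T (Finset.mem_inter.2 ⟨hv, Finset.mem_sdiff.2 ⟨h3 hv, ?_⟩⟩)
      exact Finset.disjoint_left.1 h1 hv
    -- An edge leaving both the cluster and `W \ I` ends in `I` or outside `W`, and there are fewer
    -- than `k` of either kind.
    have hcard : (bd G Z ∩ bd G U).card ≤ 2 * k := by
      have : bd G Z ∩ bd G U ⊆ (bd G I ∩ bd G Z) ∪ (bd G Z ∩ bd G W) := by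
        intro e; induction e with | _ x y => ?_
        have := @hZU x; have := @hZU y
        simp only [Finset.mem_inter, Finset.mem_union, mem_bd, hU, Finset.mem_sdiff] at *
        grind
      have := (Finset.card_le_card this).trans (Finset.card_union_le _ _)
      omega
    have hle : ex (fun _ => π) (bd G U) (fun T' => ind (Disjoint T' (bd G Z ∩ bd G U))) ≤
        ex (fun _ => π) (bd G U) fun T' => ind (Sep G B U (T ∪ T')) := by
      refine ex_mono (fun _ => hπ.1) (fun _ => hπ.2) fun T' hT' => ind_mono fun hd => ?_
      refine ⟨Z, hBZ, hZU, ?_⟩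
      rw [Finset.disjoint_left] at hd ⊢
      intro e he hb
      rcases Finset.mem_union.1 he with he | he
      · exact Finset.disjoint_left.1 (clus_closed U B T) he (Finset.mem_inter.2 ⟨hb, hT he⟩)
      · exact hd he (Finset.mem_inter.2 ⟨hb, hT' he⟩)
    refine le_trans ?_ hle
    rw [ex_disjoint _ Finset.inter_subset_right, Finset.prod_const]
    exact pow_le_pow_of_le_one (sub_nonneg.2 hπ.2) (by linarith [hπ.1]) hcard
  · rw [ind_false hfar, zero_mul]
    exact ex_ind_nonneg (fun _ => hπ.1) (fun _ => hπ.2) _ _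

/-- A separator cannot cut a fully open ball. If it contains the ball it also contains the ball's
cluster, which may join `I`; otherwise it avoids that cluster, which may be removed from `W`. The
cluster is taken in `T₁` alone, so that `T₂` remains unexplored. -/
theorem ind_Sep_open_ball_le {I W : Finset V} {u : V} {n : ℕ} (T₁ T₂ : Finset (Sym2 V)) :
    ind (Sep G I W (T₁ ∪ T₂ ∪ inn G (bal G {u} n))) ≤
      ind (bal G {u} n ⊆ W) * ind (Sep G (I ∪ clus G (W \ I) (bal G {u} n) T₁) W (T₁ ∪ T₂)) +
      ind (Disjoint (bal G {u} n) I) *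
        ind (Sep G I (W \ clus G (W \ I) (bal G {u} n) T₁) (T₁ ∪ T₂)) := by
  rw [← ind_and, ← ind_and]
  refine (ind_mono ?_).trans (ind_or_le _ _)
  rintro ⟨A, hI, hW, hA⟩
  have hA1 : Disjoint (T₁ ∪ T₂) (bd G A) := hA.mono_left Finset.subset_union_left
  have hA2 : Disjoint T₁ (bd G A) := hA1.mono_left Finset.subset_union_left
  rcases bal_subset_or_disjoint (hA.mono_left Finset.subset_union_right) with h | h
  · left
    exact ⟨h.trans hW, A, Finset.union_subset hI (clus_subset_of_subset hA2 h), hW, hA1⟩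
  · right
    refine ⟨h.mono_right hI, A, hI, fun v hv => Finset.mem_sdiff.2 ⟨hW hv, fun hc => ?_⟩, hA1⟩
    exact Finset.disjoint_left.1 (clus_disjoint_of_disjoint hA2 h) hc hv

/-- Forgetting the edges at `Z` in the `π` layer of `U` leaves exactly the `π` layer of `U \ Z`, so
the same family of densities is recovered. -/
theorem ex_resampled {π δ q : ℝ} (I W : Finset V) {U Z : Finset V} (N F : Finset (Sym2 V)) :
    ex (inside G π U) F (fun T => ex (sprinkle δ q N) F fun T' =>
        ind (Sep G I W (T \ star G Z ∪ T'))) =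
      ex (dens G π δ q (U \ Z) N) F fun T => ind (Sep G I W T) := by
  rw [ex_sdiff (inside G π U) F (star G Z)
    (fun T => ex (sprinkle δ q N) F fun T' => ind (Sep G I W (T ∪ T')))]
  have : (fun i => if i ∈ star G Z then 0 else inside G π U i) = inside G π (U \ Z) := by
    have key : ∀ e, e ∈ inn G (U \ Z) ↔ e ∉ star G Z ∧ e ∈ inn G U := by
      intro e
      induction e with | _ x y => ?_
      simp only [mem_star, mem_inn, Finset.mem_sdiff]
      tauto
    funext e
    unfold inside
    by_cases h : e ∈ star G Z <;> simp [key, h]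
  rw [this]
  exact (ex_superpose (inside G π (U \ Z)) (sprinkle δ q N) F fun T => ind (Sep G I W T)).symm

/-- The cluster of the ball is explored in the `π` layer only. Finding it reveals the edges at the
cluster; these are dropped, and the rest may be resampled by `ex_resample`. -/
theorem ex_open_ball {π δ q : ℝ} (hπ : 0 ≤ π ∧ π ≤ 1) (hδ : 0 ≤ δ ∧ δ ≤ 1) (hq : 0 ≤ q ∧ q ≤ 1)
    (I W : Finset V) (N F : Finset (Sym2 V)) (u : V) (n : ℕ) :
    ex (dens G π δ q (W \ I) N) F (fun T => ind (Sep G I W (T ∪ inn G (bal G {u} n)))) ≤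
      ex (inside G π (W \ I)) F fun T =>
        ind (bal G {u} n ⊆ W) *
          ex (dens G π δ q ((W \ I) \ clus G (W \ I) (bal G {u} n) T) N) F
            (fun T' => ind (Sep G (I ∪ clus G (W \ I) (bal G {u} n) T) W T')) +
        ind (Disjoint (bal G {u} n) I) *
          ex (dens G π δ q ((W \ I) \ clus G (W \ I) (bal G {u} n) T) N) F
            (fun T' => ind (Sep G I (W \ clus G (W \ I) (bal G {u} n) T) T')) := by
  set U := W \ I
  set B := bal G {u} n
  have a0 := fun e => (inside_mem (G := G) hπ U e).1
  have a1 := fun e => (inside_mem (G := G) hπ U e).2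
  have b0 := fun e => (sprinkle_mem hδ hq N e).1
  have b1 := fun e => (sprinkle_mem hδ hq N e).2
  set g : Finset V → Finset (Sym2 V) → ℝ := fun Z T => ex (sprinkle δ q N) F fun T' =>
    ind (B ⊆ W) * ind (Sep G (I ∪ Z) W (T \ star G Z ∪ T')) +
    ind (Disjoint B I) * ind (Sep G I (W \ Z) (T \ star G Z ∪ T'))
  have h1 : ex (dens G π δ q U N) F (fun T => ind (Sep G I W (T ∪ inn G B))) ≤
      ex (inside G π U) F fun T => g (clus G U B T) T := by
    unfold dens
    rw [ex_superpose]
    refine ex_mono a0 a1 fun T _ => ex_mono b0 b1 fun T' _ => ?_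
    refine (ind_Sep_open_ball_le T T').trans ?_
    have hs : T \ star G (clus G U B T) ∪ T' ⊆ T ∪ T' :=
      Finset.union_subset_union_left Finset.sdiff_subset
    exact add_le_add
      (mul_le_mul_of_nonneg_left (ind_mono fun h => h.mono hs) (ind_nonneg _))
      (mul_le_mul_of_nonneg_left (ind_mono fun h => h.mono hs) (ind_nonneg _))
  refine h1.trans (le_of_eq ?_)
  rw [ex_resample (inside G π U) F (clus G U B) (star G) g]
  · refine ex_congr fun T _ => ?_
    simp only [g, ex_add, ex_const_mul, ex_resampled]
  · exact fun T T' h => clus_determined h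
  · intro s T T' h
    simp only [g, h]

/-- Every separator is crossed by all edges from `I` to the complement of `W`, so all of them must
be closed. -/
theorem ex_Sep_initial {π δ q : ℝ} (hπ : 0 ≤ π ∧ π ≤ 1) (hδ : 0 ≤ δ ∧ δ ≤ 1)
    (hq : 0 ≤ q ∧ q ≤ 1) {I W : Finset V} {F : Finset (Sym2 V)}
    (hF : star G W ⊆ F) (U : Finset V) (N : Finset (Sym2 V)) :
    ex (dens G π δ q U N) F (fun T => ind (Sep G I W T)) ≤ (1 - q) ^ (bd G I ∩ bd G W).card := by
  have d0 := fun e => (dens_mem (G := G) hπ hδ hq U N e).1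
  have d1 := fun e => (dens_mem (G := G) hπ hδ hq U N e).2
  calc _ ≤ ex (dens G π δ q U N) F fun T => ind (Disjoint T (bd G I ∩ bd G W)) := by
        refine ex_mono d0 d1 fun T _ => ind_mono ?_
        rintro ⟨A, hI, hW, hA⟩
        refine hA.mono_right fun e => ?_
        induction e with | _ x y => ?_
        have := @hI x; have := @hI y; have := @hW x; have := @hW y
        simp only [Finset.mem_inter, mem_bd]
        grind
    _ = ∏ e ∈ bd G I ∩ bd G W, (1 - dens G π δ q U N e) :=
        ex_disjoint _ (Finset.inter_subset_right.trans ((bd_subset_star W).trans hF))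
    _ ≤ ∏ _e ∈ bd G I ∩ bd G W, (1 - q) :=
        Finset.prod_le_prod (fun e _ => sub_nonneg.2 (d1 e))
          fun e _ => sub_le_sub_left (le_dens hπ hδ hq U N e) 1
    _ = _ := by rw [Finset.prod_const]

/-- Each summand is at most `1/8` unless the relevant exits number fewer than `k`, which itself has
probability at most `1/8`; the four contributions add up to `1/2`. Exits of `B` are at least as many
as those of the smaller balls, since the clusters are nested. -/
theorem ex_exits_le {π q : ℝ} (hπ : 0 ≤ π ∧ π ≤ 1) (hq : 0 ≤ q ∧ q ≤ 1) {k : ℕ}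
    (hk : (1 - q) ^ k ≤ 1 / 8) {I W B B₁ B₂ : Finset V} {F : Finset (Sym2 V)}
    (hB₁ : B₁ ⊆ B) (hB₂ : B₂ ⊆ B)
    (h₁ : ex (inside G π (W \ I)) F (fun T => ind (FarIn G k I W B₁ T)) ≤ 1 / 8)
    (h₂ : ex (inside G π (W \ I)) F (fun T => ind (FarOut G k I W B₂ T)) ≤ 1 / 8) :
    ex (inside G π (W \ I)) F (fun T =>
      ind (B ⊆ W) * (1 - q) ^ (bd G (clus G (W \ I) B T) ∩ bd G W).card +
      ind (Disjoint B I) * (1 - q) ^ (bd G I ∩ bd G (clus G (W \ I) B T)).card) ≤ 1 / 2 := by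
  have a0 := fun e => (inside_mem (G := G) hπ (W \ I) e).1
  have a1 := fun e => (inside_mem (G := G) hπ (W \ I) e).2
  have q0 : 0 ≤ 1 - q := sub_nonneg.2 hq.2
  have q1 : 1 - q ≤ 1 := by linarith [hq.1]
  have key : ∀ (P Q : Prop) (c : ℕ), (P → ¬ Q → k ≤ c) → ind P * (1 - q) ^ c ≤ 1 / 8 + ind Q := by
    intro P Q c h
    have hc1 : (1 - q) ^ c ≤ 1 := pow_le_one₀ q0 q1
    have hc0 : 0 ≤ (1 - q) ^ c := pow_nonneg q0 c
    by_cases hP : P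
    · by_cases hQ : Q
      · rw [ind_true hP, ind_true hQ]; linarith
      · rw [ind_true hP, ind_false hQ]
        have := pow_le_pow_of_le_one q0 q1 (h hP hQ)
        linarith
    · rw [ind_false hP]; linarith [ind_nonneg Q]
  calc _ ≤ ex (inside G π (W \ I)) F (fun T => (1 / 8 + ind (FarOut G k I W B₂ T)) +
        (1 / 8 + ind (FarIn G k I W B₁ T))) := by
        refine ex_mono a0 a1 fun T _ => add_le_add (key _ _ _ ?_) (key _ _ _ ?_)
        · intro hP hQ
          have : k ≤ _ := not_lt.1 fun h => hQ ⟨hB₂.trans hP, h⟩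
          refine this.trans (Finset.card_le_card (bd_inter_mono_of_subset
            (clus_mono hB₂ subset_rfl) ((clus_subset _ _ _).trans Finset.sdiff_subset)))
        · intro hP hQ
          have : k ≤ _ := not_lt.1 fun h => hQ ⟨hP.mono_left hB₁, h⟩
          refine this.trans (Finset.card_le_card (bd_inter_mono_of_disjoint
            (clus_mono hB₁ subset_rfl) (Finset.disjoint_left.2 fun v hI hv =>
              (Finset.mem_sdiff.1 (clus_subset _ _ _ hv)).2 hI)))
    _ = 1 / 8 + ex (inside G π (W \ I)) F (fun T => ind (FarOut G k I W B₂ T)) +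
        (1 / 8 + ex (inside G π (W \ I)) F (fun T => ind (FarIn G k I W B₁ T))) := by
        simp only [ex_add, ex_const]
    _ ≤ 1 / 2 := by linarith

/-- An edge of a large boundary which is far from a given small set of edges. -/
theorem exists_far_edge {d : ℕ} (hd : ∀ v, G.degree v ≤ d) (n : ℕ) {L : Finset V}
    {N : Finset (Sym2 V)} (h : d * (d + 1) ^ n * N.card < (bd G L).card) :
    ∃ u v, G.Adj u v ∧ u ∈ L ∧ v ∉ L ∧ Disjoint (inn G (bal G {u} n)) N := by
  set bad : Finset V := N.biUnion fun e => bal G {(Quot.out e).1} n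
  have hbad : (star G bad).card ≤ d * (d + 1) ^ n * N.card := by
    refine (card_star_le hd bad).trans ?_
    have : bad.card ≤ N.card * (d + 1) ^ n := Finset.card_biUnion_le_card_mul _ _ _ fun e _ => by
      simpa using card_bal_le hd {(Quot.out e).1} n
    calc d * bad.card ≤ d * (N.card * (d + 1) ^ n) := Nat.mul_le_mul_left _ this
      _ = _ := by ring
  obtain ⟨e, he, hne⟩ := Finset.exists_mem_notMem_of_card_lt_card (hbad.trans_lt h)
  have key : ∀ u v, s(u, v) ∉ star G bad → G.Adj u v → Disjoint (inn G (bal G {u} n)) N := by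
    intro u v hs huv
    rw [Finset.disjoint_left]
    intro e he hN
    refine hs (mem_star.2 ⟨huv, Or.inl (Finset.mem_biUnion.2 ⟨e, hN, ?_⟩)⟩)
    have hout : s((Quot.out e).1, (Quot.out e).2) = e := Quot.out_eq e
    rw [← hout] at he
    exact mem_bal_comm.1 (mem_inn.1 he).2.1
  induction e with | _ x y => ?_
  obtain ⟨hxy, ⟨hx, hy⟩ | ⟨hy, hx⟩⟩ := mem_bd.1 he
  · exact ⟨x, y, hxy, hx, hy, key x y hne hxy⟩
  · exact ⟨y, x, hxy.symm, hy, hx, key y x (Sym2.eq_swap ▸ hne) hxy.symm⟩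

/-- Bound on the number of edges of a ball of radius `n`. -/
def edgeBound (d n : ℕ) : ℕ := d * (d + 1) ^ n + 1

/-- Induction on the number `r` of sprinkled balls. `N` holds the edges whose `δ` layer is spent,
and the budget keeps `M * N.card < K` at the start of every round, where `M = edgeBound d (m + 1)`.
A round opens a fresh ball where points well joined to `I` meet points well joined to the complement
of `W`. On either side of a separator its cluster tends to add edges to the cut; the exponent of `1
- q` records these, so that `I` may grow or `W` shrink in the induction hypothesis. -/
theorem ex_Sep_le_of_budget {π δ q : ℝ} (hπ : 0 ≤ π ∧ π < 1) (hδ : 0 ≤ δ ∧ δ ≤ 1)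
    (hq : 0 ≤ q ∧ q ≤ 1) {d k m : ℕ} (hd : ∀ v, G.degree v ≤ d) (hk : (1 - q) ^ k ≤ 1 / 8)
    (hm : ∀ w U, ex (fun _ => π) (star G U) (fun T => ind (Sep G (bal G {w} m) U T)) ≤
      (1 - π) ^ (2 * k) / 64)
    {S Λ : Finset V} {K : ℕ} (hK : ∀ L, S ⊆ L → K ≤ (bd G L).card) {F : Finset (Sym2 V)}
    (hF : star G (bal G Λ (m + 1)) ⊆ F) (r : ℕ) :
    ∀ (I W : Finset V) (N : Finset (Sym2 V)), S ⊆ I → I ⊆ W → W ⊆ Λ →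
      edgeBound d (m + 1) * (N.card + edgeBound d (m + 1) * r) <
        K + edgeBound d (m + 1) * edgeBound d (m + 1) →
      ex (dens G π δ q (W \ I) N) F (fun T => ind (Sep G I W T)) ≤
        (1 - q) ^ (bd G I ∩ bd G W).card * (1 - δ ^ edgeBound d (m + 1) / 2) ^ r := by
  set M := edgeBound d (m + 1) with hM
  have hπ' : 0 ≤ π ∧ π ≤ 1 := ⟨hπ.1, hπ.2.le⟩
  have q0 : 0 ≤ 1 - q := sub_nonneg.2 hq.2
  have hδM : 0 ≤ δ ^ M ∧ δ ^ M ≤ 1 := ⟨pow_nonneg hδ.1 _, pow_le_one₀ hδ.1 hδ.2⟩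
  set lam := 1 - δ ^ M / 2
  have lam0 : 0 ≤ lam := by simp only [lam]; linarith [hδM.2]
  have hstar : ∀ W ⊆ Λ, star G W ⊆ F := fun W hW =>
    (star_mono (hW.trans (subset_bal Λ (m + 1)))).trans hF
  induction r with
  | zero =>
    intro I W N _ _ hW _
    rw [pow_zero, mul_one]
    exact ex_Sep_initial hπ' hδ hq (hstar W hW) _ _
  | succ r ih =>
    intro I W N hSI hIW hWΛ hbud
    have a0 := fun e => (inside_mem (G := G) hπ' (W \ I) e).1
    have a1 := fun e => (inside_mem (G := G) hπ' (W \ I) e).2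
    -- If both probabilities exceeded `1/8`, Harris' inequality would make the events joint with
    -- probability above `1/64`, and closing at most `2k` exits would violate `hm`.
    have either : ∀ w, ex (inside G π (W \ I)) F (fun T => ind (FarIn G k I W (bal G {w} m) T)) ≤ 1 / 8 ∨
        ex (inside G π (W \ I)) F (fun T => ind (FarOut G k I W (bal G {w} m) T)) ≤ 1 / 8 := by
      intro w
      by_contra! hcon
      have hha := ex_mul_ex_le a0 a1 F (antitone_FarIn (G := G) k I W (bal G {w} m))
        (antitone_FarOut (G := G) k I W (bal G {w} m))
      have hcl := (closing_exits hπ' k (B := bal G {w} m)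
        (((inn_subset_star _).trans (star_mono Finset.sdiff_subset)).trans (hstar W hWΛ))).trans
        (hm w (W \ I))
      have hpos : 0 < (1 - π) ^ (2 * k) := pow_pos (sub_pos.2 hπ.2) _
      have := le_of_mul_le_mul_right (hcl.trans_eq (by ring : _ = 1 / 64 * (1 - π) ^ (2 * k))) hpos
      nlinarith [hcon.1, hcon.2]
    classical
    -- The points whose balls are usually well joined to `I`. Points of `I` qualify because `FarIn`
    -- fails for balls meeting `I`; hence `L` contains `S` and `K` bounds its boundary from below.
    set L := W.filter fun w =>
      ex (inside G π (W \ I)) F (fun T => ind (FarIn G k I W (bal G {w} m) T)) ≤ 1 / 8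
    have hIL : I ⊆ L := by
      intro w hw
      refine Finset.mem_filter.2 ⟨hIW hw, (ex_le_const a0 a1 (c := 0) fun T _ => ?_).trans (by norm_num)⟩
      rw [ind_false]
      exact fun h => Finset.disjoint_left.1 h.1 (subset_bal _ _ (Finset.mem_singleton_self w)) hw
    have hfar : d * (d + 1) ^ (m + 1) * N.card < (bd G L).card := by
      refine lt_of_lt_of_le ?_ (hK L (hSI.trans hIL))
      have h1 : d * (d + 1) ^ (m + 1) ≤ M := by rw [hM, edgeBound]; omega
      have h2 := Nat.mul_le_mul_right N.card h1
      nlinarith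
    obtain ⟨u, v, huv, hu, hv, hN⟩ := exists_far_edge hd (m + 1) hfar
    -- Radius `m + 1` makes `B` contain the balls of radius `m` around both `u` and its neighbour
    -- `v`.
    set B := bal G {u} (m + 1) with hB
    have huΛ : u ∈ Λ := hWΛ (Finset.mem_filter.1 hu).1
    have hBF : inn G B ⊆ F := (inn_subset_star B).trans
      ((star_mono (bal_mono (Finset.singleton_subset_iff.2 huΛ) _)).trans hF)
    have hBM : (inn G B).card ≤ M := by
      have h1 := card_bal_le hd {u} (m + 1)
      rw [Finset.card_singleton, one_mul] at h1
      exact ((card_inn_le hd B).trans (Nat.mul_le_mul_left d h1)).trans (Nat.le_succ _)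
    -- Either `v` lies in `W` and `either` applies, or it does not and its ball is not contained in
    -- `W`, which excludes `FarOut`.
    have hFout : ex (inside G π (W \ I)) F (fun T => ind (FarOut G k I W (bal G {v} m) T)) ≤ 1 / 8 := by
      rcases either v with h | h
      · refine (ex_le_const a0 a1 (c := 0) fun T _ => ?_).trans (by norm_num)
        rw [ind_false]
        exact fun h' => hv (Finset.mem_filter.2
          ⟨h'.1 (subset_bal _ _ (Finset.mem_singleton_self v)), h⟩)
      · exact h
    set N' := N ∪ inn G B
    have hN' : N'.card ≤ N.card + M := (Finset.card_union_le _ _).trans (by omega)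
    have hbud' : M * (N'.card + M * r) < K + M * M := by
      refine lt_of_le_of_lt (Nat.mul_le_mul_left M ?_) hbud
      rw [Nat.mul_succ]; omega
    have d0 := fun e => (dens_mem (G := G) hπ' hδ hq (W \ I) N' e).1
    have d1 := fun e => (dens_mem (G := G) hπ' hδ hq (W \ I) N' e).2
    set cut := (bd G I ∩ bd G W).card
    have hfst : ex (dens G π δ q (W \ I) N') F (fun T => ind (Sep G I W T)) ≤ (1 - q) ^ cut * lam ^ r :=
      ih I W N' hSI hIW hWΛ hbud'
    have hsnd : ex (dens G π δ q (W \ I) N') F (fun T => ind (Sep G I W (T ∪ inn G B))) ≤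
        (1 - q) ^ cut * lam ^ r * (1 / 2) := by
      refine (ex_open_ball hπ' hδ hq I W N' F u (m + 1)).trans ?_
      have hhalf := ex_exits_le hπ' hq hk (bal_mono_radius {u} (Nat.le_succ m))
        (bal_adj_subset huv m) (Finset.mem_filter.1 hu).2 hFout
      refine le_trans ?_ (mul_le_mul_of_nonneg_left hhalf
        (mul_nonneg (pow_nonneg q0 cut) (pow_nonneg lam0 r)))
      rw [← ex_const_mul]
      refine ex_mono a0 a1 fun T _ => ?_
      set Z := clus G (W \ I) B T
      have hZ : Z ⊆ W \ I := clus_subset _ _ _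
      have hZW : Z ⊆ W := hZ.trans Finset.sdiff_subset
      have hIZ : Disjoint I Z := Finset.disjoint_left.2 fun x hx hz => (Finset.mem_sdiff.1 (hZ hz)).2 hx
      have e1 : (W \ I) \ Z = W \ (I ∪ Z) := by rw [sdiff_sdiff_left, Finset.sup_eq_union]
      have e2 : (W \ I) \ Z = (W \ Z) \ I := by rw [sdiff_right_comm]
      have i1 := ih (I ∪ Z) W N' (hSI.trans Finset.subset_union_left)
        (Finset.union_subset hIW hZW) hWΛ hbud'
      have i2 := ih I (W \ Z) N' hSI
        (fun x hx => Finset.mem_sdiff.2 ⟨hIW hx, Finset.disjoint_left.1 hIZ hx⟩)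
        (Finset.sdiff_subset.trans hWΛ) hbud'
      rw [card_bd_union_inter hIZ hIW hZW, pow_add, ← e1] at i1
      rw [card_bd_inter_sdiff hIZ hIW hZW, pow_add, ← e2] at i2
      have j1 := mul_le_mul_of_nonneg_left i1 (ind_nonneg (B ⊆ W))
      have j2 := mul_le_mul_of_nonneg_left i2 (ind_nonneg (Disjoint B I))
      refine (add_le_add j1 j2).trans_eq ?_
      ring
    have hδB : δ ^ M ≤ δ ^ (inn G B).card := pow_le_pow_of_le_one hδ.1 hδ.2 hBM
    -- The edges inside `B` are not in `N`, so their `δ` layer is still unused; splitting it off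
    -- replaces `N` by `N'`.
    have hsplit : ex (dens G π δ q (W \ I) N) F (fun T => ind (Sep G I W T)) =
        ex (dens G π δ q (W \ I) N') F fun T =>
          ex (fun e => if e ∈ inn G B then δ else 0) F fun T' => ind (Sep G I W (T ∪ T')) := by
      refine Eq.trans ?_ (ex_superpose (dens G π δ q (W \ I) N')
        (fun e => if e ∈ inn G B then δ else 0) F fun T => ind (Sep G I W T))
      refine ex_congr_density (fun e _ => ?_) _
      unfold dens sprinkle
      by_cases he : e ∈ inn G B
      · have h1 : e ∉ N := Finset.disjoint_left.1 hN he
        have h2 : e ∈ N' := Finset.mem_union_right _ he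
        simp only [he, h1, h2, if_true, if_false]; ring
      · have h2 : e ∈ N' ↔ e ∈ N := by simp [N', he]
        simp only [he, h2, if_false]; ring
    have b0 : ∀ e, 0 ≤ (fun e => if e ∈ inn G B then δ else 0) e := by
      intro e; dsimp only; split_ifs; exacts [hδ.1, le_rfl]
    have b1 : ∀ e, (fun e => if e ∈ inn G B then δ else 0) e ≤ 1 := by
      intro e; dsimp only; split_ifs; exacts [hδ.2, zero_le_one]
    have hpt : ∀ T, ex (fun e => if e ∈ inn G B then δ else 0) F (fun T' => ind (Sep G I W (T ∪ T'))) ≤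
        (1 - δ ^ (inn G B).card) * ind (Sep G I W T) +
          δ ^ (inn G B).card * ind (Sep G I W (T ∪ inn G B)) := by
      intro T
      have hopen : ex (fun e => if e ∈ inn G B then δ else 0) F (fun T' => ind (inn G B ⊆ T')) =
          δ ^ (inn G B).card := by
        rw [ex_superset _ hBF, Finset.prod_congr rfl fun e he => if_pos he, Finset.prod_const]
      rw [← hopen, ← ex_mul_const, ← ex_const (fun e => if e ∈ inn G B then δ else 0) F 1, ← ex_sub,
        ← ex_mul_const, ← ex_add]
      refine ex_mono b0 b1 fun T' _ => ?_
      by_cases h : inn G B ⊆ T'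
      · rw [ind_true h]
        have := antitone_ind_Sep (G := G) I W (Finset.union_subset_union_right (s := T) h)
        dsimp only at this
        linarith
      · rw [ind_false h]
        have := antitone_ind_Sep (G := G) I W (Finset.subset_union_left (s₁ := T) (s₂ := T'))
        dsimp only at this
        linarith
    have hδB1 : δ ^ (inn G B).card ≤ 1 := pow_le_one₀ hδ.1 hδ.2
    have hδB0 : 0 ≤ δ ^ (inn G B).card := pow_nonneg hδ.1 _
    rw [hsplit]
    refine (ex_mono d0 d1 fun T _ => hpt T).trans ?_
    rw [ex_add, ex_const_mul, ex_const_mul]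
    have k1 := mul_le_mul_of_nonneg_left hfst (sub_nonneg.2 hδB1)
    have k2 := mul_le_mul_of_nonneg_left hsnd hδB0
    have k3 : 0 ≤ (1 - q) ^ cut * lam ^ r := mul_nonneg (pow_nonneg q0 cut) (pow_nonneg lam0 r)
    have k4 : (1 - q) ^ cut * lam ^ (r + 1) = (1 - q) ^ cut * lam ^ r * (1 - δ ^ M / 2) := by
      rw [pow_succ]; ring
    rw [k4]
    have k5 := mul_le_mul_of_nonneg_left hδB k3
    linarith

/-- A finite set is exponentially unlikely, in its isoperimetric profile, to be separated. -/
theorem exists_ex_Sep_le_exp {π δ q : ℝ} (hπ : 0 ≤ π ∧ π < 1) (hδ : 0 < δ ∧ δ < 1)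
    (hq : 0 < q ∧ q < 1) {d : ℕ} (hd : ∀ v, G.degree v ≤ d)
    (hm : ∀ ε > 0, ∃ m, ∀ w U,
      ex (fun _ => π) (star G U) (fun T => ind (Sep G (bal G {w} m) U T)) ≤ ε) :
    ∃ c : ℝ, 0 < c ∧ ∀ A Λ : Finset V, A ⊆ Λ → ∀ ρ : Sym2 V → ℝ, (∀ e, ρ e ≤ 1) →
      (∀ e, 1 - (1 - δ) * (1 - q) ≤ ρ e) →
      (∀ e, e ∉ star G A → 1 - (1 - π) * ((1 - δ) * (1 - q)) ≤ ρ e) →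
      ∀ K : ℕ, (∀ L, A ⊆ L → K ≤ (bd G L).card) →
      ex ρ (star G Λ) (fun T => ind (Sep G A Λ T)) ≤ Real.exp (-(c * K)) := by
  have hπ' : 0 ≤ π ∧ π ≤ 1 := ⟨hπ.1, hπ.2.le⟩
  have hδ' : 0 ≤ δ ∧ δ ≤ 1 := ⟨hδ.1.le, hδ.2.le⟩
  have hq' : 0 ≤ q ∧ q ≤ 1 := ⟨hq.1.le, hq.2.le⟩
  obtain ⟨k, hk⟩ := exists_pow_lt_of_lt_one (by norm_num : (0 : ℝ) < 1 / 8)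
    (by linarith [hq.1] : 1 - q < 1)
  obtain ⟨m, hm⟩ := hm ((1 - π) ^ (2 * k) / 64)
    (div_pos (pow_pos (sub_pos.2 hπ.2) _) (by norm_num))
  set M := edgeBound d (m + 1) with hM
  have hM1 : 1 ≤ M * M := Nat.mul_pos (Nat.succ_pos _) (Nat.succ_pos _)
  have hδM : 0 < δ ^ M ∧ δ ^ M ≤ 1 := ⟨pow_pos hδ.1 _, pow_le_one₀ hδ'.1 hδ'.2⟩
  set lam := 1 - δ ^ M / 2 with hlam
  have lam0 : 0 < lam := by rw [hlam]; linarith [hδM.2]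
  have lam1 : lam < 1 := by rw [hlam]; linarith [hδM.1]
  have hlog : Real.log lam < 0 := Real.log_neg lam0 lam1
  have hMM : (0 : ℝ) < ((M * M : ℕ) : ℝ) := by exact_mod_cast hM1
  refine ⟨-Real.log lam / (M * M : ℕ), div_pos (neg_pos.2 hlog) hMM, ?_⟩
  intro A Λ hA ρ hρ1 hlow hfar K hK
  rcases Nat.eq_zero_or_pos K with rfl | hKpos
  · have hρ0 : ∀ e, 0 ≤ ρ e := fun e => le_trans (by
      nlinarith [mul_nonneg hδ'.1 (sub_nonneg.2 hq'.2)]) (hlow e)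
    simpa using ex_ind_le_one hρ0 hρ1 (star G Λ) (Sep G A Λ)
  -- The least `r` with `K ≤ M * M * r`: a round spends at most `M` edges, and each spent edge
  -- excludes at most `M` boundary edges of `L`.
  set r := (K + M * M - 1) / (M * M) with hr
  have hr1 : M * (0 + M * r) < K + M * M := by
    have := Nat.div_mul_le_self (K + M * M - 1) (M * M)
    rw [← hr] at this
    nlinarith [Nat.sub_lt (by omega : 0 < K + M * M) one_pos]
  have hr2 : K ≤ M * M * r := by
    have := Nat.lt_div_mul_add (a := K + M * M - 1) hM1
    rw [← hr] at this
    nlinarith [Nat.sub_add_cancel (by omega : 1 ≤ K + M * M)]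
  have hmain := ex_Sep_le_of_budget hπ hδ' hq' hd hk.le hm hK
    (subset_rfl : star G (bal G Λ (m + 1)) ⊆ _) r A Λ ∅ subset_rfl hA subset_rfl
    (by rw [Finset.card_empty]; exact hr1)
  rw [ex_Sep_eq _ (star_mono (subset_bal Λ (m + 1)))] at hmain
  refine (ex_antitone_density (fun e => (dens_mem hπ' hδ' hq' (Λ \ A) ∅ e).1) hρ1 (fun e _ => ?_)
    (antitone_ind_Sep A Λ)).trans (hmain.trans ?_)
  · unfold dens inside sprinkle
    by_cases he : e ∈ inn G (Λ \ A)
    -- The `π` layer lives inside `Λ \ A`, so its density is needed only on edges that do not touch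
    -- `A`.
    · have : e ∉ star G A := by
        intro hs
        induction e with | _ x y => ?_
        simp only [mem_inn, mem_star, Finset.mem_sdiff] at he hs
        tauto
      have := hfar e this
      simp only [he, if_true, Finset.notMem_empty, if_false]
      linarith
    · have := hlow e
      simp only [he, Finset.notMem_empty, if_false]
      linarith
  · have h1 : (1 - q) ^ (bd G A ∩ bd G Λ).card ≤ 1 :=
      pow_le_one₀ (sub_nonneg.2 hq'.2) (by linarith [hq.1])
    refine (mul_le_of_le_one_left (pow_nonneg lam0.le r) h1).trans ?_
    rw [← Real.exp_log (pow_pos lam0 r), Real.log_pow]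
    refine Real.exp_le_exp.2 ?_
    have : (K : ℝ) ≤ (M * M : ℕ) * r := by exact_mod_cast hr2
    rw [← neg_mul, neg_div, neg_neg, div_mul_eq_mul_div, le_div_iff₀ hMM]
    nlinarith

end Separation

/-! ### The cost of separation and the thinning argument. -/

section Cost

variable {V : Type*} [DecidableEq V] {G : SimpleGraph V} [G.LocallyFinite]

variable (G) in
/-- Density `y` on the boundary of `A` and `x` elsewhere. -/
noncomputable def mixDens (x y : ℝ) (A : Finset V) (e : Sym2 V) : ℝ := if e ∈ bd G A then y else x

variable (G) in
/-- Probability that `A` is separated from the complement of `Λ`, when only the edges of `B` are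
available on the boundary of `A`, and densities are reduced by the factor `1 - t`. -/
noncomputable def sepProb (x y t : ℝ) (Λ A : Finset V) (B : Finset (Sym2 V)) : ℝ :=
  ex (fun e => mixDens G x y A e * (1 - t)) (star G Λ) fun T => ind (Sep G A Λ (T \ (bd G A \ B)))

variable (G) in
/-- The exponential cost of separation. -/
noncomputable def sepCost (x y t : ℝ) (Λ A : Finset V) (B : Finset (Sym2 V)) : ℝ :=
  -Real.log (sepProb G x y t Λ A B)

variable (G) in
/-- Some set between `A` and `Λ` has few available boundary edges. -/
def Thin (x y t : ℝ) (Λ A : Finset V) (B T : Finset (Sym2 V)) : Prop :=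
  ∃ A', A ⊆ A' ∧ A' ⊆ Λ ∧
    (((T \ (bd G A \ B)) ∩ bd G A').card : ℝ) * (2 * -Real.log t) ≤ sepCost G x y t Λ A B

variable {x y t : ℝ} {Λ A : Finset V}

theorem mixDens_mem (hx : 0 ≤ x ∧ x < 1) (hy : 0 ≤ y ∧ y < 1) (A : Finset V) (e : Sym2 V) :
    0 ≤ mixDens G x y A e ∧ mixDens G x y A e < 1 := by
  unfold mixDens; split_ifs; exacts [hy, hx]

theorem mixDens_mul_mem (hx : 0 ≤ x ∧ x < 1) (hy : 0 ≤ y ∧ y < 1) (ht : 0 < t ∧ t < 1)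
    (A : Finset V) (e : Sym2 V) :
    0 ≤ mixDens G x y A e * (1 - t) ∧ mixDens G x y A e * (1 - t) < 1 := by
  have h := mixDens_mem (G := G) hx hy A e
  have h1 : 0 < 1 - t := sub_pos.2 ht.2
  exact ⟨mul_nonneg h.1 h1.le, by nlinarith [ht.1]⟩

theorem sepProb_le_one (hx : 0 ≤ x ∧ x < 1) (hy : 0 ≤ y ∧ y < 1) (ht : 0 < t ∧ t < 1)
    (B : Finset (Sym2 V)) : sepProb G x y t Λ A B ≤ 1 :=
  ex_ind_le_one (fun e => (mixDens_mul_mem hx hy ht A e).1)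
    (fun e => (mixDens_mul_mem hx hy ht A e).2.le) _ _

theorem sepProb_pos (hx : 0 ≤ x ∧ x < 1) (hy : 0 ≤ y ∧ y < 1) (ht : 0 < t ∧ t < 1) (hA : A ⊆ Λ)
    (B : Finset (Sym2 V)) : 0 < sepProb G x y t Λ A B := by
  have h0 := fun e => (mixDens_mul_mem (G := G) hx hy ht A e).1
  have h1 := fun e => (mixDens_mul_mem (G := G) hx hy ht A e).2
  refine lt_of_lt_of_le ?_ (ex_mono h0 (fun e => (h1 e).le)
    (f := fun T => ind (Disjoint T (star G Λ))) fun T hT => ind_mono fun hd => ?_)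
  · rw [ex_disjoint _ subset_rfl]
    exact Finset.prod_pos fun e _ => sub_pos.2 (h1 e)
  · have : T = ∅ := disjoint_self.1 (hd.mono_right hT)
    subst this
    exact ⟨A, subset_rfl, hA, by simp⟩

theorem sepCost_nonneg (hx : 0 ≤ x ∧ x < 1) (hy : 0 ≤ y ∧ y < 1) (ht : 0 < t ∧ t < 1)
    (B : Finset (Sym2 V)) : 0 ≤ sepCost G x y t Λ A B := by
  refine neg_nonneg.2 (Real.log_nonpos ?_ (sepProb_le_one hx hy ht B))
  exact ex_ind_nonneg (fun e => (mixDens_mul_mem hx hy ht A e).1)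
    (fun e => (mixDens_mul_mem hx hy ht A e).2.le) _ _

theorem sepCost_mono (hx : 0 ≤ x ∧ x < 1) (hy : 0 ≤ y ∧ y < 1) (ht : 0 < t ∧ t < 1) (hA : A ⊆ Λ)
    {B B' : Finset (Sym2 V)} (hB : B ⊆ B') : sepCost G x y t Λ A B ≤ sepCost G x y t Λ A B' := by
  refine neg_le_neg (Real.log_le_log (sepProb_pos hx hy ht hA B') ?_)
  refine ex_mono (fun e => (mixDens_mul_mem hx hy ht A e).1)
    (fun e => (mixDens_mul_mem hx hy ht A e).2.le) fun T _ => ind_mono fun h => h.mono ?_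
  exact Finset.sdiff_subset_sdiff subset_rfl (Finset.sdiff_subset_sdiff subset_rfl hB)

theorem sepCost_empty (hA : A ⊆ Λ) : sepCost G x y t Λ A ∅ = 0 := by
  have : sepProb G x y t Λ A ∅ = 1 := by
    rw [sepProb, ex_congr (g := fun _ => 1), ex_const]
    intro T _
    refine ind_true ⟨A, subset_rfl, hA, ?_⟩
    rw [Finset.sdiff_empty]
    exact Finset.sdiff_disjoint
  rw [sepCost, this, Real.log_one, neg_zero]

/-- The two separation events are decreasing, hence positively correlated. The union of separators
for `B₁` and `B₂` is one for `B₁ ∪ B₂`: a boundary edge of the union that starts in `A` crosses both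
separators, and one that does not is not affected by the restriction. -/
theorem sepCost_union_le (hx : 0 ≤ x ∧ x < 1) (hy : 0 ≤ y ∧ y < 1) (ht : 0 < t ∧ t < 1)
    (hA : A ⊆ Λ) (B₁ B₂ : Finset (Sym2 V)) :
    sepCost G x y t Λ A (B₁ ∪ B₂) ≤ sepCost G x y t Λ A B₁ + sepCost G x y t Λ A B₂ := by
  have h0 := fun e => (mixDens_mul_mem (G := G) hx hy ht A e).1
  have h1 := fun e => (mixDens_mul_mem (G := G) hx hy ht A e).2.le
  have hanti : ∀ B, Antitone fun T : Finset (Sym2 V) => ind (Sep G A Λ (T \ (bd G A \ B))) :=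
    fun B T T' h => ind_mono fun hs => hs.mono (Finset.sdiff_subset_sdiff h subset_rfl)
  have hP : sepProb G x y t Λ A B₁ * sepProb G x y t Λ A B₂ ≤ sepProb G x y t Λ A (B₁ ∪ B₂) := by
    refine (ex_mul_ex_le h0 h1 (star G Λ) (hanti B₁) (hanti B₂)).trans
      (ex_mono h0 h1 fun T _ => ?_)
    rw [← ind_and]
    refine ind_mono ?_
    rintro ⟨⟨A₁, a1, b1, c1⟩, A₂, a2, b2, c2⟩
    refine ⟨A₁ ∪ A₂, a1.trans Finset.subset_union_left, Finset.union_subset b1 b2, ?_⟩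
    rw [Finset.disjoint_left] at c1 c2 ⊢
    intro e he hb
    have d1 := @c1 e; have d2 := @c2 e
    induction e with | _ u v => ?_
    have := @a1 u; have := @a1 v; have := @a2 u; have := @a2 v
    simp only [Finset.mem_sdiff, mem_bd, Finset.mem_union] at *
    grind
  have p1 := sepProb_pos (G := G) hx hy ht hA B₁
  have p2 := sepProb_pos (G := G) hx hy ht hA B₂
  unfold sepCost
  rw [← neg_add, ← Real.log_mul p1.ne' p2.ne']
  exact neg_le_neg (Real.log_le_log (mul_pos p1 p2) hP)

theorem sepCost_le_of_subset (hx : 0 ≤ x ∧ x < 1) (hy : 0 ≤ y ∧ y < 1) (ht : 0 < t ∧ t < 1)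
    {A' : Finset V} (hAA' : A ⊆ A') (hA' : A' ⊆ Λ) {B : Finset (Sym2 V)} (hB : B ⊆ bd G A)
    (hB' : B ⊆ bd G A') : sepCost G x y t Λ A' B ≤ sepCost G x y t Λ A B := by
  refine neg_le_neg (Real.log_le_log (sepProb_pos hx hy ht (hAA'.trans hA') B) ?_)
  -- The edges irrelevant to separating `A'` through `B`. Off `R` the boundaries of `A` and `A'`
  -- coincide, and so do the two densities.
  set R := inn G A' ∪ (bd G A' \ B) with hR
  have h1 : sepProb G x y t Λ A B ≤ ex (fun e => mixDens G x y A e * (1 - t)) (star G Λ)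
      fun T => ind (Sep G A' Λ (T \ R)) := by
    refine ex_mono (fun e => (mixDens_mul_mem hx hy ht A e).1)
      (fun e => (mixDens_mul_mem hx hy ht A e).2.le) fun T _ => ind_mono ?_
    rintro ⟨C, a, b, c⟩
    refine ⟨C ∪ A', Finset.subset_union_right, Finset.union_subset b hA', ?_⟩
    rw [Finset.disjoint_left] at c ⊢
    intro e he hb
    have c1 := @c e; have b1 := @hB e; have b2 := @hB' e
    clear_value R
    induction e with | _ u v => ?_
    have := @a u; have := @a v; have := @hAA' u; have := @hAA' v
    simp only [Finset.mem_sdiff, mem_bd, mem_inn, Finset.mem_union, hR] at *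
    grind
  have h2 : sepProb G x y t Λ A' B = ex (fun e => mixDens G x y A' e * (1 - t)) (star G Λ)
      fun T => ind (Sep G A' Λ (T \ R)) := by
    refine ex_congr fun T _ => ind_congr ⟨fun h => h.mono ?_, ?_⟩
    · exact Finset.sdiff_subset_sdiff subset_rfl Finset.subset_union_right
    · rintro ⟨C, a, b, c⟩
      refine ⟨C, a, b, ?_⟩
      rw [Finset.disjoint_left] at c ⊢
      intro e he hb
      have c1 := @c e
      clear_value R
      induction e with | _ u v => ?_
      have := @a u; have := @a v
      simp only [Finset.mem_sdiff, mem_bd, mem_inn, Finset.mem_union, hR] at *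
      grind
  rw [h2]
  refine h1.trans_eq ?_
  rw [ex_sdiff _ _ R fun T => ind (Sep G A' Λ T), ex_sdiff _ _ R fun T => ind (Sep G A' Λ T)]
  refine ex_congr_density (fun e _ => ?_) _
  by_cases he : e ∈ R
  · simp only [he, if_true]
  · have : e ∈ bd G A ↔ e ∈ bd G A' := by
      have b1 := @hB e; have b2 := @hB' e
      clear_value R
      induction e with | _ u v => ?_
      have := @hAA' u; have := @hAA' v
      simp only [Finset.mem_sdiff, mem_bd, mem_inn, Finset.mem_union, hR] at *
      grind
    simp only [he, if_false, mixDens, this]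

/-- With `κ` the cost, a thin boundary has at most `κ / (2 log (1/t))` available open edges.
Thinning removes them all with probability at least `exp (-κ/2)`, which produces a separation at the
reduced density. Hence the probability of thinness times `exp (-κ/2)` is at most `exp (-κ)`. -/
theorem ex_Thin_le (hx : 0 ≤ x ∧ x < 1) (hy : 0 ≤ y ∧ y < 1) (ht : 0 < t ∧ t < 1) (hA : A ⊆ Λ)
    (B : Finset (Sym2 V)) :
    ex (mixDens G x y A) (star G Λ) (fun T => ind (Thin G x y t Λ A B T)) ≤
      Real.exp (-(sepCost G x y t Λ A B / 2)) := by
  have m0 := fun e => (mixDens_mem (G := G) hx hy A e).1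
  have m1 := fun e => (mixDens_mem (G := G) hx hy A e).2.le
  have t0 : ∀ _e : Sym2 V, 0 ≤ (fun _ : Sym2 V => 1 - t) _e := fun _ => (sub_pos.2 ht.2).le
  have t1 : ∀ _e : Sym2 V, (fun _ : Sym2 V => 1 - t) _e ≤ 1 := fun _ => by
    dsimp only; linarith [ht.1]
  set κ := sepCost G x y t Λ A B with hκ
  have hP : sepProb G x y t Λ A B = Real.exp (-κ) := by
    rw [hκ, sepCost, neg_neg, Real.exp_log (sepProb_pos hx hy ht hA B)]
  have h1 : ex (mixDens G x y A) (star G Λ) (fun T => ind (Thin G x y t Λ A B T) *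
      Real.exp (-(κ / 2))) ≤ sepProb G x y t Λ A B := by
    rw [sepProb, ex_thin (mixDens G x y A) (fun _ => 1 - t) (star G Λ)
      fun T => ind (Sep G A Λ (T \ (bd G A \ B)))]
    refine ex_mono m0 m1 fun T hT => ?_
    by_cases hthin : Thin G x y t Λ A B T
    · rw [ind_true hthin, one_mul]
      obtain ⟨A', a, b, c⟩ := hthin
      set Y := (T \ (bd G A \ B)) ∩ bd G A'
      have hY : Y ⊆ star G Λ := Finset.inter_subset_left.trans (Finset.sdiff_subset.trans hT)
      have hexp : Real.exp (-(κ / 2)) ≤ t ^ Y.card := by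
        rw [← Real.exp_log (pow_pos ht.1 _), Real.log_pow]
        refine Real.exp_le_exp.2 ?_
        linarith
      refine hexp.trans ?_
      have hd := ex_disjoint (fun _ => 1 - t) hY
      rw [Finset.prod_const, sub_sub_cancel] at hd
      rw [← hd]
      refine ex_mono t0 t1 fun T' _ => ind_mono fun hdis => ⟨A', a, b, ?_⟩
      rw [Finset.disjoint_left] at hdis ⊢
      intro e he hb
      have he' := Finset.mem_sdiff.1 he
      have he'' := Finset.mem_inter.1 he'.1
      exact hdis he''.2 (Finset.mem_inter.2 ⟨Finset.mem_sdiff.2 ⟨he''.1, he'.2⟩, hb⟩)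
    · rw [ind_false hthin, zero_mul]
      exact ex_ind_nonneg t0 t1 _ _
  rw [ex_mul_const, hP] at h1
  have h2 : Real.exp (-κ) = Real.exp (-(κ / 2)) * Real.exp (-(κ / 2)) := by
    rw [← Real.exp_add]; congr 1; ring
  rw [h2] at h1
  exact le_of_mul_le_mul_right h1 (Real.exp_pos _)

end Cost

/-! ### Two independent coins per edge. -/

section TwoCoins

variable {ι : Type*} [DecidableEq ι]

/-- The layer `b` of a set of two-sided coins. -/
def lay (b : Bool) (T : Finset (ι × Bool)) : Finset ι := (T.filter fun c => c.2 = b).image Prod.fst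

theorem mem_lay {b : Bool} {T : Finset (ι × Bool)} {i : ι} : i ∈ lay b T ↔ (i, b) ∈ T := by
  simp [lay]

/-- The two layers are independent. -/
theorem ex_lay (ρ : ι × Bool → ℝ) (F : Finset ι) (f : Finset ι → Finset ι → ℝ) :
    ex ρ (F ×ˢ Finset.univ) (fun T => f (lay true T) (lay false T)) =
      ex (fun i => ρ (i, true)) F fun T => ex (fun i => ρ (i, false)) F fun T' => f T T' := by
  have hF : F ×ˢ (Finset.univ : Finset Bool) =
      F.map (Function.Embedding.sectL ι true) ∪ F.map (Function.Embedding.sectL ι false) := by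
    ext ⟨i, b⟩
    cases b <;> simp
  have hd : Disjoint (F.map (Function.Embedding.sectL ι true))
      (F.map (Function.Embedding.sectL ι false)) := by
    rw [Finset.disjoint_left]
    rintro ⟨i, b⟩
    simp; intros; simp_all
  rw [hF, ex_union _ hd, ex_map]
  refine ex_congr fun T _ => ?_
  rw [ex_map]
  refine ex_congr fun T' _ => ?_
  have e1 : lay true (T.map (Function.Embedding.sectL ι true) ∪
      T'.map (Function.Embedding.sectL ι false)) = T := by
    ext i; simp [mem_lay]
  have e2 : lay false (T.map (Function.Embedding.sectL ι true) ∪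
      T'.map (Function.Embedding.sectL ι false)) = T' := by
    ext i; simp [mem_lay]
  rw [e1, e2]

/-- Using one layer off `D` and the other one on `D`. -/
theorem ex_lay_mix (x y : ℝ) (F D : Finset ι) (f : Finset ι → ℝ) :
    ex (fun c : ι × Bool => if c.2 then x else y) (F ×ˢ Finset.univ)
        (fun T => f (lay true T \ D ∪ lay false T ∩ D)) =
      ex (fun i => if i ∈ D then y else x) F f := by
  rw [ex_lay _ F fun T T' => f (T \ D ∪ T' ∩ D)]
  have h1 : ∀ T, (ex (fun _ => y) F fun T' => f (T ∪ T' ∩ D)) =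
      ex (fun i => if i ∈ F \ D then 0 else y) F fun T' => f (T ∪ T') := by
    intro T
    rw [← ex_sdiff (fun _ => y) F (F \ D) fun T' => f (T ∪ T')]
    refine ex_congr fun T' hT' => ?_
    congr 2
    ext i
    have := @hT' i
    simp only [Finset.mem_inter, Finset.mem_sdiff]
    tauto
  simp only [if_true, Bool.false_eq_true, if_false, h1]
  rw [ex_sdiff (fun _ => x) F D fun T => ex (fun i => if i ∈ F \ D then 0 else y) F fun T' =>
    f (T ∪ T'), ← ex_superpose]
  refine ex_congr_density (fun i hi => ?_) _
  by_cases hD : i ∈ D <;> simp [hD, hi]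

end TwoCoins

/-! ### The exploration with restarts. -/

/-- State of the exploration: the current set, the edges whose second coin is in use, and the
cost recorded at the last restart. -/
structure ExplState (V : Type*) where
  A : Finset V
  O : Finset (Sym2 V)
  h : ℝ

section Exploration

variable {V : Type*} [DecidableEq V] {G : SimpleGraph V} [G.LocallyFinite]

variable (G) in
/-- The state `s` calls for a restart. -/
def Restarts (x y t : ℝ) (Λ : Finset V) (s : ExplState V) : Prop :=
  4 * s.h ≤ sepCost G x y t Λ s.A (bd G s.A \ s.O)

open Classical in
variable (G) in
/-- Restart if called for. -/
noncomputable def restart (x y t : ℝ) (Λ : Finset V) (s : ExplState V) : ExplState V :=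
  if Restarts G x y t Λ s then
    ⟨s.A, s.O ∪ bd G s.A, sepCost G x y t Λ s.A (bd G s.A \ s.O)⟩ else s

variable (G) in
/-- The open boundary edges available for growth. -/
noncomputable def active (T : Finset (Sym2 V × Bool)) (s : ExplState V) : Finset (Sym2 V) :=
  bd G s.A ∩ (lay true T ∪ s.O ∩ lay false T)

open Classical in
variable (G) in
/-- Add the endpoints of the active edges. -/
noncomputable def grow (T : Finset (Sym2 V × Bool)) (s : ExplState V) : ExplState V :=
  ⟨(bal G s.A 1).filter fun v => v ∈ s.A ∨ ∃ u ∈ s.A, s(u, v) ∈ active G T s, s.O, s.h⟩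

variable (G) in
/-- The state before the `n`-th possible restart. -/
noncomputable def explore (x y t : ℝ) (Λ S : Finset V) (T : Finset (Sym2 V × Bool)) : ℕ → ExplState V
  | 0 => ⟨S, ∅, 0⟩
  | n + 1 => grow G T (restart G x y t Λ (explore x y t Λ S T n))

variable (G) in
/-- The coins inspected up to the state `s`. -/
def inspected (s : ExplState V) : Finset (Sym2 V × Bool) :=
  star G s.A ×ˢ {true} ∪ s.O ×ˢ {false}

variable {x y t : ℝ} {Λ S : Finset V}

theorem restart_A (s : ExplState V) : (restart G x y t Λ s).A = s.A := by
  unfold restart; split_ifs <;> rfl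

theorem subset_restart_O (s : ExplState V) : s.O ⊆ (restart G x y t Λ s).O := by
  unfold restart; split_ifs
  · exact Finset.subset_union_left
  · exact subset_rfl

theorem mem_grow {T : Finset (Sym2 V × Bool)} {s : ExplState V} {v : V} :
    v ∈ (grow G T s).A ↔ v ∈ s.A ∨ ∃ u ∈ s.A, s(u, v) ∈ active G T s := by
  unfold grow
  refine Finset.mem_filter.trans (and_iff_right_of_imp ?_)
  rintro (h | ⟨u, hu, h⟩)
  · exact subset_bal _ _ h
  · exact mem_bal_succ.2 (Or.inr ⟨u, hu, (mem_bd.1 (Finset.mem_inter.1 h).1).1⟩)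

theorem subset_grow (T : Finset (Sym2 V × Bool)) (s : ExplState V) : s.A ⊆ (grow G T s).A :=
  fun _ hv => mem_grow.2 (Or.inl hv)

theorem grow_subset_bal (T : Finset (Sym2 V × Bool)) (s : ExplState V) :
    (grow G T s).A ⊆ bal G s.A 1 := Finset.filter_subset _ _

theorem explore_subset_succ (T : Finset (Sym2 V × Bool)) (n : ℕ) :
    (explore G x y t Λ S T n).A ⊆ (explore G x y t Λ S T (n + 1)).A := by
  have := subset_grow (G := G) T (restart G x y t Λ (explore G x y t Λ S T n))
  rwa [restart_A] at this

theorem bal_bal_one (A : Finset V) (n : ℕ) : bal G (bal G A n) 1 = bal G A (n + 1) := rfl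

theorem explore_subset_bal (T : Finset (Sym2 V × Bool)) (n : ℕ) :
    (explore G x y t Λ S T n).A ⊆ bal G S n := by
  induction n with
  | zero => exact subset_rfl
  | succ n ih =>
    refine (grow_subset_bal T _).trans ?_
    rw [restart_A, ← bal_bal_one]
    exact bal_mono ih 1

theorem subset_explore (T : Finset (Sym2 V × Bool)) (n : ℕ) :
    S ⊆ (explore G x y t Λ S T n).A := by
  induction n with
  | zero => exact subset_rfl
  | succ n ih => exact ih.trans (explore_subset_succ T n)

/-- The exploration reads first coins only at edges touching the current set, and second coins only
in `O`. This is the stopping property that `ex_resample` requires. -/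
theorem explore_determined (n : ℕ) : ∀ T T' : Finset (Sym2 V × Bool),
    T ∩ inspected G (explore G x y t Λ S T n) = T' ∩ inspected G (explore G x y t Λ S T n) →
    explore G x y t Λ S T' n = explore G x y t Λ S T n := by
  induction n with
  | zero => intro _ _ _; rfl
  | succ n ih =>
    intro T T' h
    set s := restart G x y t Λ (explore G x y t Λ S T n) with hs
    have hsub : s.A ⊆ (grow G T s).A := subset_grow T s
    have hA : s.A = (explore G x y t Λ S T n).A := restart_A _
    have hc : ∀ c ∈ inspected G (grow G T s), (c ∈ T ↔ c ∈ T') := by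
      intro c hc
      have := Finset.ext_iff.1 h c
      simp only [Finset.mem_inter] at this
      change (c ∈ T ∧ c ∈ inspected G (grow G T s) ↔ c ∈ T' ∧ c ∈ inspected G (grow G T s)) at this
      tauto
    have h1 : inspected G (explore G x y t Λ S T n) ⊆ inspected G (grow G T s) := by
      refine Finset.union_subset_union (Finset.product_subset_product_left (star_mono ?_))
        (Finset.product_subset_product_left (subset_restart_O _))
      rw [← hA]; exact hsub
    have h2 : explore G x y t Λ S T' n = explore G x y t Λ S T n := by
      refine ih T T' ?_
      ext c
      have := hc c
      have := @h1 c
      simp only [Finset.mem_inter]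
      tauto
    have h3 : active G T' s = active G T s := by
      ext e
      have c1 : e ∈ bd G s.A → ((e, true) ∈ T ↔ (e, true) ∈ T') := fun he =>
        hc _ (Finset.mem_union_left _ (Finset.mem_product.2
          ⟨star_mono hsub (bd_subset_star _ he), Finset.mem_singleton_self _⟩))
      have c2 : e ∈ s.O → ((e, false) ∈ T ↔ (e, false) ∈ T') := fun he =>
        hc _ (Finset.mem_union_right _ (Finset.mem_product.2 ⟨he, Finset.mem_singleton_self _⟩))
      simp only [active, Finset.mem_inter, Finset.mem_union, mem_lay]
      tauto
    change grow G T' (restart G x y t Λ (explore G x y t Λ S T' n)) = grow G T s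
    rw [h2, ← hs]
    unfold grow
    rw [h3]

variable (G) in
/-- The restart at `s`, if any, is followed by a thin boundary. -/
def BadRestart (x y t : ℝ) (Λ : Finset V) (s : ExplState V) (T : Finset (Sym2 V × Bool)) : Prop :=
  Restarts G x y t Λ s ∧
    Thin G x y t Λ s.A (bd G s.A \ s.O) (lay true T \ bd G s.A ∪ lay false T ∩ bd G s.A)

/-- Only fresh coins enter: on the boundary of `s.A` the second coins off `s.O`, and elsewhere the
first coins of boundary edges of a superset, which do not touch `s.A`. -/
theorem BadRestart_congr (s : ExplState V) {T T' : Finset (Sym2 V × Bool)}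
    (h : T \ inspected G s = T' \ inspected G s) :
    BadRestart G x y t Λ s T ↔ BadRestart G x y t Λ s T' := by
  have key : ∀ A', s.A ⊆ A' →
      ((lay true T \ bd G s.A ∪ lay false T ∩ bd G s.A) \ (bd G s.A \ (bd G s.A \ s.O))) ∩ bd G A' =
      ((lay true T' \ bd G s.A ∪ lay false T' ∩ bd G s.A) \ (bd G s.A \ (bd G s.A \ s.O))) ∩ bd G A' := by
    intro A' hA'
    ext e
    have h1 := Finset.ext_iff.1 h (e, true)
    have h2 := Finset.ext_iff.1 h (e, false)
    have h3 : e ∈ bd G A' → e ∉ bd G s.A → e ∉ star G s.A := by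
      induction e with | _ u v => ?_
      have := @hA' u; have := @hA' v
      simp only [mem_bd, mem_star]
      grind
    simp only [Finset.mem_inter, Finset.mem_union, Finset.mem_sdiff, mem_lay, inspected,
      Finset.mem_product, Finset.mem_singleton, and_true, and_false, or_false,
      false_or, Bool.true_eq_false, Bool.false_eq_true] at h1 h2 ⊢
    clear h
    by_cases hb : e ∈ bd G s.A <;> simp only [hb] at h3 ⊢ <;> grind
  unfold BadRestart Thin
  refine and_congr_right fun _ => exists_congr fun A' => and_congr_right fun hA' => ?_
  rw [key A' hA']

omit [DecidableEq V] in
theorem coin_mem (hx : 0 ≤ x ∧ x < 1) (hy : 0 ≤ y ∧ y < 1) (c : Sym2 V × Bool) :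
    0 ≤ (fun c : Sym2 V × Bool => if c.2 then x else y) c ∧
      (fun c : Sym2 V × Bool => if c.2 then x else y) c ≤ 1 := by
  dsimp only; split_ifs
  · exact ⟨hx.1, hx.2.le⟩
  · exact ⟨hy.1, hy.2.le⟩

/-- Given the state, the coins deciding whether the restart is bad may be resampled. Second coins on
the boundary and first coins off it have density `mixDens`, so `ex_Thin_le` applies with the newly
recorded cost. -/
theorem ex_BadRestart_le (hx : 0 ≤ x ∧ x < 1) (hy : 0 ≤ y ∧ y < 1) (ht : 0 < t ∧ t < 1) {n : ℕ}
    (hΛ : bal G S n ⊆ Λ) :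
    ex (fun c : Sym2 V × Bool => if c.2 then x else y) (star G Λ ×ˢ Finset.univ)
        (fun T => ind (BadRestart G x y t Λ (explore G x y t Λ S T n) T)) ≤
      ex (fun c : Sym2 V × Bool => if c.2 then x else y) (star G Λ ×ˢ Finset.univ) fun T =>
        ind (Restarts G x y t Λ (explore G x y t Λ S T n)) *
          Real.exp (-(restart G x y t Λ (explore G x y t Λ S T n)).h / 2) := by
  classical
  have c0 := fun c => (coin_mem (V := V) hx hy c).1
  have c1 := fun c => (coin_mem (V := V) hx hy c).2
  rw [ex_resample (fun c : Sym2 V × Bool => if c.2 then x else y) (star G Λ ×ˢ Finset.univ)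
    (fun T => explore G x y t Λ S T n) (inspected G)
    (fun s T => ind (BadRestart G x y t Λ s T)) (explore_determined n)
    (fun s T T' h => ind_congr (BadRestart_congr s h))]
  refine ex_mono c0 c1 fun T _ => ?_
  set s := explore G x y t Λ S T n
  have hs : s.A ⊆ Λ := (explore_subset_bal T n).trans hΛ
  simp only [BadRestart, ind_and]
  rw [ex_const_mul]
  by_cases hr : Restarts G x y t Λ s
  · refine mul_le_mul_of_nonneg_left ?_ (ind_nonneg _)
    rw [ex_lay_mix x y (star G Λ) (bd G s.A)
      fun T => ind (Thin G x y t Λ s.A (bd G s.A \ s.O) T)]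
    refine (ex_Thin_le hx hy ht hs _).trans_eq ?_
    rw [restart, if_pos hr, neg_div]
  · rw [ind_false hr, zero_mul, zero_mul]

/-- What is known about a state before a restart. -/
structure Admissible (x y t : ℝ) (Λ : Finset V) (s : ExplState V) : Prop where
  nonneg : 0 ≤ s.h
  subset : s.A ⊆ Λ
  touch : s.O ⊆ star G s.A
  cost : sepCost G x y t Λ s.A (bd G s.A ∩ s.O) ≤ 2 * s.h

/-- A restart records some `h'` with `4h ≤ h'`, so by subadditivity the whole boundary costs at most
`2h + h' ≤ 2h'`. Without a restart the edges in `O` cost at most `2h` and the others less than `4h`,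
whence the factor `6`. -/
theorem Admissible.restart (hx : 0 ≤ x ∧ x < 1) (hy : 0 ≤ y ∧ y < 1) (ht : 0 < t ∧ t < 1)
    {s : ExplState V} (hs : Admissible (G := G) x y t Λ s) :
    Admissible (G := G) x y t Λ (restart G x y t Λ s) ∧
      sepCost G x y t Λ s.A (bd G s.A) ≤ 6 * (PercGrowth.restart G x y t Λ s).h := by
  have hunion := sepCost_union_le (G := G) hx hy ht hs.subset (bd G s.A ∩ s.O) (bd G s.A \ s.O)
  rw [Finset.union_comm, Finset.sdiff_union_inter] at hunion
  by_cases hr : Restarts G x y t Λ s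
  · have hr' := hr
    unfold Restarts at hr'
    rw [PercGrowth.restart, if_pos hr]
    have h1 := hs.cost
    have h0 := hs.nonneg
    refine ⟨⟨sepCost_nonneg hx hy ht _, hs.subset, Finset.union_subset hs.touch (bd_subset_star _), ?_⟩, ?_⟩
    · dsimp only
      rw [Finset.inter_eq_left.2 Finset.subset_union_right]
      linarith
    · dsimp only; linarith
  · have hr' := not_le.1 hr
    rw [PercGrowth.restart, if_neg hr]
    exact ⟨hs, by linarith [hs.cost]⟩

/-- Edges of `O` touch the old set, so those on the new boundary were already on the old one.
Enlarging the set and dropping available edges can only lower the cost. -/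
theorem Admissible.grow (hx : 0 ≤ x ∧ x < 1) (hy : 0 ≤ y ∧ y < 1) (ht : 0 < t ∧ t < 1)
    {s : ExplState V} (hs : Admissible (G := G) x y t Λ s) {T : Finset (Sym2 V × Bool)}
    (hΛ : (grow G T s).A ⊆ Λ) : Admissible (G := G) x y t Λ (grow G T s) := by
  refine ⟨hs.nonneg, hΛ, hs.touch.trans (star_mono (subset_grow T s)), ?_⟩
  change sepCost G x y t Λ (PercGrowth.grow G T s).A (bd G (PercGrowth.grow G T s).A ∩ s.O) ≤ 2 * s.h
  have hsub : bd G (PercGrowth.grow G T s).A ∩ s.O ⊆ bd G s.A ∩ s.O := by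
    intro e he
    obtain ⟨h1, h2⟩ := Finset.mem_inter.1 he
    refine Finset.mem_inter.2 ⟨?_, h2⟩
    have h3 := hs.touch h2
    have h4 := subset_grow (G := G) T s
    induction e with | _ u v => ?_
    have := @h4 u; have := @h4 v
    simp only [mem_bd, mem_star] at h1 h3 ⊢
    grind
  refine (sepCost_le_of_subset hx hy ht (subset_grow T s) hΛ
    (hsub.trans Finset.inter_subset_left) Finset.inter_subset_left).trans ?_
  exact (sepCost_mono hx hy ht hs.subset hsub).trans hs.cost

theorem explore_admissible (hx : 0 ≤ x ∧ x < 1) (hy : 0 ≤ y ∧ y < 1) (ht : 0 < t ∧ t < 1)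
    (T : Finset (Sym2 V × Bool)) (n : ℕ) (hΛ : bal G S n ⊆ Λ) :
    Admissible (G := G) x y t Λ (explore G x y t Λ S T n) := by
  induction n with
  | zero =>
    refine ⟨le_rfl, hΛ, Finset.empty_subset _, ?_⟩
    change sepCost G x y t Λ S (bd G S ∩ ∅) ≤ 2 * 0
    have hS : S ⊆ Λ := hΛ
    rw [Finset.inter_empty, sepCost_empty hS, mul_zero]
  | succ n ih =>
    have h := (ih ((bal_mono_radius S n.le_succ).trans hΛ)).restart hx hy ht
    exact h.1.grow hx hy ht ((explore_subset_bal T (n + 1)).trans hΛ)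

theorem restart_explore_h_ge (hx : 0 ≤ x ∧ x < 1) (hy : 0 ≤ y ∧ y < 1) (ht : 0 < t ∧ t < 1)
    (T : Finset (Sym2 V × Bool)) (n : ℕ) :
    sepCost G x y t Λ S (bd G S) ≤ (restart G x y t Λ (explore G x y t Λ S T n)).h := by
  have h0 : 0 ≤ sepCost G x y t Λ S (bd G S) := sepCost_nonneg hx hy ht _
  induction n with
  | zero =>
    -- The recorded cost starts at `0`, so the initial state always restarts and records the cost of
    -- the full boundary of `S`.
    have hr : Restarts G x y t Λ (explore G x y t Λ S T 0) := by
      change 4 * 0 ≤ sepCost G x y t Λ S (bd G S \ ∅)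
      rw [mul_zero]; exact sepCost_nonneg hx hy ht _
    rw [restart, if_pos hr]
    change _ ≤ sepCost G x y t Λ S (bd G S \ ∅)
    rw [Finset.sdiff_empty]
  | succ n ih =>
    set s := explore G x y t Λ S T (n + 1) with hs
    have hsh : s.h = (restart G x y t Λ (explore G x y t Λ S T n)).h := rfl
    rw [← hsh] at ih
    by_cases hr : Restarts G x y t Λ s
    · have hr' := hr
      unfold Restarts at hr'
      rw [restart, if_pos hr]
      dsimp only
      linarith
    · rw [restart, if_neg hr]; exact ih

/-- After the first restart the recorded cost is at least `1` and every further one multiplies it by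
at least `4`, so `exp (-h/2)` at least halves. The subtracted term makes the bound inductive: it
pays for the next summand. -/
theorem sum_restart_le (hx : 0 ≤ x ∧ x < 1) (hy : 0 ≤ y ∧ y < 1) (ht : 0 < t ∧ t < 1)
    (h1 : 1 ≤ sepCost G x y t Λ S (bd G S)) (T : Finset (Sym2 V × Bool)) (N : ℕ) :
    ∑ n ∈ Finset.range (N + 1), ind (Restarts G x y t Λ (explore G x y t Λ S T n)) *
        Real.exp (-(restart G x y t Λ (explore G x y t Λ S T n)).h / 2) ≤
      2 * Real.exp (-sepCost G x y t Λ S (bd G S) / 2) -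
        Real.exp (-(restart G x y t Λ (explore G x y t Λ S T N)).h / 2) := by
  induction N with
  | zero =>
    have hge := restart_explore_h_ge (G := G) hx hy ht (Λ := Λ) (S := S) T 0
    have hexp : Real.exp (-(restart G x y t Λ (explore G x y t Λ S T 0)).h / 2) ≤
        Real.exp (-sepCost G x y t Λ S (bd G S) / 2) := Real.exp_le_exp.2 (by linarith)
    rw [zero_add, Finset.sum_range_one]
    have := mul_le_mul_of_nonneg_right (ind_le_one (Restarts G x y t Λ (explore G x y t Λ S T 0)))
      (Real.exp_pos (-(restart G x y t Λ (explore G x y t Λ S T 0)).h / 2)).le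
    linarith
  | succ N ih =>
    rw [Finset.sum_range_succ]
    set s := explore G x y t Λ S T (N + 1) with hs
    have hsh : s.h = (restart G x y t Λ (explore G x y t Λ S T N)).h := rfl
    have hge := restart_explore_h_ge (G := G) hx hy ht (Λ := Λ) (S := S) T N
    rw [← hsh] at ih hge
    by_cases hr : Restarts G x y t Λ s
    · have hr' := hr
      unfold Restarts at hr'
      have e : (restart G x y t Λ s).h = sepCost G x y t Λ s.A (bd G s.A \ s.O) := by
        rw [restart, if_pos hr]
      rw [← e] at hr'
      rw [ind_true hr, one_mul]
      have h2 : Real.exp (-(restart G x y t Λ s).h / 2) ≤ Real.exp (-s.h / 2) * Real.exp (-1) := by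
        rw [← Real.exp_add]; exact Real.exp_le_exp.2 (by linarith)
      have h3 : Real.exp (-1) ≤ 1 / 2 := by
        rw [Real.exp_neg, one_div]
        exact inv_anti₀ two_pos (by linarith [Real.add_one_le_exp (1 : ℝ)])
      have h4 := mul_le_mul_of_nonneg_left h3 (Real.exp_pos (-s.h / 2)).le
      linarith
    · have e : (restart G x y t Λ s).h = s.h := by rw [restart, if_neg hr]
      rw [ind_false hr, zero_mul, e]
      linarith

/-- All restarts succeed, except with small probability. -/
theorem ex_exists_BadRestart_le (hx : 0 ≤ x ∧ x < 1) (hy : 0 ≤ y ∧ y < 1) (ht : 0 < t ∧ t < 1)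
    (h1 : 1 ≤ sepCost G x y t Λ S (bd G S)) (N : ℕ) (hΛ : bal G S N ⊆ Λ) :
    ex (fun c : Sym2 V × Bool => if c.2 then x else y) (star G Λ ×ˢ Finset.univ)
        (fun T => ind (∃ n ≤ N, BadRestart G x y t Λ (explore G x y t Λ S T n) T)) ≤
      2 * Real.exp (-sepCost G x y t Λ S (bd G S) / 2) := by
  have c0 := fun c => (coin_mem (V := V) hx hy c).1
  have c1 := fun c => (coin_mem (V := V) hx hy c).2
  calc _ ≤ ex (fun c : Sym2 V × Bool => if c.2 then x else y) (star G Λ ×ˢ Finset.univ)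
        (fun T => ∑ n ∈ Finset.range (N + 1),
          ind (BadRestart G x y t Λ (explore G x y t Λ S T n) T)) := by
        refine ex_mono c0 c1 fun T _ => ?_
        by_cases h : ∃ n ≤ N, BadRestart G x y t Λ (explore G x y t Λ S T n) T
        · obtain ⟨n, hn, hb⟩ := h
          rw [ind_true ⟨n, hn, hb⟩]
          refine le_trans ?_ (Finset.single_le_sum
            (f := fun n => ind (BadRestart G x y t Λ (explore G x y t Λ S T n) T))
            (fun _ _ => ind_nonneg _) (Finset.mem_range.2 (Nat.lt_succ_of_le hn)))
          rw [ind_true hb]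
        · rw [ind_false h]
          exact Finset.sum_nonneg fun _ _ => ind_nonneg _
    _ = ∑ n ∈ Finset.range (N + 1),
          ex (fun c : Sym2 V × Bool => if c.2 then x else y) (star G Λ ×ˢ Finset.univ)
            (fun T => ind (BadRestart G x y t Λ (explore G x y t Λ S T n) T)) := ex_sum _ _ _ _
    _ ≤ ∑ n ∈ Finset.range (N + 1),
          ex (fun c : Sym2 V × Bool => if c.2 then x else y) (star G Λ ×ˢ Finset.univ) (fun T =>
            ind (Restarts G x y t Λ (explore G x y t Λ S T n)) *
              Real.exp (-(restart G x y t Λ (explore G x y t Λ S T n)).h / 2)) :=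
        Finset.sum_le_sum fun n hn => ex_BadRestart_le hx hy ht
          ((bal_mono_radius S (Nat.lt_succ_iff.1 (Finset.mem_range.1 hn))).trans hΛ)
    _ = ex (fun c : Sym2 V × Bool => if c.2 then x else y) (star G Λ ×ˢ Finset.univ) (fun T =>
          ∑ n ∈ Finset.range (N + 1), ind (Restarts G x y t Λ (explore G x y t Λ S T n)) *
              Real.exp (-(restart G x y t Λ (explore G x y t Λ S T n)).h / 2)) :=
        (ex_sum _ _ _ _).symm
    _ ≤ _ := by
        refine ex_le_const c0 c1 fun T _ => (sum_restart_le hx hy ht h1 T N).trans ?_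
        linarith [Real.exp_pos (-(restart G x y t Λ (explore G x y t Λ S T N)).h / 2)]

variable (G) in
/-- The last restart before the state `s` succeeded. -/
def Anchored (x y t : ℝ) (Λ : Finset V) (T : Finset (Sym2 V × Bool)) (s : ExplState V) : Prop :=
  ∃ A B, A ⊆ s.A ∧ B ⊆ s.O ∧ B ⊆ bd G A ∧ s.h = sepCost G x y t Λ A B ∧
    ¬ Thin G x y t Λ A B (lay true T \ bd G A ∪ lay false T ∩ bd G A)

/-- Failure of `Thin` concerns all sets between `A` and `Λ`, so the witnesses of one successful
restart serve until the next. -/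
theorem explore_anchored (hx : 0 ≤ x ∧ x < 1) (hy : 0 ≤ y ∧ y < 1) (ht : 0 < t ∧ t < 1)
    {T : Finset (Sym2 V × Bool)} {N : ℕ}
    (hgood : ∀ n ≤ N, ¬ BadRestart G x y t Λ (explore G x y t Λ S T n) T) (n : ℕ) (hn : n ≤ N) :
    Anchored G x y t Λ T (restart G x y t Λ (explore G x y t Λ S T n)) := by
  have step : ∀ s : ExplState V, Restarts G x y t Λ s → ¬ BadRestart G x y t Λ s T →
      Anchored G x y t Λ T (restart G x y t Λ s) := by
    intro s hr hb
    rw [restart, if_pos hr]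
    exact ⟨s.A, bd G s.A \ s.O, subset_rfl, Finset.sdiff_subset.trans Finset.subset_union_right,
      Finset.sdiff_subset, rfl, fun h => hb ⟨hr, h⟩⟩
  induction n with
  | zero =>
    refine step _ ?_ (hgood 0 hn)
    change 4 * 0 ≤ sepCost G x y t Λ S (bd G S \ ∅)
    rw [mul_zero]; exact sepCost_nonneg hx hy ht _
  | succ n ih =>
    by_cases hr : Restarts G x y t Λ (explore G x y t Λ S T (n + 1))
    · exact step _ hr (hgood (n + 1) hn)
    · rw [restart, if_neg hr]
      obtain ⟨A, B, h1, h2, h3, h4, h5⟩ := ih (by omega)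
      exact ⟨A, B, h1.trans (subset_grow T _), h2, h3, h4, h5⟩

/-- Growth in one step of a successful exploration. -/
theorem card_explore_succ_ge (hx : 0 ≤ x ∧ x < 1) (hy : 0 ≤ y ∧ y < 1) (ht : 0 < t ∧ t < 1)
    {d : ℕ} (hd : ∀ v, G.degree v ≤ d)
    {T : Finset (Sym2 V × Bool)} {N : ℕ} (hΛ : bal G S N ⊆ Λ)
    (hgood : ∀ n ≤ N, ¬ BadRestart G x y t Λ (explore G x y t Λ S T n) T) (n : ℕ) (hn : n ≤ N) :
    sepCost G x y t Λ (explore G x y t Λ S T n).A (bd G (explore G x y t Λ S T n).A) ≤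
      12 * -Real.log t * d * (((explore G x y t Λ S T (n + 1)).A.card : ℝ) -
        (explore G x y t Λ S T n).A.card) := by
  have hΛn : bal G S n ⊆ Λ := (bal_mono_radius S hn).trans hΛ
  have hcost := ((explore_admissible hx hy ht T n hΛn).restart hx hy ht).2
  obtain ⟨A, B, h1, h2, h3, h4, h5⟩ := explore_anchored hx hy ht hgood n hn
  set s := restart G x y t Λ (explore G x y t Λ S T n) with hs
  have hsA : s.A = (explore G x y t Λ S T n).A := restart_A _
  have hsucc : (explore G x y t Λ S T (n + 1)).A = (grow G T s).A := rfl
  rw [hsucc]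
  rw [← hsA] at hcost ⊢
  have hlog : 0 < -Real.log t := neg_pos.2 (Real.log_neg ht.1 ht.2)
  have hsΛ : s.A ⊆ Λ := by rw [hsA]; exact (explore_subset_bal T n).trans hΛn
  set Y := ((lay true T \ bd G A ∪ lay false T ∩ bd G A) \ (bd G A \ B)) ∩ bd G s.A with hY
  have hthin : s.h < (Y.card : ℝ) * (2 * -Real.log t) := by
    rw [h4]
    by_contra hcon
    exact h5 ⟨s.A, h1, hsΛ, not_lt.1 hcon⟩
  -- Edges of `Y` are active: off `bd G A` through the first coin, on it through the second coin,
  -- since there they lie in `B ⊆ s.O`. Their outer endpoints are therefore added.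
  have hYact : Y ⊆ star G ((grow G T s).A \ s.A) := by
    intro e he
    have hact : e ∈ active G T s := by
      have := @h2 e
      simp only [hY, active, Finset.mem_inter, Finset.mem_union, Finset.mem_sdiff] at he ⊢
      tauto
    have hb := (Finset.mem_inter.1 hact).1
    induction e with | _ u v => ?_
    obtain ⟨huv, ⟨hu, hv⟩ | ⟨hv, hu⟩⟩ := mem_bd.1 hb
    · exact mem_star.2 ⟨huv, Or.inr (Finset.mem_sdiff.2 ⟨mem_grow.2 (Or.inr ⟨u, hu, hact⟩), hv⟩)⟩
    · exact mem_star.2 ⟨huv, Or.inl (Finset.mem_sdiff.2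
        ⟨mem_grow.2 (Or.inr ⟨v, hv, Sym2.eq_swap ▸ hact⟩), hu⟩)⟩
  have hcard : (Y.card : ℝ) ≤ d * (((grow G T s).A.card : ℝ) - s.A.card) := by
    have := (Finset.card_le_card hYact).trans (card_star_le hd _)
    have h6 : (((grow G T s).A \ s.A).card : ℝ) = ((grow G T s).A.card : ℝ) - s.A.card := by
      rw [Finset.card_sdiff_of_subset (subset_grow T s), Nat.cast_sub
        (Finset.card_le_card (subset_grow T s))]
    rw [← h6]
    exact_mod_cast this
  -- The constant `12` is the `6` of `Admissible.restart` times the `2` in `Thin`.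
  have := mul_le_mul_of_nonneg_right hcard (by linarith : 0 ≤ 2 * -Real.log t)
  linarith

theorem explore_subset_clus {T : Finset (Sym2 V × Bool)} (n : ℕ) :
    (explore G x y t Λ S T n).A ⊆ clus G (bal G S n) S (lay true T ∪ lay false T) := by
  have key : ∀ j ≤ n, (explore G x y t Λ S T j).A ⊆
      clus G (bal G S n) S (lay true T ∪ lay false T) := by
    intro j
    induction j with
    | zero =>
      intro _ v hv
      exact subset_clus _ _ _ (Finset.mem_inter.2 ⟨hv, subset_bal _ _ hv⟩)
    | succ j ih =>
      intro hj v hv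
      have ih' := ih (by omega)
      have hvb : v ∈ bal G S n := bal_mono_radius S hj (explore_subset_bal T (j + 1) hv)
      rcases mem_grow.1 hv with hv | ⟨u, hu, hact⟩
      · rw [restart_A] at hv; exact ih' hv
      · rw [restart_A] at hu
        by_contra hcon
        have huc := ih' hu
        obtain ⟨hb, ho⟩ := Finset.mem_inter.1 hact
        have hadj := (mem_bd.1 hb).1
        have hcl := Finset.disjoint_left.1 (clus_closed (G := G) (bal G S n) S
          (lay true T ∪ lay false T))
        refine @hcl s(u, v) ?_ (Finset.mem_inter.2 ⟨mem_bd.2 ⟨hadj, Or.inl ⟨huc, hcon⟩⟩,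
            mem_inn.2 ⟨hadj, clus_subset _ _ _ huc, hvb⟩⟩)
        simp only [Finset.mem_union, Finset.mem_inter] at ho ⊢
        tauto
  exact key n le_rfl

end Exploration

/-! ### Comparison with deterministic growth at rate `c Φ`. -/

section Profile

variable {Φ : ℝ → ℕ} {d : ℕ}

theorem intervalIntegrable_inv_profile (hmono : Monotone Φ) {c : ℝ} (hc : 0 < c) (a b : ℝ) :
    IntervalIntegrable (fun t => 1 / (c * (Φ t : ℝ))) volume a b := by
  have hmeas : Measurable fun t => 1 / (c * (Φ t : ℝ)) := by
    have : Measurable fun t => (Φ t : ℝ) :=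
      Monotone.measurable fun _ _ h => Nat.cast_le.2 (hmono h)
    fun_prop
  refine (intervalIntegrable_const (c := 1 / c)).mono_fun hmeas.aestronglyMeasurable
    (Filter.Eventually.of_forall fun t => ?_)
  dsimp only
  rw [Real.norm_of_nonneg (by positivity), Real.norm_of_nonneg (by positivity)]
  -- Where `Φ t = 0` the integrand is `0` by the convention for division; elsewhere `Φ t ≥ 1` bounds
  -- it by `1 / c`.
  rcases Nat.eq_zero_or_pos (Φ t) with h | h
  · rw [h]; simp only [Nat.cast_zero, mul_zero, div_zero]; positivity
  · have : (1 : ℝ) ≤ Φ t := by exact_mod_cast h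
    exact one_div_le_one_div_of_le hc (by nlinarith)

/-- On a window of length `k ≥ b * Φ z` the profile stays below `Φ z + d * k ≤ (1 / b + d) * k`, so
`c * Φ ≤ k` throughout. Thus one step of growth advances the integral by a unit of time. -/
theorem one_le_integral_inv_profile (hmono : Monotone Φ) (hpos : ∀ x, 0 < x → 1 ≤ Φ x)
    (hstep : ∀ x, ∀ k : ℕ, Φ (x + k) ≤ Φ x + d * k) {c b : ℝ} (hc : 0 < c) (hb : 0 < b)
    (hcb : c * (1 / b + d) ≤ 1) {z : ℝ} (hz : 0 < z) {k : ℕ} (hk : b * Φ z ≤ k) :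
    1 ≤ ∫ t in z..(z + k), 1 / (c * (Φ t : ℝ)) := by
  have hΦz : (1 : ℝ) ≤ Φ z := by exact_mod_cast hpos z hz
  have hk0 : (0 : ℝ) < k := lt_of_lt_of_le (by positivity) hk
  have hle : z ≤ z + k := by linarith
  have hlow : ∀ t ∈ Set.Icc z (z + k), 1 / (k : ℝ) ≤ 1 / (c * (Φ t : ℝ)) := by
    intro t ht
    have h1 : (1 : ℝ) ≤ Φ t := by exact_mod_cast hpos t (hz.trans_le ht.1)
    have h2 : (Φ t : ℝ) ≤ Φ z + d * k := by exact_mod_cast (hmono ht.2).trans (hstep z k)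
    refine one_div_le_one_div_of_le (by positivity) ?_
    have h3 : (Φ z : ℝ) ≤ k / b := by rw [le_div_iff₀ hb]; linarith
    calc c * (Φ t : ℝ) ≤ c * (k / b + d * k) := by
          refine mul_le_mul_of_nonneg_left ?_ hc.le
          linarith
      _ = c * (1 / b + d) * k := by ring
      _ ≤ 1 * k := mul_le_mul_of_nonneg_right hcb hk0.le
      _ = k := one_mul _
  have := intervalIntegral.integral_mono_on hle intervalIntegrable_const
    (intervalIntegrable_inv_profile hmono hc z (z + k)) hlow
  rw [intervalIntegral.integral_const, add_sub_cancel_left, smul_eq_mul, mul_one_div_cancel hk0.ne']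
    at this
  exact this

/-- The times at which the deterministic growth with rate `c Φ` is observed. -/
theorem exists_growth_profile (hmono : Monotone Φ) (hpos : ∀ x, 0 < x → 1 ≤ Φ x)
    (hstep : ∀ x, ∀ k : ℕ, Φ (x + k) ≤ Φ x + d * k) {c b : ℝ} (hc : 0 < c) (hb : 0 < b)
    (hcb : c * (1 / b + d) ≤ 1) {a : ℝ} (ha : 0 < a) :
    ∃ v : ℕ → ℝ, (∀ n : ℕ, ∀ x : ℝ, (∫ t in a..x, 1 / (c * (Φ t : ℝ))) = (n : ℝ) ↔ x = v n) ∧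
      ∀ n : ℕ, ∀ z, a ≤ z → (n : ℝ) ≤ (∫ t in a..z, 1 / (c * (Φ t : ℝ))) → v n ≤ z := by
  set f : ℝ → ℝ := fun t => 1 / (c * (Φ t : ℝ)) with hf
  set I : ℝ → ℝ := fun x => ∫ t in a..x, f t with hI
  have hint : ∀ u w, IntervalIntegrable f volume u w := intervalIntegrable_inv_profile hmono hc
  have hadd : ∀ u w, I u + ∫ t in u..w, f t = I w := fun u w =>
    intervalIntegral.integral_add_adjacent_intervals (hint _ _) (hint _ _)
  have hfpos : ∀ t, 0 < t → 0 < f t := by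
    intro t ht
    have : (1 : ℝ) ≤ Φ t := by exact_mod_cast hpos t ht
    simp only [hf]; positivity
  have hfnn : ∀ t, 0 ≤ f t := fun t => by simp only [hf]; positivity
  have hstrict : ∀ u w, 0 ≤ u → u < w → I u < I w := by
    intro u w hu huw
    rw [← hadd u w]
    have := intervalIntegral.intervalIntegral_pos_of_pos_on (hint u w)
      (fun t ht => hfpos t (hu.trans_lt ht.1)) huw
    linarith
  have hmonoI : Monotone I := by
    intro u w huw
    rw [← hadd u w]
    have := intervalIntegral.integral_nonneg (μ := volume) huw fun t _ => hfnn t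
    linarith
  have hIa : I a = 0 := intervalIntegral.integral_same
  have hneg : ∀ x, x < a → I x < 0 := by
    intro x hx
    calc I x ≤ I (max x 0) := hmonoI (le_max_left _ _)
      _ < I a := hstrict _ _ (le_max_right _ _) (max_lt hx ha)
      _ = 0 := hIa
  have hcont : Continuous I := intervalIntegral.continuous_primitive hint a
  have hunb : ∀ n : ℕ, ∃ z, a ≤ z ∧ (n : ℝ) ≤ I z := by
    intro n
    induction n with
    | zero => exact ⟨a, le_rfl, by rw [hIa, Nat.cast_zero]⟩
    | succ n ih =>
      obtain ⟨z, hz, hn⟩ := ih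
      obtain ⟨k, hk⟩ := exists_nat_ge (b * Φ z)
      refine ⟨z + k, by linarith [Nat.cast_nonneg (α := ℝ) k], ?_⟩
      have := one_le_integral_inv_profile hmono hpos hstep hc hb hcb (ha.trans_le hz) hk
      rw [← hadd z (z + k), Nat.cast_succ]
      linarith
  have hex : ∀ n : ℕ, ∃ x, a ≤ x ∧ I x = n := by
    intro n
    obtain ⟨z, hz, hn⟩ := hunb n
    obtain ⟨x, hx, hxn⟩ := intermediate_value_Icc hz hcont.continuousOn
      (⟨by rw [hIa]; exact Nat.cast_nonneg n, hn⟩ : (n : ℝ) ∈ Set.Icc (I a) (I z))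
    exact ⟨x, hx.1, hxn⟩
  choose v hva hv using hex
  have hinj : ∀ u w, a ≤ u → a ≤ w → I u = I w → u = w := by
    intro u w hu hw h
    rcases lt_trichotomy u w with h' | h' | h'
    · exact absurd h (hstrict u w (ha.le.trans hu) h').ne
    · exact h'
    · exact absurd h (hstrict w u (ha.le.trans hw) h').ne'
  refine ⟨v, fun n x => ⟨fun h => ?_, fun h => h ▸ hv n⟩, fun n z hz hn => ?_⟩
  · refine hinj x (v n) ?_ (hva n) (h.trans (hv n).symm)
    by_contra hx
    have := hneg x (not_le.1 hx)
    have hh : I x = n := h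
    rw [hh] at this
    exact absurd this (not_lt.2 (Nat.cast_nonneg n))
  · by_contra hlt
    have := hstrict z (v n) (ha.le.trans hz) (not_le.1 hlt)
    rw [hv n] at this
    exact absurd this (not_lt.2 hn)

/-- As `Φ` rises by at most `d` per unit, the tail dominates a geometric series of ratio `exp (-(c *
d))`, and `1 - exp (-(c * d)) ≤ c * d`. For small `c * d` this absorbs constant prefactors. -/
theorem geometric_le_tail (hstep : ∀ x, ∀ k : ℕ, Φ (x + k) ≤ Φ x + d * k) {c : ℝ} (hc : 0 < c)
    (hd : 0 < d) (a : ℕ) {r : ℝ} (hr : r ≤ Real.exp (-(c * Φ a)) / (c * d)) :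
    ENNReal.ofReal r ≤ ∑' n : {n : ℕ // a ≤ n},
      ENNReal.ofReal (Real.exp (-c * (Φ ((n : ℕ) : ℝ) : ℝ))) := by
  have hd' : (0 : ℝ) < d := by exact_mod_cast hd
  set g := Real.exp (-(c * d)) with hg
  have g0 : 0 ≤ g := (Real.exp_pos _).le
  have g1 : g < 1 := by
    rw [hg, ← Real.exp_zero]
    exact Real.exp_lt_exp.2 (neg_neg_of_pos (by positivity))
  have hinj : Function.Injective fun j : ℕ => (⟨a + j, Nat.le_add_right a j⟩ : {n : ℕ // a ≤ n}) := by
    intro i j h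
    simpa using h
  refine le_trans ?_ (ENNReal.tsum_comp_le_tsum_of_injective hinj _)
  have hterm : ∀ j : ℕ, ENNReal.ofReal (Real.exp (-(c * Φ a)) * g ^ j) ≤
      ENNReal.ofReal (Real.exp (-c * (Φ ((a + j : ℕ) : ℝ) : ℝ))) := by
    intro j
    refine ENNReal.ofReal_le_ofReal ?_
    rw [hg, ← Real.exp_nat_mul, ← Real.exp_add]
    refine Real.exp_le_exp.2 ?_
    have : (Φ ((a + j : ℕ) : ℝ) : ℝ) ≤ Φ a + d * j := by
      rw [Nat.cast_add]; exact_mod_cast hstep a j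
    nlinarith
  refine le_trans ?_ (ENNReal.tsum_le_tsum hterm)
  have hsum : Summable fun j : ℕ => Real.exp (-(c * Φ a)) * g ^ j :=
    (summable_geometric_of_lt_one g0 g1).mul_left _
  rw [← ENNReal.ofReal_tsum_of_nonneg (fun j => by positivity) hsum, tsum_mul_left,
    tsum_geometric_of_lt_one g0 g1]
  refine ENNReal.ofReal_le_ofReal (hr.trans ?_)
  rw [← div_eq_mul_inv]
  refine div_le_div_of_nonneg_left (Real.exp_pos _).le (sub_pos.2 g1) ?_
  have := Real.add_one_le_exp (-(c * d))
  linarith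

end Profile

/-! ### Properties of the isoperimetric function. -/

section Isoperimetry

variable {V : Type*} [DecidableEq V] {G : SimpleGraph V} [G.LocallyFinite]

theorem isoperimetric_le {A : Finset V} {x : ℝ} (h : x ≤ A.card) :
    Perc.isoperimetric G x ≤ (bd G A).card :=
  Nat.sInf_le ⟨A, h, (ncard_edgeBoundary A).symm⟩

theorem exists_isoperimetric_eq [Infinite V] (G : SimpleGraph V) [G.LocallyFinite] (x : ℝ) :
    ∃ A : Finset V, x ≤ A.card ∧ Perc.isoperimetric G x = (bd G A).card := by
  have hne : {k | ∃ A : Finset V, x ≤ (A.card : ℝ) ∧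
      k = (Perc.edgeBoundary G (A : Set V)).ncard}.Nonempty := by
    obtain ⟨n, hn⟩ := exists_nat_ge x
    obtain ⟨A, hA⟩ := Infinite.exists_subset_card_eq V n
    exact ⟨_, A, hA.symm ▸ hn, rfl⟩
  obtain ⟨A, h1, h2⟩ := Nat.sInf_mem hne
  exact ⟨A, h1, h2.trans (ncard_edgeBoundary A)⟩

theorem isoperimetric_mono [Infinite V] : Monotone (Perc.isoperimetric G) := by
  intro x x' h
  obtain ⟨A, h1, h2⟩ := exists_isoperimetric_eq G x'
  rw [h2]
  exact isoperimetric_le (h.trans h1)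

/-- A nonempty finite set without boundary edges would contain every ball around its points, hence
the whole infinite connected graph. -/
theorem one_le_isoperimetric [Infinite V] (hconn : G.Connected) (x : ℝ) (hx : 0 < x) :
    1 ≤ Perc.isoperimetric G x := by
  obtain ⟨A, h1, h2⟩ := exists_isoperimetric_eq G x
  rw [h2, Nat.one_le_iff_ne_zero]
  intro h0
  have hbd : bd G A = ∅ := Finset.card_eq_zero.1 h0
  have hA : 0 < A.card := by exact_mod_cast hx.trans_le h1
  obtain ⟨u, hu⟩ := Finset.card_pos.1 hA
  obtain ⟨v, hv⟩ := Infinite.exists_notMem_finset A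
  obtain ⟨n, hn⟩ := exists_subset_bal hconn u {v}
  have hdis : Disjoint (inn G (bal G {u} n)) (bd G A) := by rw [hbd]; exact Finset.disjoint_empty_right _
  rcases bal_subset_or_disjoint hdis with h | h
  · exact hv (h (hn (Finset.mem_singleton_self v)))
  · exact Finset.disjoint_left.1 h (subset_bal _ _ (Finset.mem_singleton_self u)) hu

/-- Adding one vertex to a minimiser creates at most `d` boundary edges. -/
theorem isoperimetric_add_le [Infinite V] {d : ℕ} (hd : ∀ v, G.degree v ≤ d) (x : ℝ) (k : ℕ) :
    Perc.isoperimetric G (x + k) ≤ Perc.isoperimetric G x + d * k := by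
  induction k with
  | zero => simp
  | succ k ih =>
    obtain ⟨A, h1, h2⟩ := exists_isoperimetric_eq G (x + k)
    obtain ⟨v, hv⟩ := Infinite.exists_notMem_finset A
    have hins : x + (k + 1 : ℕ) ≤ (insert v A).card := by
      rw [Finset.card_insert_of_notMem hv]; push_cast; linarith
    have hsub : bd G (insert v A) ⊆ bd G A ∪ star G {v} := by
      intro e; induction e with | _ a b => ?_
      simp only [Finset.mem_union, mem_bd, mem_star, Finset.mem_insert, Finset.mem_singleton]
      tauto
    have h3 := (Finset.card_le_card hsub).trans (Finset.card_union_le _ _)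
    have h4 := card_star_le hd {v}
    rw [Finset.card_singleton, mul_one] at h4
    have h5 := isoperimetric_le (G := G) hins
    rw [Nat.mul_succ]
    omega

end Isoperimetry

/-! ### The finite clusters and the clusters of the percolation configuration. -/

section Cluster

variable {V : Type*} [DecidableEq V] {G : SimpleGraph V} [G.LocallyFinite]

theorem ball_eq_bal (S : Finset V) (n : ℕ) : Perc.ball G (S : Set V) n = bal G S n := by
  ext v
  rw [Finset.mem_coe, mem_bal]
  constructor
  · rintro ⟨s, hs, h⟩
    obtain ⟨w, hw⟩ := SimpleGraph.exists_walk_of_edist_ne_top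
      (ne_top_of_le_ne_top (ENat.natCast_ne_top n) h)
    exact ⟨s, hs, w, by rw [← hw] at h; exact_mod_cast h⟩
  · rintro ⟨s, hs, w, hw⟩
    exact ⟨s, hs, (SimpleGraph.edist_le w).trans (by exact_mod_cast hw)⟩

/-- The vertices reached by open paths form a closed set containing `S`, so minimality gives the one
inclusion that a lower bound on the cluster needs. -/
theorem clus_openF_subset (ω : Perc.Config G) (S : Finset V) (n : ℕ) :
    (clus G (bal G S n) S (openF ω (inn G (bal G S n))) : Set V) ⊆
      Perc.cluster ω (Perc.ball G (S : Set V) n) (S : Set V) := by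
  classical
  rw [ball_eq_bal]
  set X := (bal G S n).filter fun v =>
    v ∈ Perc.cluster ω (bal G S n : Set V) (S : Set V) with hX
  have hsub : clus G (bal G S n) S (openF ω (inn G (bal G S n))) ⊆ X := by
    refine clus_minimal (Finset.filter_subset _ _) ?_ ?_
    · intro v hv
      obtain ⟨h1, h2⟩ := Finset.mem_inter.1 hv
      exact Finset.mem_filter.2 ⟨h2, h2, v, h1, SimpleGraph.Reachable.refl _⟩
    · have key : ∀ a b, s(a, b) ∈ openF ω (inn G (bal G S n)) → a ∈ X → b ∈ X := by
        intro a b ho ha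
        obtain ⟨hi, he, hω⟩ := mem_openF.1 ho
        obtain ⟨hab, hA, hB⟩ := mem_inn.1 hi
        obtain ⟨-, -, s, hs, hr⟩ := Finset.mem_filter.1 ha
        refine Finset.mem_filter.2 ⟨hB, hB, s, hs, SimpleGraph.Reachable.trans
          (SimpleGraph.Adj.reachable ?_) hr⟩
        exact SimpleGraph.Adj.symm (G := Perc.openGraph ω (bal G S n : Set V)) ⟨hA, hB, hab, hω⟩
      rw [Finset.disjoint_left]
      intro e ho hb
      obtain ⟨hb, -⟩ := Finset.mem_inter.1 hb
      induction e with | _ a b => ?_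
      rcases (mem_bd.1 hb).2 with ⟨h1, h2⟩ | ⟨h1, h2⟩
      · exact h2 (key a b ho h1)
      · exact h2 (key b a (Sym2.eq_swap ▸ ho) h1)
  exact fun v hv => (Finset.mem_filter.1 (hsub hv)).2

theorem card_clus_le_ncard (ω : Perc.Config G) (S : Finset V) (n : ℕ) :
    (clus G (bal G S n) S (openF ω (inn G (bal G S n)))).card ≤
      (Perc.cluster ω (Perc.ball G (S : Set V) n) (S : Set V)).ncard := by
  rw [← Set.ncard_coe_finset]
  refine Set.ncard_le_ncard (clus_openF_subset ω S n) ?_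
  refine (Finset.finite_toSet (bal G S n)).subset fun v hv => ?_
  rw [← ball_eq_bal]
  exact hv.1

theorem clus_openF_eq (ω : Perc.Config G) {U : Finset V} (B : Finset V) {F : Finset (Sym2 V)}
    (hF : inn G U ⊆ F) : clus G U B (openF ω F) = clus G U B (openF ω (inn G U)) := by
  rw [← clus_inter U B (openF ω F)]
  congr 1
  ext e
  simp only [Finset.mem_inter, mem_openF]
  have := @hF e
  tauto

/-- Events described by finite explorations: passing to the infinite configuration. -/
theorem le_measure_of_forall_finite (p : unitInterval) (S : Finset V) (v : ℕ → ℝ) (θ : ENNReal)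
    (h : ∀ N, θ ≤ ENNReal.ofReal (ex (fun _ => (p : ℝ)) (star G (bal G S N)) fun T =>
      ind (∀ n ≤ N, v n ≤ ((clus G (bal G S n) S T).card : ℝ)))) :
    θ ≤ Perc.measure G p {ω | ∀ n : ℕ,
      v n ≤ ((Perc.cluster ω (Perc.ball G (S : Set V) n) (S : Set V)).ncard : ℝ)} := by
  set E : ℕ → Set (Perc.Config G) := fun N => {ω | ∀ n ≤ N,
    v n ≤ ((clus G (bal G S n) S (openF ω (inn G (bal G S n)))).card : ℝ)}
  have hE : ∀ N, E N = {ω | ∀ n ≤ N, v n ≤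
      ((clus G (bal G S n) S (openF ω (star G (bal G S N)))).card : ℝ)} := by
    intro N
    ext ω
    refine forall_congr' fun n => forall_congr' fun hn => ?_
    rw [clus_openF_eq ω S ((inn_subset_star _).trans (star_mono (bal_mono_radius S hn)))]
  have hF : ∀ N, ∀ e ∈ star G (bal G S N), e ∈ G.edgeSet := fun N e he => adj_of_mem_star he
  have hmeas : ∀ N, MeasurableSet (E N) := by
    intro N
    rw [hE]
    exact measurableSet_event (fun T => ∀ n ≤ N, v n ≤ ((clus G (bal G S n) S T).card : ℝ)) (hF N)
  have hprob : ∀ N, θ ≤ Perc.measure G p (E N) := by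
    intro N
    have := measureReal_event p (fun T => ∀ n ≤ N, v n ≤ ((clus G (bal G S n) S T).card : ℝ)) (hF N)
    rw [← hE] at this
    have h' := h N
    rwa [← this, ofReal_measureReal] at h'
  have hanti : Antitone E := fun N N' hN ω hω n hn => hω n (hn.trans hN)
  have hlim := hanti.measure_iInter (μ := Perc.measure G p) (fun N => (hmeas N).nullMeasurableSet)
    ⟨0, measure_ne_top _ _⟩
  refine (le_iInf hprob).trans (hlim.symm.le.trans (measure_mono fun ω hω n => ?_))
  exact (Set.mem_iInter.1 hω n n le_rfl).trans (by exact_mod_cast card_clus_le_ncard ω S n)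

end Cluster

/-! ### From the exploration to percolation. -/

section Growth

variable {V : Type*} [DecidableEq V] {G : SimpleGraph V} [G.LocallyFinite]

/-- Transfer from the exploration with two coins to percolation. -/
theorem ex_clus_ge {x y t p : ℝ} (hx : 0 ≤ x ∧ x < 1) (hy : 0 ≤ y ∧ y < 1) (ht : 0 < t ∧ t < 1)
    (hp : 1 - (1 - x) * (1 - y) ≤ p) (hp1 : p ≤ 1) {S : Finset V} {N : ℕ} {v : ℕ → ℝ}
    (h1 : 1 ≤ sepCost G x y t (bal G S N) S (bd G S))
    (hv : ∀ T, (∀ n ≤ N, ¬ BadRestart G x y t (bal G S N) (explore G x y t (bal G S N) S T n) T) →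
      ∀ n ≤ N, v n ≤ ((explore G x y t (bal G S N) S T n).A.card : ℝ)) :
    1 - 2 * Real.exp (-sepCost G x y t (bal G S N) S (bd G S) / 2) ≤
      ex (fun _ => p) (star G (bal G S N)) fun T =>
        ind (∀ n ≤ N, v n ≤ ((clus G (bal G S n) S T).card : ℝ)) := by
  set Λ := bal G S N
  set Q : Finset (Sym2 V) → Prop := fun T => ∀ n ≤ N, v n ≤ ((clus G (bal G S n) S T).card : ℝ)
  have c0 := fun c => (coin_mem (V := V) hx hy c).1
  have c1 := fun c => (coin_mem (V := V) hx hy c).2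
  have hbad := ex_exists_BadRestart_le hx hy ht h1 N (subset_rfl : bal G S N ⊆ Λ)
  have hanti : Antitone fun T => ind (¬ Q T) := by
    intro T T' h
    refine ind_mono (mt fun hQ n hn => (hQ n hn).trans ?_)
    exact_mod_cast Finset.card_le_card (clus_mono subset_rfl h)
  have hdens : ex (fun _ => p) (star G Λ) (fun T => ind (¬ Q T)) ≤
      ex (fun _ => 1 - (1 - x) * (1 - y)) (star G Λ) fun T => ind (¬ Q T) :=
    ex_antitone_density (fun _ => (superpose_mem ⟨hx.1, hx.2.le⟩ ⟨hy.1, hy.2.le⟩).1) (fun _ => hp1)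
      (fun _ _ => hp) hanti
  have hcoins : ex (fun _ => 1 - (1 - x) * (1 - y)) (star G Λ) (fun T => ind (¬ Q T)) =
      ex (fun c : Sym2 V × Bool => if c.2 then x else y) (star G Λ ×ˢ Finset.univ)
        fun T => ind (¬ Q (lay true T ∪ lay false T)) := by
    rw [ex_lay _ (star G Λ) fun T T' => ind (¬ Q (T ∪ T'))]
    exact ex_superpose (fun _ => x) (fun _ => y) (star G Λ) fun T => ind (¬ Q T)
  have hle : ex (fun c : Sym2 V × Bool => if c.2 then x else y) (star G Λ ×ˢ Finset.univ)
        (fun T => ind (¬ Q (lay true T ∪ lay false T))) ≤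
      ex (fun c : Sym2 V × Bool => if c.2 then x else y) (star G Λ ×ˢ Finset.univ)
        (fun T => ind (∃ n ≤ N, BadRestart G x y t Λ (explore G x y t Λ S T n) T)) := by
    refine ex_mono c0 c1 fun T _ => ind_mono fun hQ => ?_
    by_contra! hgood
    refine hQ fun n hn => (hv T hgood n hn).trans ?_
    exact_mod_cast Finset.card_le_card (explore_subset_clus n)
  have hnot : ex (fun _ => p) (star G Λ) (fun T => ind (¬ Q T)) =
      1 - ex (fun _ => p) (star G Λ) fun T => ind (Q T) := by
    simp only [ind_not]
    rw [ex_sub, ex_const]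
  change _ ≤ ex (fun _ => p) (star G Λ) fun T => ind (Q T)
  linarith

end Growth

end PercGrowth

/-! ### Choice of constants and conclusion. -/

open PercGrowth in
theorem theorem7p1 {V : Type*} [Infinite V] (G : SimpleGraph V)
    (hlf : ∀ v : V, (G.neighborSet v).Finite) (hconn : G.Connected) (htrans : Perc.Transitive G)
    (o : V) (p : unitInterval) (hp : Perc.criticalPoint G o < (p : ℝ)) :
    ∃ c : ℝ, 0 < c ∧ ∀ S : Finset V, S.Nonempty →
      ∃ v : ℕ → ℝ,
        (∀ n : ℕ, ∀ x : ℝ,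
          (∫ t in (S.card : ℝ)..x, 1 / (c * (Perc.isoperimetric G t : ℝ))) = (n : ℝ) ↔ x = v n) ∧
        1 - ∑' n : {n : ℕ // S.card ≤ n},
            ENNReal.ofReal (Real.exp (-c * (Perc.isoperimetric G ((n : ℕ) : ℝ) : ℝ))) ≤
          Perc.measure G p {ω | ∀ n : ℕ,
            v n ≤ ((Perc.cluster ω (Perc.ball G (S : Set V) n) (S : Set V)).ncard : ℝ)} := by
  classical
  have : G.LocallyFinite := fun v => (hlf v).fintype
  have hp1 : (p : ℝ) ≤ 1 := p.2.2
  -- The extra `1` makes `d` visibly positive, since it occurs in denominators.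
  set d : ℕ := G.degree o + 1 with hd_def
  have hd : ∀ v, G.degree v ≤ d := by
    intro v
    obtain ⟨φ, rfl⟩ := htrans o v
    rw [φ.degree_eq]; omega
  have hd0 : (0 : ℝ) < d := by exact_mod_cast Nat.succ_pos _
  obtain ⟨π, hπ0, -, hπp, hball⟩ := exists_radius hconn htrans o hp
  set Δ : ℝ := p - π with hΔ
  have hΔ0 : 0 < Δ := sub_pos.2 hπp
  have hΔ1 : Δ ≤ 1 := by linarith
  -- As `x + y = p`, the two coins superpose to density at most `p`. After thinning by `1 - t`, `y`
  -- still carries the layers `δ = q = Δ / 8`, and `x` carries them on top of `π`.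
  set x : ℝ := π + Δ / 2 with hx_def
  set y : ℝ := Δ / 2 with hy_def
  set t : ℝ := Δ / 4 with ht_def
  have hx : 0 ≤ x ∧ x < 1 := ⟨by positivity, by linarith⟩
  have hy : 0 ≤ y ∧ y < 1 := ⟨by positivity, by linarith⟩
  have ht : 0 < t ∧ t < 1 := ⟨by positivity, by linarith⟩
  have hxyp : 1 - (1 - x) * (1 - y) ≤ p := by nlinarith [mul_nonneg hx.1 hy.1]
  obtain ⟨c₁, hc₁, hbase⟩ := exists_ex_Sep_le_exp (G := G) (π := π) (δ := Δ / 8) (q := Δ / 8)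
    ⟨hπ0, by linarith⟩ ⟨by positivity, by linarith⟩ ⟨by positivity, by linarith⟩ hd hball
  have hcost : ∀ A Λ : Finset V, A ⊆ Λ →
      c₁ * Perc.isoperimetric G A.card ≤ sepCost G x y t Λ A (bd G A) := by
    intro A Λ hA
    have hlow := hbase A Λ hA (fun e => mixDens G x y A e * (1 - t))
      (fun e => (mixDens_mul_mem hx hy ht A e).2.le) ?_ ?_ (Perc.isoperimetric G A.card)
      (fun L hL => isoperimetric_le (by exact_mod_cast Finset.card_le_card hL))
    · have hP : sepProb G x y t Λ A (bd G A) ≤ Real.exp (-(c₁ * Perc.isoperimetric G A.card)) := by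
        rw [sepProb, Finset.sdiff_self]
        simpa only [Finset.sdiff_empty] using hlow
      have := Real.log_le_log (sepProb_pos hx hy ht hA _) hP
      rw [Real.log_exp] at this
      unfold sepCost
      linarith
    · intro e
      unfold mixDens
      split_ifs <;> nlinarith
    · intro e he
      have : e ∉ bd G A := fun h => he (bd_subset_star A h)
      simp only [mixDens, if_neg this]
      have h1 := mul_nonneg ht.1.le (sub_nonneg.2 hx.2.le)
      have h2 : 0 ≤ (1 - π) * (Δ / 8 * (Δ / 8)) := mul_nonneg (by linarith) (by positivity)
      have h3 := mul_nonneg hπ0 hΔ0.le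
      linarith
  set ℓ : ℝ := -Real.log t with hℓ
  have hℓ0 : 0 < ℓ := neg_pos.2 (Real.log_neg ht.1 ht.2)
  -- A step adds at least cost over `12 * ℓ * d` vertices, and the cost is at least `c₁` times the
  -- profile.
  set b : ℝ := c₁ / (12 * ℓ * d) with hb
  have hb0 : 0 < b := by positivity
  -- The first bound passes from half the initial cost to `c * K`, the second lets the tail sum
  -- absorb a factor `2`, and the third makes one step of growth worth a unit of the integral.
  set c : ℝ := min (c₁ / 2) (min (1 / (2 * d)) (1 / (1 / b + d))) with hc
  have hc0 : 0 < c := by positivity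
  have hcc₁ : c ≤ c₁ / 2 := min_le_left _ _
  have hcd : c * d ≤ 1 / 2 := by
    have : c ≤ 1 / (2 * d) := (min_le_right _ _).trans (min_le_left _ _)
    calc c * d ≤ 1 / (2 * d) * d := mul_le_mul_of_nonneg_right this hd0.le
      _ = 1 / 2 := by field_simp
  have hcb : c * (1 / b + d) ≤ 1 := by
    have : c ≤ 1 / (1 / b + d) := (min_le_right _ _).trans (min_le_right _ _)
    rwa [le_div_iff₀ (by positivity)] at this
  have hmono : Monotone (Perc.isoperimetric G) := isoperimetric_mono
  have hpos := one_le_isoperimetric hconn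
  have hstep := isoperimetric_add_le hd
  refine ⟨c, hc0, fun S hS => ?_⟩
  have hS0 : (0 : ℝ) < S.card := by exact_mod_cast hS.card_pos
  obtain ⟨v, hv, hvle⟩ := exists_growth_profile hmono hpos hstep hc0 hb0 hcb hS0
  refine ⟨v, hv, ?_⟩
  set K : ℝ := ((Perc.isoperimetric G (S.card : ℝ) : ℕ) : ℝ) with hK
  have hK0 : 0 ≤ K := Nat.cast_nonneg _
  have htail : ∀ r, r ≤ Real.exp (-(c * K)) / (c * d) → ENNReal.ofReal r ≤
      ∑' n : {n : ℕ // S.card ≤ n},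
        ENNReal.ofReal (Real.exp (-c * (Perc.isoperimetric G ((n : ℕ) : ℝ) : ℝ))) :=
    fun r hr => geometric_le_tail hstep hc0 (Nat.succ_pos _) S.card hr
  have hcd0 : 0 < c * d := by positivity
  have hexp2 : 2 * Real.exp (-(c * K)) ≤ Real.exp (-(c * K)) / (c * d) := by
    rw [le_div_iff₀ hcd0]
    nlinarith [Real.exp_pos (-(c * K))]
  -- In this case the tail sum is at least `1` and the bound is trivial. Otherwise the initial cost
  -- is at least `1`, as the sum over restarts requires.
  by_cases hsmall : c₁ * K < 1
  · have hone : (1 : ENNReal) ≤ ∑' n : {n : ℕ // S.card ≤ n},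
        ENNReal.ofReal (Real.exp (-c * (Perc.isoperimetric G ((n : ℕ) : ℝ) : ℝ))) := by
      rw [← ENNReal.ofReal_one]
      refine htail 1 (le_trans ?_ hexp2)
      have h1 := Real.add_one_le_exp (-(c * K))
      have h2 : c * K ≤ c₁ / 2 * K := mul_le_mul_of_nonneg_right hcc₁ hK0
      linarith
    rw [tsub_eq_zero_of_le hone]
    exact zero_le
  refine le_measure_of_forall_finite p S v _ fun N => ?_
  have hcostS : c₁ * K ≤ sepCost G x y t (bal G S N) S (bd G S) := hcost S _ (subset_bal S N)
  have hmain := ex_clus_ge hx hy ht hxyp hp1 (S := S) (N := N) (v := v)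
    ((not_lt.1 hsmall).trans hcostS) ?_
  · refine le_trans ?_ (ENNReal.ofReal_le_ofReal hmain)
    rw [ENNReal.ofReal_sub _ (by positivity), ENNReal.ofReal_one]
    refine tsub_le_tsub_left (htail _ (le_trans ?_ hexp2)) 1
    refine mul_le_mul_of_nonneg_left (Real.exp_le_exp.2 ?_) two_pos.le
    have h2 : c * K ≤ c₁ / 2 * K := mul_le_mul_of_nonneg_right hcc₁ hK0
    linarith
  · intro T hgood n hn
    refine hvle n _ (by exact_mod_cast Finset.card_le_card (subset_explore T n)) ?_
    induction n with
    | zero =>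
      change ((0 : ℕ) : ℝ) ≤ ∫ t in (S.card : ℝ)..(S.card : ℝ), _
      rw [intervalIntegral.integral_same, Nat.cast_zero]
    | succ n ih =>
      have ih := ih (by omega)
      have hgrow := card_explore_succ_ge hx hy ht hd (subset_rfl : bal G S N ⊆ bal G S N) hgood n
        (by omega)
      set A := (explore G x y t (bal G S N) S T n).A with hA
      set A' := (explore G x y t (bal G S N) S T (n + 1)).A with hA'
      have hAA' : A ⊆ A' := explore_subset_succ T n
      obtain ⟨k, hk⟩ := Nat.exists_eq_add_of_le (Finset.card_le_card hAA')
      have hkr : (A'.card : ℝ) = A.card + k := by exact_mod_cast hk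
      have hAΛ : A ⊆ bal G S N := (explore_subset_bal T n).trans (bal_mono_radius S (by omega))
      have hbk : b * Perc.isoperimetric G A.card ≤ k := by
        have h1 := (hcost A _ hAΛ).trans hgrow
        rw [hkr, add_sub_cancel_left, ← hℓ] at h1
        rw [hb, div_mul_eq_mul_div, div_le_iff₀ (by positivity)]
        linarith
      have hA0 : (0 : ℝ) < A.card :=
        hS0.trans_le (by exact_mod_cast Finset.card_le_card (subset_explore T n))
      have hint := one_le_integral_inv_profile hmono hpos hstep hc0 hb0 hcb hA0 hbk
      rw [hkr, ← intervalIntegral.integral_add_adjacent_intervals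
        (intervalIntegrable_inv_profile hmono hc0 _ (A.card : ℝ))
        (intervalIntegrable_inv_profile hmono hc0 _ _), Nat.cast_succ]
      exact add_le_add ih hint
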